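/- **Setting.** Let $g>0$ and let $\pi_1=\pi_1(\Sigma_{g,1})$ be the free group on symplectic generators $\mathbf u_1,\mathbf v_1,\dots,\mathbf u_g,\mathbf v_g$, with boundary word $\partial=\prod_{i=1}^g[\mathbf u_i,\mathbf v_i]$. Let $H=H_1(\Sigma_{g,1};\mathbb Q)$, with intersection pairing normalized by $u_i\cdot v_i=1$, and let $\widehat T=\prod_{n\ge 0}H^{\otimes n}$ be the completed tensor algebra, filtered by $\widehat T_p=\prod_{n\ge p}H^{\otimes n}$. Let $\mathcal L_n\subset H^{\otimes n}$ be the degree $n$ part of the free Lie algebra on $H$. Define $h$ by $X+Y+h(X,Y)=\log(\exp X\exp Y)$ (the Hausdorff series), and let $(\cdot)_{(n)}$ denote the component of degree $n$. We identify $H\otimes H^{\otimes n}\cong \mathrm{Hom}(H,H^{\otimes n})$ by Poincaré duality, $u\otimes w\mapsto\big(x\mapsto (u\cdot x)\,w\big)$. A trivalent bordered fatgraph $G$ is a finite connected graph with a cyclic order on the half-edges at each vertex, with exactly one boundary cycle (after arriving at a vertex along an oriented edge one leaves along the next edge in the cyclic order), all of whose vertices are trivalent except for one univalent vertex; the edge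 $\mathbf t$ at that vertex, oriented away from it, is the tail. It has genus $g$ if gluing a disc to the boundary cycle gives a closed surface of genus $g$. Let $\bar{\mathbf x}$ denote the oriented edge $\mathbf x$ with reversed orientation. A ($\pi$-)marking of $G$ assigns to each oriented edge an element of $\pi_1$ such that $\pi(\bar{\mathbf x})\pi(\mathbf x)=1$; such that $\pi(\mathbf x)\pi(\mathbf y)\pi(\mathbf z)=1$ whenever $\mathbf x,\mathbf y,\mathbf z$ are the cyclically ordered edges pointing into a trivalent vertex; such that the values generate $\pi_1$; and such that $\pi(\bar{\mathbf t})=\partial$. We write $\mathbf x$ also for $\pi(\mathbf x)$, and $x\in H$ for its homology class. For a trivalent marked bordered fatgraph $G$ of genus $g$, define $\ell=\ell^G$ on oriented edges through its homogeneous components: $\ell_0(\mathbf x)=0$, $\ell_1(\mathbf x)=x$, and for $n\ge2$ $$\ell_n(\mathbf x)=-\tfrac13\sum_{i=1}^k h\big(\ell(\mathbf f_{i-1}),-\ell(\mathbf f_i)\big)_{(n)}$$ if the path $\mathbf f_0=\mathbf x,\dots,\mathbf f_k=\bar{\mathbf x}$ along the boundary cycle does not pass around the univalent vertex (that is, does not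 contain the step from $\bar{\mathbf t}$ to $\mathbf t$), and $\ell_n(\mathbf x)=-\ell_n(\bar{\mathbf x})$ otherwise. (Only the $\ell_j$ with $j<n$ enter the right-hand side.) The fatgraph Magnus expansion $\theta^G:\pi_1\to 1+\widehat T_1$ is the group homomorphism with $\theta^G(\mathbf x)\equiv 1+x \bmod \widehat T_2$ for all $\mathbf x\in\pi_1$ and $\theta^G(\mathbf x)=\exp(\ell^G(\mathbf x))$ for all oriented edges $\mathbf x$ of $G$. A Whitehead move $G\to G'$ between trivalent marked bordered fatgraphs of genus $g$ is taken along a non-tail edge $\mathbf e$ of $G$ with distinct endpoints: it collapses $\mathbf e$ and expands the resulting $4$-valent vertex in the other way to a new edge $\mathbf f$. The labels are such that the cyclically ordered edges pointing into the two endpoints of $\mathbf e$ are $(\mathbf a,\mathbf b,\mathbf e)$ and $(\mathbf c,\mathbf d,\bar{\mathbf e})$; in $G'$ these vertices are replaced by $(\mathbf d,\mathbf a,\mathbf f)$ and $(\mathbf b,\mathbf c,\bar{\mathbf f})$, and everything else, including the markings of all edges other than $\mathbf e,\mathbf f$, is unchanged. Let $IA(\widehat T)$ be the group of filtration-preserving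 algebra automorphisms of $\widehat T$ that act trivially on $\widehat T_1/\widehat T_2$. The fatgraph Johnson map $\tau^{GG'}\in IA(\widehat T)$ is the element with $\tau^{GG'}\circ\theta^{G'}=\theta^G$, and $\tau^{GG'}_m\in \mathrm{Hom}(H,H^{\otimes(m+1)})\cong H\otimes H^{\otimes (m+1)}$ is the degree $m+1$ component of $\tau^{GG'}|_H-\mathrm{id}_H$. **Theorem 5.4.** For every Whitehead move $G\to G'$, labeled as above, the expansions $\theta^G$, $\theta^{G'}$ and the map $\tau^{GG'}$ exist and $\tau^{GG'}$ is unique. For every $m\ge1$, $\tau^{GG'}_m$ lies in $H\otimes\mathcal L_{m+1}$, and, with $\ell=\ell^G$, $$3\,\tau^{GG'}_m=a\otimes h(\ell(\mathbf b),\ell(\mathbf c))_{(m+1)}+b\otimes\big(h(\ell(\mathbf b),\ell(\mathbf c))-h(\ell(\mathbf c),\ell(\mathbf d))\big)_{(m+1)}+c\otimes h(\ell(\mathbf a),\ell(\mathbf b))_{(m+1)}.$$ -/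

import Mathlib

open scoped TensorProduct

namespace FatgraphJohnson

noncomputable section

/-! ## The surface group, its homology, and Poincare duality -/

/-- The fundamental group of the surface of genus `g` with one boundary component: the free group
on the symplectic generators `u i = of (inl i)` and `v i = of (inr i)`. -/
abbrev SurfaceGroup (g : ℕ) : Type := FreeGroup (Fin g ⊕ Fin g)

/-- The boundary word `[u₁,v₁] ⋯ [u_g,v_g]`, where `[u,v] = u v u⁻¹ v⁻¹`. -/
def boundaryWord (g : ℕ) : SurfaceGroup g :=
  (List.ofFn fun i : Fin g =>
    FreeGroup.of (Sum.inl i) * FreeGroup.of (Sum.inr i) *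
      (FreeGroup.of (Sum.inl i))⁻¹ * (FreeGroup.of (Sum.inr i))⁻¹).prod

/-- The first rational homology of the surface, in the basis of the classes of the `u i`, `v i`. -/
abbrev Hlgy (g : ℕ) : Type := Fin g ⊕ Fin g → ℚ

/-- The homology class `[x] ∈ H` of an element of the surface group, as a homomorphism. -/
def homologyHom (g : ℕ) : SurfaceGroup g →* Multiplicative (Hlgy g) :=
  FreeGroup.lift fun i => Multiplicative.ofAdd (Pi.single i 1)

/-- The homology class `[x] ∈ H` of an element of the surface group. -/
def homologyClass {g : ℕ} (x : SurfaceGroup g) : Hlgy g :=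
  Multiplicative.toAdd (homologyHom g x)

/-- The homology intersection pairing: `u i · v i = 1 = - (v i · u i)`, all other pairings of
basis elements vanish. -/
def intersection (g : ℕ) : LinearMap.BilinForm ℚ (Hlgy g) :=
  LinearMap.mk₂ ℚ
    (fun x y => ∑ i : Fin g, (x (Sum.inl i) * y (Sum.inr i) - x (Sum.inr i) * y (Sum.inl i)))
    (by intros; simp only [Pi.add_apply, ← Finset.sum_add_distrib]; congr 1; ext; ring)
    (by intros; simp only [Pi.smul_apply, smul_eq_mul, Finset.mul_sum]; congr 1; ext; ring)
    (by intros; simp only [Pi.add_apply, ← Finset.sum_add_distrib]; congr 1; ext; ring)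
    (by intros; simp only [Pi.smul_apply, smul_eq_mul, Finset.mul_sum]; congr 1; ext; ring)

theorem intersection_apply {g : ℕ} (x y : Hlgy g) :
    intersection g x y =
      ∑ i : Fin g, (x (Sum.inl i) * y (Sum.inr i) - x (Sum.inr i) * y (Sum.inl i)) := rfl

theorem intersection_nondegenerate (g : ℕ) : (intersection g).Nondegenerate := by
  constructor
  · intro x hx
    funext k
    rcases k with i | i
    · simpa [intersection_apply, Pi.single_apply] using hx (Pi.single (Sum.inr i) 1)
    · simpa [intersection_apply, Pi.single_apply] using hx (Pi.single (Sum.inl i) 1)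
  · intro x hx
    funext k
    rcases k with i | i
    · simpa [intersection_apply, Pi.single_apply] using hx (Pi.single (Sum.inr i) 1)
    · simpa [intersection_apply, Pi.single_apply] using hx (Pi.single (Sum.inl i) 1)

/-- The tensor algebra `⨁ H^{⊗ n}` of `H`; the summand `H^{⊗ n}` is `tensorPower g n`. -/
abbrev TA (g : ℕ) : Type := TensorAlgebra ℚ (Hlgy g)

/-- `H^{⊗ n}` inside the tensor algebra. -/
def tensorPower (g n : ℕ) : Submodule ℚ (TA g) :=
  LinearMap.range (TensorAlgebra.ι ℚ (M := Hlgy g)) ^ n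

attribute [local instance] LieRing.ofAssociativeRing in
/-- `L_n`: the degree `n` part of the free Lie algebra on `H`, the latter being realised as the
Lie subalgebra of the tensor algebra (with the commutator bracket) generated by `H`. -/
def freeLiePart (g n : ℕ) : Submodule ℚ (TA g) :=
  (LieSubalgebra.lieSpan ℚ (TA g) (Set.range (TensorAlgebra.ι ℚ (M := Hlgy g)))).toSubmodule ⊓
    tensorPower g n

/-- `H ⊗ L_n` inside `H ⊗ T(H)`. -/
def tensorLie (g n : ℕ) : Submodule ℚ (Hlgy g ⊗[ℚ] TA g) :=
  LinearMap.range (LinearMap.lTensor (Hlgy g) (freeLiePart g n).subtype)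

/-- The identification `H ⊗ T ≃ Hom (H, T)` by Poincare duality `H ≃ H^*`, `u ↦ (u · -)`:
the tensor `u ⊗ w` is sent to `x ↦ (u · x) w`. -/
def dualityEquiv (g : ℕ) : (Hlgy g ⊗[ℚ] TA g) ≃ₗ[ℚ] (Hlgy g →ₗ[ℚ] TA g) :=
  (TensorProduct.congr
    (LinearMap.BilinForm.toDual (intersection g) (intersection_nondegenerate g))
    (LinearEquiv.refl ℚ (TA g))).trans
  (dualTensorHomEquiv ℚ (Hlgy g) (TA g))

theorem dualityEquiv_tmul {g : ℕ} (u : Hlgy g) (w : TA g) (x : Hlgy g) :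
    dualityEquiv g (u ⊗ₜ[ℚ] w) x = intersection g u x • w := rfl

/-! ## The completed tensor algebra

The completed tensor algebra `∏ H^{⊗ n}` is realised inside the power series ring `T(H)⟦X⟧` in a
central variable `X`: the series `∑ wₙ Xⁿ` with `wₙ ∈ H^{⊗ n}` stands for the element with
homogeneous components `wₙ`. -/

/-- The completed tensor algebra of `H`. -/
def CompletedTensor (g : ℕ) : Subalgebra ℚ (PowerSeries (TA g)) where
  carrier := {f | ∀ n, PowerSeries.coeff n f ∈ tensorPower g n}
  mul_mem' := by
    intro f f' hf hf' n
    rw [PowerSeries.coeff_mul]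
    refine Submodule.sum_mem _ fun p hp => ?_
    rw [← Finset.HasAntidiagonal.mem_antidiagonal.mp hp, tensorPower, pow_add]
    exact Submodule.mul_mem_mul (hf _) (hf' _)
  add_mem' := by
    intro f f' hf hf' n
    rw [map_add]
    exact Submodule.add_mem _ (hf n) (hf' n)
  algebraMap_mem' := by
    intro r n
    rw [PowerSeries.algebraMap_apply, PowerSeries.coeff_C]
    split_ifs with h
    · subst h
      rw [tensorPower, pow_zero]
      exact Submodule.algebraMap_mem r
    · exact Submodule.zero_mem _

/-- The homogeneous component of degree `n` of an element of the completed tensor algebra. -/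
def component {g : ℕ} (n : ℕ) (w : CompletedTensor g) : TA g :=
  PowerSeries.coeff n (w : PowerSeries (TA g))

/-- `w` lies in the ideal `∏_{n ≥ p} H^{⊗ n}`. -/
def InFiltration {g : ℕ} (p : ℕ) (w : CompletedTensor g) : Prop :=
  ∀ n < p, component n w = 0

/-- The inclusion of `H` in the completed tensor algebra, as the part of degree one. -/
def ofH {g : ℕ} : Hlgy g →ₗ[ℚ] CompletedTensor g where
  toFun x := ⟨PowerSeries.monomial 1 (TensorAlgebra.ι ℚ x), by
    intro n
    rw [PowerSeries.coeff_monomial]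
    split_ifs with h
    · subst h
      rw [tensorPower, pow_one]
      exact LinearMap.mem_range_self _ _
    · exact Submodule.zero_mem _⟩
  map_add' x y := by
    apply Subtype.ext
    simp
  map_smul' r x := by
    apply Subtype.ext
    refine PowerSeries.ext fun n => ?_
    simp [PowerSeries.coeff_monomial]

/-- Membership in `IA`: the algebra automorphism `U` preserves the filtration and acts trivially
on the first graded quotient. -/
def IsIA {g : ℕ} (U : CompletedTensor g ≃ₐ[ℚ] CompletedTensor g) : Prop :=
  (∀ p w, InFiltration p (U w) ↔ InFiltration p w) ∧
    ∀ w, InFiltration 1 w → InFiltration 2 (U w - w)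

/-- The component of `U|_H - id_H` in `Hom (H, H^{⊗ (m+1)})`. -/
def homComponent {g : ℕ} (U : CompletedTensor g ≃ₐ[ℚ] CompletedTensor g) (m : ℕ) :
    Hlgy g →ₗ[ℚ] TA g :=
  (PowerSeries.coeff (R := TA g) (m + 1)).restrictScalars ℚ ∘ₗ (CompletedTensor g).val.toLinearMap ∘ₗ
    (U.toLinearMap ∘ₗ ofH - ofH)

/-- The component of `U|_H - id_H` in `Hom (H, H^{⊗ (m+1)})`, written as a tensor in
`H ⊗ H^{⊗ (m+1)}` by Poincare duality. -/
def tensorComponent {g : ℕ} (U : CompletedTensor g ≃ₐ[ℚ] CompletedTensor g) (m : ℕ) :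
    Hlgy g ⊗[ℚ] TA g :=
  (dualityEquiv g).symm (homComponent U m)

/-- The exponential of a series without constant term. -/
def expSeries {g : ℕ} (Y : PowerSeries (TA g)) : PowerSeries (TA g) :=
  PowerSeries.mk fun n =>
    ∑ k ∈ Finset.range (n + 1), ((k.factorial : ℚ)⁻¹) • PowerSeries.coeff n (Y ^ k)

/-- The logarithm of a series with constant term one:
`log Z = ∑_{k ≥ 1} (-1)^(k+1) / k (Z - 1)^k`. -/
def logSeries {g : ℕ} (Z : PowerSeries (TA g)) : PowerSeries (TA g) :=
  PowerSeries.mk fun n =>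
    ∑ k ∈ Finset.Icc 1 n, ((-1 : ℚ) ^ (k + 1) / (k : ℚ)) • PowerSeries.coeff n ((Z - 1) ^ k)

/-- The Hausdorff series without its linear part: `Y + Z + h (Y, Z) = log (exp Y exp Z)`. -/
def hausdorff {g : ℕ} (Y Z : PowerSeries (TA g)) : PowerSeries (TA g) :=
  logSeries (expSeries Y * expSeries Z) - Y - Z

/-- A generalized Magnus expansion of the surface group over `ℚ`. -/
def IsMagnusExpansion {g : ℕ} (θ : SurfaceGroup g →* CompletedTensor g) : Prop :=
  ∀ x, component 0 (θ x) = 1 ∧ component 1 (θ x) = TensorAlgebra.ι ℚ (homologyClass x)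

/-! ## Fatgraphs -/

/-- A trivalent once-bordered fatgraph with set of oriented edges `D`. An oriented edge `x` is
regarded as pointing into its terminal vertex, `bar x` is `x` with the opposite orientation, and
`next x` is the successor of `x` in the cyclic order of the oriented edges pointing into the
terminal vertex of `x`. Vertices are the cycles of `next`, edges are the cycles of `bar`. The tail
points away from the univalent vertex. Having only one boundary cycle forces connectedness. -/
structure Fatgraph (D : Type*) where
  bar : Equiv.Perm D
  bar_bar : ∀ x, bar (bar x) = x
  bar_ne : ∀ x, bar x ≠ x
  next : Equiv.Perm D
  tail : D
  univalent : next (bar tail) = bar tail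
  trivalent : ∀ x, x ≠ bar tail → next x ≠ x ∧ next (next (next x)) = x
  one_boundary : ∀ x y, (bar * next : Equiv.Perm D).SameCycle x y

namespace Fatgraph

variable {D : Type*} (G : Fatgraph D)

/-- The successor along the boundary cycle: after running along `x` into its terminal vertex, one
leaves along the next edge in the cyclic order. -/
def boundary : Equiv.Perm D := G.bar * G.next

/-- The number of cycles (including fixed points) of a permutation. -/
def numCycles (p : Equiv.Perm D) : ℕ := Nat.card (Quotient (Equiv.Perm.SameCycle.setoid p))

/-- The closed surface obtained by gluing a disc to each boundary cycle has genus `g`: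
`V - E + F = 2 - 2 g`. -/
def HasGenus (g : ℕ) : Prop :=
  (numCycles G.next : ℤ) - numCycles G.bar + numCycles G.boundary = 2 - 2 * g

/-- The number of steps of the path along the boundary cycle from `x` to `bar x`. -/
def pathLength (x : D) : ℕ := sInf {k | (G.boundary ^ k) x = G.bar x}

/-- The path along the boundary cycle from `x` to `bar x` does not turn around the univalent
vertex, that is, it does not take the step from `bar tail` to `tail`. -/
def AvoidsTail (x : D) : Prop := ∀ i < G.pathLength x, (G.boundary ^ i) x ≠ G.bar G.tail

end Fatgraph

/-- A trivalent once-bordered fatgraph of genus `g` with a `π`-marking `mark`. -/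
structure MarkedFatgraph (g : ℕ) (D : Type*) extends Fatgraph D where
  genus : toFatgraph.HasGenus g
  mark : D → SurfaceGroup g
  orientation : ∀ x, mark (bar x) * mark x = 1
  vertex_compatibility : ∀ x, x ≠ bar tail → mark x * mark (next x) * mark (next (next x)) = 1
  full_rank : Subgroup.closure (Set.range mark) = ⊤
  geometricity : mark (bar tail) = boundaryWord g

namespace MarkedFatgraph

variable {g : ℕ} {D : Type*} (G : MarkedFatgraph g D)

/-- The `H`-marking of an oriented edge. -/
def hmark (x : D) : Hlgy g := homologyClass (G.mark x)

open Classical in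
/-- The homogeneous components `ℓ_n (x)`, defined recursively: `ℓ_0 (x) = 0`, `ℓ_1 (x)` is the
`H`-marking of `x`, and for `n ≥ 2`
`ℓ_n (x) = - (1/3) ∑ h (ℓ (f_{i-1}), - ℓ (f_i))_(n)`,
the sum running over the path `f_0 = x, …, f_k = bar x` along the boundary cycle if this avoids the
tail, and `ℓ_n (x) = - ℓ_n (bar x)` otherwise. As the degree `n` part of `h` only depends on
the components of its arguments of degree less than `n`, the arguments are truncated there. -/
def ellComponent : ℕ → D → TA g
  | 0, _ => 0
  | 1, x => TensorAlgebra.ι ℚ (G.hmark x)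
  | n + 2, x =>
    let trunc : D → PowerSeries (TA g) := fun y =>
      PowerSeries.mk fun j => if _h : j < n + 2 then ellComponent j y else 0
    let integral : D → TA g := fun y =>
      -(1 / 3 : ℚ) • ∑ i ∈ Finset.range (G.pathLength y),
        PowerSeries.coeff (n + 2)
          (hausdorff (trunc ((G.boundary ^ i) y)) (-trunc ((G.boundary ^ (i + 1)) y)))
    if G.AvoidsTail x then integral x else -integral (G.bar x)
  termination_by n => n

/-- The function `ℓ` on oriented edges. -/
def ell (x : D) : PowerSeries (TA g) := PowerSeries.mk fun n => G.ellComponent n x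

/-- `θ` is the fatgraph Magnus expansion of `G`: the generalized Magnus expansion with
`θ (x) = exp (ℓ (x))` for every oriented edge `x`. There is at most one such `θ`, as the markings
of the edges generate the surface group. -/
def IsFatgraphMagnus (θ : SurfaceGroup g →* CompletedTensor g) : Prop :=
  IsMagnusExpansion θ ∧ ∀ x, (θ (G.mark x) : PowerSeries (TA g)) = expSeries (G.ell x)

end MarkedFatgraph

/-- The Whitehead move from `G` to `G'` along the edge `e` of `G`. The edge `e` is not the tail and
has distinct endpoints; the cyclic orders at these are `(a, b, e)` and `(c, d, bar e)`, all edges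
pointing inwards. In `G'` these two vertices are replaced by vertices with cyclic orders
`(d, a, f)` and `(b, c, bar f)`, where `f = φ e` is the new edge. Everything else is unchanged:
`φ` identifies the other edges of `G` with those of `G'`, together with their `π`-markings. -/
structure IsWhiteheadMove {g : ℕ} {D D' : Type*} (G : MarkedFatgraph g D)
    (G' : MarkedFatgraph g D') (φ : D ≃ D') (a b c d e : D) : Prop where
  ne_tail : e ≠ G.tail
  ne_bar_tail : e ≠ G.bar G.tail
  distinct_endpoints : ¬ G.next.SameCycle e (G.bar e)
  next_a : G.next a = b
  next_b : G.next b = e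
  next_e : G.next e = a
  next_c : G.next c = d
  next_d : G.next d = G.bar e
  next_bar_e : G.next (G.bar e) = c
  map_bar : ∀ x, φ (G.bar x) = G'.bar (φ x)
  map_tail : φ G.tail = G'.tail
  next'_d : G'.next (φ d) = φ a
  next'_a : G'.next (φ a) = φ e
  next'_e : G'.next (φ e) = φ d
  next'_b : G'.next (φ b) = φ c
  next'_c : G'.next (φ c) = φ (G.bar e)
  next'_bar_e : G'.next (φ (G.bar e)) = φ b
  next'_other : ∀ x, x ≠ a → x ≠ b → x ≠ c → x ≠ d → x ≠ e → x ≠ G.bar e →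
    G'.next (φ x) = φ (G.next x)
  mark' : ∀ x, x ≠ e → x ≠ G.bar e → G'.mark (φ x) = G.mark x

/-- `τ` is the fatgraph Johnson map of `G` and `G'`: the element of `IA` that takes the fatgraph
Magnus expansion of `G'` to that of `G`. -/
def IsFatgraphJohnsonMap {g : ℕ} {D D' : Type*} (G : MarkedFatgraph g D)
    (G' : MarkedFatgraph g D') (τ : CompletedTensor g ≃ₐ[ℚ] CompletedTensor g) : Prop :=
  IsIA τ ∧ ∃ θ θ' : SurfaceGroup g →* CompletedTensor g,
    G.IsFatgraphMagnus θ ∧ G'.IsFatgraphMagnus θ' ∧ ∀ x, τ (θ' x) = θ x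

end

end FatgraphJohnson

open FatgraphJohnson

/-! Cut the boundary cycle at the tail: it becomes an interval from `tail` to `bar tail`. Let V(x)
be the sum of the corner series h(ℓ(y), ℓ(next y)) over the y met before x. Both cases of the
recursion then say ℓ(x) = [x] + (V(x) - V(bar x))/3 (`ell_eq`). Around a trivalent vertex the values
of V telescope, so three times the sum of ℓ is minus the sum of the three corner series. This forces
exp ℓ(x) exp ℓ(y) exp ℓ(z) = 1 (`hausdorff_eq_of_three_sum`): rotating the product is a conjugation,
so the lowest order errors of the three rotations agree, and they add up to zero.

Additive solutions of the vertex relations (flows) form a space of dimension at most 2g by an Euler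
characteristic count, and functionals on H already give 2g of them. Hence a flow is determined by
its values on edges whose classes form a basis of H, and degree by degree the same holds for
multiplicative solutions (`eq_of_vertex_relations`). An element of IA moves any Magnus expansion to
one agreeing with exp ℓ on such edges, hence on all edges; so θ exists. As IA acts simply
transitively on Magnus expansions, τ exists and is unique.

For the formula, τ θ' = θ and injectivity of exp give τ ℓ'(x) = ℓ(x) for every edge x common to G
and G'. Subtracting the two equations for ℓ, 3(τ[x] - [x]) is the difference of V - τV' at x and at
bar x. Away from the quadrilateral both boundary cycles turn at the same corners, so V - τV' is a
step function jumping after a, b, c, d only, by -Q, R, -P, S; here P, Q are the corner series at the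
ends of e, R, S those at the ends of f, and P + Q = R + S (`potential_sub`).

The steps are intersection numbers: [a]·[x] is minus the linking number of the positions of a and x
on the boundary cycle (`intersection_hmark`). To see this, the degree two part of θ(∂) is computed
from the commutators and from ℓ, which expresses the symplectic form through consecutive edges at
the vertices; summation by parts along the boundary cycle does the rest. That the coefficients are
Lie elements is the Campbell-Baker-Hausdorff theorem, proved with the logarithmic derivative for the
Euler derivation (`LieUpTo.hausdorff`). -/

namespace FatgraphJohnson

universe u

noncomputable section

/-! ## Congruence of power series -/

/-- The coefficients of `f` and `g` in degrees less than `n` agree. -/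
def Cong {A : Type*} [Semiring A] (n : ℕ) (f g : PowerSeries A) : Prop :=
  ∀ i < n, PowerSeries.coeff i f = PowerSeries.coeff i g

namespace Cong

variable {A : Type*} [Ring A] {m n : ℕ} {f f' g g' h : PowerSeries A}

theorem refl (f : PowerSeries A) : Cong n f f := fun _ _ => rfl

theorem symm (H : Cong n f g) : Cong n g f := fun i hi => (H i hi).symm

theorem trans (H : Cong n f g) (H' : Cong n g h) : Cong n f h :=
  fun i hi => (H i hi).trans (H' i hi)

theorem mono (hmn : m ≤ n) (H : Cong n f g) : Cong m f g := fun i hi => H i (hi.trans_le hmn)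

theorem add (H : Cong n f g) (H' : Cong n f' g') : Cong n (f + f') (g + g') := fun i hi => by
  rw [map_add, map_add, H i hi, H' i hi]

theorem sub (H : Cong n f g) (H' : Cong n f' g') : Cong n (f - f') (g - g') := fun i hi => by
  rw [map_sub, map_sub, H i hi, H' i hi]

theorem neg (H : Cong n f g) : Cong n (-f) (-g) := fun i hi => by
  rw [map_neg, map_neg, H i hi]

theorem smul [Algebra ℚ A] (r : ℚ) (H : Cong n f g) : Cong n (r • f) (r • g) := fun i hi => by
  rw [PowerSeries.coeff_smul, PowerSeries.coeff_smul, H i hi]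

theorem mul (H : Cong n f g) (H' : Cong n f' g') : Cong n (f * f') (g * g') := fun i hi => by
  rw [PowerSeries.coeff_mul, PowerSeries.coeff_mul]
  refine Finset.sum_congr rfl fun p hp => ?_
  have := Finset.HasAntidiagonal.mem_antidiagonal.mp hp
  rw [H _ (by omega), H' _ (by omega)]

theorem pow (H : Cong n f g) (k : ℕ) : Cong n (f ^ k) (g ^ k) := by
  induction k with
  | zero => simpa using Cong.refl _
  | succ k ih => rw [pow_succ, pow_succ]; exact ih.mul H

theorem sum {ι : Type*} (s : Finset ι) {F F' : ι → PowerSeries A}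
    (H : ∀ i ∈ s, Cong n (F i) (F' i)) : Cong n (∑ i ∈ s, F i) (∑ i ∈ s, F' i) := fun i hi => by
  rw [map_sum, map_sum]
  exact Finset.sum_congr rfl fun j hj => H j hj i hi

theorem sub_iff : Cong n (f - g) 0 ↔ Cong n f g := by
  refine forall₂_congr fun i _ => ?_
  rw [map_sub, map_zero, sub_eq_zero]

theorem mul_zero (H : Cong m f 0) (H' : Cong n g 0) : Cong (m + n) (f * g) 0 := fun i hi => by
  rw [PowerSeries.coeff_mul, map_zero]
  refine Finset.sum_eq_zero fun p hp => ?_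
  have := Finset.HasAntidiagonal.mem_antidiagonal.mp hp
  by_cases hp1 : p.1 < m
  · rw [H _ hp1, map_zero, zero_mul]
  · rw [H' p.2 (by omega), map_zero, MulZeroClass.mul_zero]

theorem mul_right_zero (H : Cong n f 0) (g : PowerSeries A) : Cong n (f * g) 0 := by
  simpa using (Cong.mul_zero (n := 0) (g := g) H (fun i hi => by omega))

theorem pow_zero (H : Cong 1 f 0) (k : ℕ) : Cong k (f ^ k) 0 := by
  induction k with
  | zero => exact fun i hi => by omega
  | succ k ih => rw [pow_succ]; exact ih.mul_zero H

theorem eq_of_forall (H : ∀ n, Cong n f g) : f = g :=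
  PowerSeries.ext fun n => H (n + 1) n n.lt_succ_self

theorem one_iff : Cong 1 f g ↔ PowerSeries.coeff 0 f = PowerSeries.coeff 0 g := by
  constructor
  · exact fun H => H 0 one_pos
  · intro H i hi
    obtain rfl : i = 0 := by omega
    exact H

end Cong

/-! ## Evaluation of a power series at a series without constant term -/

section Eval

variable {A : Type*} [Ring A] [Algebra ℚ A]

/-- The series `∑ fₖ Wᵏ`, for a series `W` without constant term. -/
def evalSeries (W : PowerSeries A) (f : PowerSeries ℚ) : PowerSeries A :=
  PowerSeries.mk fun n =>
    ∑ k ∈ Finset.range (n + 1), PowerSeries.coeff k f • PowerSeries.coeff n (W ^ k)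

/-- Powers of `W` with exponent at least `N` are invisible below degree `N`. Identities for series
thus reduce to polynomial identities, one truncation at a time. -/
theorem evalSeries_cong_aeval {W : PowerSeries A} (hW : Cong 1 W 0) (f : PowerSeries ℚ) (N : ℕ) :
    Cong N (evalSeries W f) (Polynomial.aeval W (PowerSeries.trunc N f)) := by
  intro i hi
  rw [Polynomial.aeval_def, PowerSeries.eval₂_trunc_eq_sum_range, map_sum, evalSeries,
    PowerSeries.coeff_mk]
  simp only [← Algebra.smul_def, PowerSeries.coeff_smul]
  refine Finset.sum_subset (Finset.range_mono hi) fun k _ hk => ?_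
  rw [hW.pow_zero k i (by simpa using hk), map_zero, smul_zero]

theorem aeval_cong_zero {W : PowerSeries A} (hW : Cong 1 W 0) {p : Polynomial ℚ} {N : ℕ}
    (hp : ∀ i < N, p.coeff i = 0) : Cong N (Polynomial.aeval W p) 0 := by
  obtain ⟨q, rfl⟩ := Polynomial.X_pow_dvd_iff.mpr hp
  rw [map_mul, map_pow, Polynomial.aeval_X]
  exact (hW.pow_zero N).mul_right_zero _

theorem evalSeries_mul {W : PowerSeries A} (hW : Cong 1 W 0) (f f' : PowerSeries ℚ) :
    evalSeries W (f * f') = evalSeries W f * evalSeries W f' := by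
  refine Cong.eq_of_forall fun N => ?_
  refine (evalSeries_cong_aeval hW _ N).trans
    (Cong.trans ?_ ((evalSeries_cong_aeval hW f N).mul (evalSeries_cong_aeval hW f' N)).symm)
  rw [← map_mul, ← Cong.sub_iff, ← map_sub]
  refine aeval_cong_zero hW fun i hi => ?_
  rw [Polynomial.coeff_sub, PowerSeries.coeff_trunc, if_pos hi,
    PowerSeries.coeff_mul_eq_coeff_trunc_mul_trunc f f' hi, ← Polynomial.coe_mul,
    Polynomial.coeff_coe, sub_self]

/-- Evaluation at a series without constant term, as an algebra homomorphism. -/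
def evalHom (W : PowerSeries A) (hW : Cong 1 W 0) : PowerSeries ℚ →ₐ[ℚ] PowerSeries A :=
  AlgHom.ofLinearMap
    { toFun := evalSeries W
      map_add' := fun f f' => PowerSeries.ext fun n => by
        simp [evalSeries, add_smul, Finset.sum_add_distrib]
      map_smul' := fun r f => PowerSeries.ext fun n => by
        simp [evalSeries, mul_smul, Finset.smul_sum] }
    (PowerSeries.ext fun n => by
      simp only [LinearMap.coe_mk, AddHom.coe_mk, evalSeries, PowerSeries.coeff_mk]
      rw [Finset.sum_eq_single 0]
      · simp
      · intro k _ hk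
        simp [PowerSeries.coeff_one, hk]
      · simp)
    (evalSeries_mul hW)

theorem evalHom_apply (W : PowerSeries A) (hW : Cong 1 W 0) (f : PowerSeries ℚ) :
    evalHom W hW f = evalSeries W f := rfl

theorem evalSeries_X {W : PowerSeries A} (hW : Cong 1 W 0) : evalSeries W PowerSeries.X = W := by
  refine PowerSeries.ext fun n => ?_
  rcases n with _ | n
  · simp [evalSeries, hW 0 one_pos]
  · simp only [evalSeries, PowerSeries.coeff_mk]
    rw [Finset.sum_eq_single 1]
    · simp
    · intro k _ hk
      simp [PowerSeries.coeff_X, hk]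
    · intro h
      simp at h

theorem evalSeries_cong_zero {W : PowerSeries A} {f : PowerSeries ℚ}
    (hf : Cong 1 f 0) : Cong 1 (evalSeries W f) 0 := by
  rw [Cong.one_iff] at hf ⊢
  simp at hf
  simp [evalSeries, hf]

/-- Split `e` as a truncation plus `X ^ N` times a remainder. The remainder does not show below
degree `N`, and on a polynomial the claim only says that evaluation at `W` is an algebra
homomorphism. -/
theorem evalSeries_evalSeries {W : PowerSeries A} (hW : Cong 1 W 0) {f : PowerSeries ℚ}
    (hf : Cong 1 f 0) (e : PowerSeries ℚ) :
    evalSeries (evalSeries W f) e = evalSeries W (e.subst f) := by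
  have hs : PowerSeries.HasSubst f := by
    refine PowerSeries.HasSubst.of_constantCoeff_zero' ?_
    rw [← PowerSeries.coeff_zero_eq_constantCoeff_apply, hf 0 one_pos, map_zero]
  refine Cong.eq_of_forall fun N => ?_
  refine (evalSeries_cong_aeval (evalSeries_cong_zero hf) e N).trans (Cong.symm ?_)
  conv_lhs => rw [PowerSeries.eq_X_pow_mul_shift_add_trunc N e, PowerSeries.subst_add hs,
    PowerSeries.subst_mul hs, PowerSeries.subst_pow hs, PowerSeries.subst_X hs,
    PowerSeries.subst_coe hs]
  rw [← evalHom_apply W hW, map_add, map_mul, map_pow, ← Polynomial.aeval_algHom_apply,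
    evalHom_apply]
  rw [← Cong.sub_iff, add_sub_cancel_right]
  exact ((evalSeries_cong_zero hf).pow_zero N).mul_right_zero _

end Eval

/-- The composite `E` satisfies E' = E/(1 + X), so E/(1 + X) has derivative zero and constant
coefficient one. -/
theorem exp_subst_log :
    (PowerSeries.exp ℚ).subst (PowerSeries.log ℚ) = 1 + PowerSeries.X := by
  have hs := PowerSeries.HasSubst.log (A := ℚ)
  set E := (PowerSeries.exp ℚ).subst (PowerSeries.log ℚ) with hE
  have hc : PowerSeries.constantCoeff E = 1 := by
    rw [hE, PowerSeries.eq_X_pow_mul_shift_add_trunc 1 (PowerSeries.exp ℚ),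
      PowerSeries.subst_add hs, PowerSeries.subst_mul hs, PowerSeries.subst_pow hs,
      PowerSeries.subst_X hs, PowerSeries.subst_coe hs]
    simp
  have hd : PowerSeries.derivative ℚ E =
      E * PowerSeries.mk fun n ↦ (-1 : ℚ) ^ n := by
    rw [hE, PowerSeries.derivative_subst hs, PowerSeries.derivative_exp, PowerSeries.deriv_log]
    rfl
  have hg : (PowerSeries.mk fun n ↦ (-1 : ℚ) ^ n) * (1 + PowerSeries.X) = 1 := by
    ext n
    rcases n with _ | n
    · simp [mul_add]
    · simp [mul_add, PowerSeries.coeff_succ_mul_X, PowerSeries.coeff_one, pow_succ]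
  have key : E * PowerSeries.mk (fun n ↦ (-1 : ℚ) ^ n) = 1 := by
    refine PowerSeries.derivative.ext ?_ ?_
    · have hg' : PowerSeries.derivative ℚ (PowerSeries.mk fun n ↦ (-1 : ℚ) ^ n) =
          -(PowerSeries.mk fun n ↦ (-1 : ℚ) ^ n) ^ 2 := by
        have h1 := congrArg (PowerSeries.derivative ℚ) hg
        rw [Derivation.leibniz, map_add, PowerSeries.derivative_one, PowerSeries.derivative_X,
          smul_eq_mul, smul_eq_mul, zero_add, mul_one] at h1
        have h2 := congrArg (fun z => (PowerSeries.mk fun n ↦ (-1 : ℚ) ^ n) * z) h1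
        simp only [mul_add, mul_zero] at h2
        linear_combination h2 -
          (PowerSeries.derivative ℚ (PowerSeries.mk fun n ↦ (-1 : ℚ) ^ n)) * hg
      rw [Derivation.leibniz, hg', hd, PowerSeries.derivative_one]
      simp only [smul_eq_mul]
      ring
    · simp [hc]
  calc E = E * ((PowerSeries.mk fun n ↦ (-1 : ℚ) ^ n) * (1 + PowerSeries.X)) := by
        rw [hg, mul_one]
    _ = 1 + PowerSeries.X := by rw [← mul_assoc, key, one_mul]

/-! ## Exponential, logarithm and Hausdorff series -/

section ExpLog

variable {g : ℕ} {Y Z W : PowerSeries (TA g)}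

theorem expSeries_eq (Y : PowerSeries (TA g)) :
    expSeries Y = evalSeries Y (PowerSeries.exp ℚ) := by
  ext n
  simp [expSeries, evalSeries]

theorem logSeries_eq (Z : PowerSeries (TA g)) :
    logSeries Z = evalSeries (Z - 1) (PowerSeries.log ℚ) := by
  refine PowerSeries.ext fun n => ?_
  simp only [logSeries, evalSeries, PowerSeries.coeff_mk, PowerSeries.coeff_log]
  refine Finset.sum_subset_zero_on_sdiff (fun k hk => ?_) (fun k hk => ?_) (fun k hk => ?_)
  · simp at hk ⊢; omega
  · obtain rfl : k = 0 := by simp at hk; omega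
    simp
  · have : k ≠ 0 := by simp at hk; omega
    simp [this]

theorem logSeries_cong_zero (Z : PowerSeries (TA g)) : Cong 1 (logSeries Z) 0 := by
  rw [logSeries_eq]
  exact evalSeries_cong_zero (Cong.one_iff.mpr (by simp))

theorem expSeries_logSeries (hZ : Cong 1 Z 1) : expSeries (logSeries Z) = Z := by
  have hW : Cong 1 (Z - 1) 0 := Cong.sub_iff.mpr hZ
  rw [expSeries_eq, logSeries_eq, evalSeries_evalSeries hW (Cong.one_iff.mpr (by simp)),
    exp_subst_log, ← evalHom_apply _ hW, map_add, map_one, evalHom_apply, evalSeries_X hW]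
  abel

theorem expSeries_zero : expSeries (0 : PowerSeries (TA g)) = 1 := by
  refine PowerSeries.ext fun n => ?_
  rw [expSeries, PowerSeries.coeff_mk, Finset.sum_eq_single 0]
  · simp
  · intro k _ hk
    simp [hk]
  · simp

theorem expSeries_cong_one (Y : PowerSeries (TA g)) : Cong 1 (expSeries Y) 1 := by
  rw [Cong.one_iff]
  simp [expSeries]

theorem expSeries_cong_sum (hY : Cong 1 Y 0) (N : ℕ) :
    Cong N (expSeries Y) (∑ k ∈ Finset.range N, ((k.factorial : ℚ)⁻¹) • Y ^ k) := by
  intro i hi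
  rw [expSeries, PowerSeries.coeff_mk, map_sum]
  refine Finset.sum_subset (Finset.range_mono hi) fun k _ hk => ?_
  rw [hY.pow_zero k i (by simpa using hk), map_zero, smul_zero]

/-- The identity between rational series is evaluated at `Y`, which commutes with itself. -/
theorem expSeries_mul_neg (hY : Cong 1 Y 0) : expSeries Y * expSeries (-Y) = 1 := by
  have h : expSeries (-Y) = evalSeries Y (PowerSeries.evalNegHom (PowerSeries.exp ℚ)) := by
    refine PowerSeries.ext fun n => ?_
    simp only [expSeries, evalSeries, PowerSeries.coeff_mk]
    refine Finset.sum_congr rfl fun k _ => ?_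
    rw [neg_pow, PowerSeries.evalNegHom, PowerSeries.coeff_rescale, PowerSeries.coeff_exp,
      mul_smul]
    rcases Nat.even_or_odd k with hk | hk
    · simp [hk.neg_one_pow]
    · simp [hk.neg_one_pow]
  rw [h, expSeries_eq, ← evalSeries_mul hY, PowerSeries.exp_mul_exp_neg_eq_one,
    ← evalHom_apply _ hY, map_one]

theorem expSeries_neg_mul (hY : Cong 1 Y 0) : expSeries (-Y) * expSeries Y = 1 := by
  simpa using expSeries_mul_neg (Y := -Y) (by simpa using hY.neg)

/-- From the square on, every term containing `δ` carries another factor of positive order. -/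
theorem add_pow_cong {A : Type*} [Ring A] {Y δ : PowerSeries A} (hY : Cong 1 Y 0)
    {n : ℕ} (hn : 1 ≤ n) (hδ : Cong n δ 0) (k : ℕ) :
    Cong (n + 1) ((Y + δ) ^ (k + 2)) (Y ^ (k + 2)) := by
  have hδ1 : Cong 1 (Y + δ) 0 := by simpa using hY.add (hδ.mono hn)
  have h : Cong n (Y + δ) Y := by simpa using (Cong.refl Y).add hδ
  rw [pow_succ, pow_succ Y, mul_add, ← Cong.sub_iff, add_sub_right_comm, ← sub_mul]
  have h1 := (Cong.sub_iff.mpr (h.pow (k + 1))).mul_zero hY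
  have h2 := ((hδ1.pow_zero (k + 1)).mono (by omega : 1 ≤ k + 1)).mul_zero hδ
  rw [add_comm 1 n] at h2
  simpa using h1.add h2

/-- To lowest order a perturbation passes through the exponential unchanged. Injectivity of exp, the
dependence of h on lower degrees only, and the vertex relation all rest on this. -/
theorem expSeries_add_small (hY : Cong 1 Y 0) {n : ℕ} (hn : 1 ≤ n) {δ : PowerSeries (TA g)}
    (hδ : Cong n δ 0) : Cong (n + 1) (expSeries (Y + δ)) (expSeries Y + δ) := by
  have hδ1 : Cong 1 (Y + δ) 0 := by simpa using hY.add (hδ.mono hn)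
  refine (expSeries_cong_sum hδ1 _).trans
    (Cong.trans ?_ ((expSeries_cong_sum hY (n + 1)).add (Cong.refl δ)).symm)
  obtain ⟨n, rfl⟩ : ∃ m, n = m + 1 := ⟨n - 1, by omega⟩
  -- The constant and linear terms are peeled off both sums; only the linear one sees `δ`.
  rw [Finset.sum_range_succ', Finset.sum_range_succ', Finset.sum_range_succ',
    Finset.sum_range_succ']
  have h := Cong.sum (Finset.range n) fun k _ =>
    (add_pow_cong hY hn hδ k).smul (((k + 1 + 1).factorial : ℚ)⁻¹)
  have h' := h.add (Cong.refl (Y + δ + 1))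
  intro i hi
  have := h' i hi
  simp only [map_add] at this ⊢
  simp only [zero_add, Nat.factorial_one, Nat.cast_one, inv_one, pow_one, one_smul,
    Nat.factorial_zero, pow_zero, map_add]
  rw [add_assoc, add_assoc, add_assoc, ← add_assoc _ _ (PowerSeries.coeff i 1), this]
  abel

/-- Once `Y` and `Z` agree below degree `n`, their difference in degree `n` appears unchanged in the
difference of the exponentials. -/
theorem cong_of_expSeries (hY : Cong 1 Y 0) (hZ : Cong 1 Z 0) {n : ℕ}
    (h : Cong n (expSeries Y) (expSeries Z)) : Cong n Y Z := by
  induction n with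
  | zero => exact fun i hi => by omega
  | succ n ih =>
    rcases Nat.eq_zero_or_pos n with rfl | hn
    · exact hY.trans hZ.symm
    · have h1 : Cong n Y Z := ih (h.mono n.le_succ)
      have h2 := expSeries_add_small hY hn (Cong.sub_iff.mpr h1.symm)
      rw [add_sub_cancel] at h2
      have h3 := (h.trans h2).sub (Cong.refl (expSeries Y))
      rw [sub_self, add_sub_cancel_left] at h3
      exact (Cong.sub_iff.mp h3.symm).symm

theorem expSeries_injective (hY : Cong 1 Y 0) (hZ : Cong 1 Z 0)
    (h : expSeries Y = expSeries Z) : Y = Z :=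
  Cong.eq_of_forall fun _ => cong_of_expSeries hY hZ (h ▸ Cong.refl _)

theorem expSeries_mul_eq (Y Z : PowerSeries (TA g)) :
    expSeries (Y + Z + hausdorff Y Z) = expSeries Y * expSeries Z := by
  have h : Y + Z + hausdorff Y Z = logSeries (expSeries Y * expSeries Z) := by
    rw [hausdorff]; abel
  rw [h, expSeries_logSeries]
  simpa using (expSeries_cong_one Y).mul (expSeries_cong_one Z)

theorem expSeries_cong_one_add (hY : Cong 1 Y 0) : Cong 2 (expSeries Y) (1 + Y) := by
  have := expSeries_add_small (Y := 0) (Cong.refl 0) le_rfl hY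
  rwa [zero_add, expSeries_zero] at this

theorem add_hausdorff_cong_zero (Y Z : PowerSeries (TA g)) :
    Cong 1 (Y + Z + hausdorff Y Z) 0 := by
  have h : Y + Z + hausdorff Y Z = logSeries (expSeries Y * expSeries Z) := by
    rw [hausdorff]; abel
  rw [h]
  exact logSeries_cong_zero _

theorem hausdorff_cong_zero (hY : Cong 1 Y 0) (hZ : Cong 1 Z 0) : Cong 2 (hausdorff Y Z) 0 := by
  have hYZ : Cong 1 (Y + Z) 0 := by simpa using hY.add hZ
  have h : Cong 2 (expSeries (Y + Z + hausdorff Y Z)) (expSeries (Y + Z)) := by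
    rw [expSeries_mul_eq]
    refine ((expSeries_cong_one_add hY).mul (expSeries_cong_one_add hZ)).trans
      (Cong.trans ?_ (expSeries_cong_one_add hYZ).symm)
    have : (1 + Y) * (1 + Z) - (1 + (Y + Z)) = Y * Z := by noncomm_ring
    rw [← Cong.sub_iff, this]
    exact hY.mul_zero hZ
  have := (cong_of_expSeries (add_hausdorff_cong_zero Y Z) hYZ h).sub (Cong.refl (Y + Z))
  simpa using this

/-- The gain of one degree is what makes the recursion for ℓ well founded. Changes of order `n` in
`Y` and `Z` alter the product of exponentials in degree `n` by their sum, which the linear part of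
the logarithm already accounts for. -/
theorem hausdorff_congr {Y' Z' : PowerSeries (TA g)} (hY : Cong 1 Y 0) (hZ : Cong 1 Z 0)
    (hY' : Cong 1 Y' 0) (hZ' : Cong 1 Z' 0) {n : ℕ} (h : Cong n Y Y') (h' : Cong n Z Z') :
    Cong (n + 1) (hausdorff Y Z) (hausdorff Y' Z') := by
  rcases Nat.eq_zero_or_pos n with rfl | hn
  · exact ((hausdorff_cong_zero hY hZ).trans (hausdorff_cong_zero hY' hZ').symm).mono (by omega)
  set W := Y + Z + hausdorff Y Z with hW
  set W' := Y' + Z' + hausdorff Y' Z' with hW'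
  have hW0 : Cong 1 W 0 := add_hausdorff_cong_zero Y Z
  have hW0' : Cong 1 W' 0 := add_hausdorff_cong_zero Y' Z'
  have e1 : Cong n (Y' - Y) 0 := Cong.sub_iff.mpr h.symm
  have e2 : Cong n (Z' - Z) 0 := Cong.sub_iff.mpr h'.symm
  have e12 : Cong n ((Y' - Y) + (Z' - Z)) 0 := by simpa using e1.add e2
  have k1 := expSeries_add_small hY hn e1
  have k2 := expSeries_add_small hZ hn e2
  have k3 := expSeries_add_small hW0 hn e12
  rw [add_sub_cancel] at k1 k2
  have k4 : Cong (n + 1) (expSeries W') (expSeries (W + ((Y' - Y) + (Z' - Z)))) := by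
    rw [hW', expSeries_mul_eq]
    refine (k1.mul k2).trans (Cong.trans ?_ k3.symm)
    rw [hW, expSeries_mul_eq, ← Cong.sub_iff]
    have : (expSeries Y + (Y' - Y)) * (expSeries Z + (Z' - Z)) -
        (expSeries Y * expSeries Z + (Y' - Y + (Z' - Z))) =
        (expSeries Y - 1) * (Z' - Z) + (Y' - Y) * (expSeries Z - 1) +
          (Y' - Y) * (Z' - Z) := by noncomm_ring
    rw [this]
    have m1 := (Cong.sub_iff.mpr (expSeries_cong_one Y)).mul_zero e2
    have m2 := e1.mul_zero (Cong.sub_iff.mpr (expSeries_cong_one Z))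
    have m3 := e1.mul_zero (e2.mono hn)
    rw [add_comm 1 n] at m1
    simpa using (m1.add m2).add m3
  have k5 := cong_of_expSeries hW0' (by simpa using hW0.add (e12.mono hn)) k4
  have k6 := (k5.sub (Cong.refl (Y' + Z'))).symm
  have t1 : W' - (Y' + Z') = hausdorff Y' Z' := by rw [hW']; abel
  have t2 : W + (Y' - Y + (Z' - Z)) - (Y' + Z') = hausdorff Y Z := by rw [hW]; abel
  rwa [t1, t2] at k6

theorem coeff_two_expSeries (Y : PowerSeries (TA g)) (hY : Cong 1 Y 0) :
    PowerSeries.coeff 2 (expSeries Y) = PowerSeries.coeff 2 Y +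
      (1 / 2 : ℚ) • (PowerSeries.coeff 1 Y * PowerSeries.coeff 1 Y) := by
  have h0 : PowerSeries.coeff 0 Y = 0 := by simpa using hY 0 one_pos
  rw [expSeries, PowerSeries.coeff_mk, Finset.sum_range_succ, Finset.sum_range_succ,
    Finset.sum_range_one, pow_two, PowerSeries.coeff_mul 2 Y Y,
    Finset.Nat.sum_antidiagonal_eq_sum_range_succ_mk, Finset.sum_range_succ,
    Finset.sum_range_succ, Finset.sum_range_one]
  simp [h0, PowerSeries.coeff_one, Nat.factorial]

theorem coeff_two_hausdorff (hY : Cong 1 Y 0) (hZ : Cong 1 Z 0) :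
    PowerSeries.coeff 2 (hausdorff Y Z) =
      (1 / 2 : ℚ) • (PowerSeries.coeff 1 Y * PowerSeries.coeff 1 Z -
        PowerSeries.coeff 1 Z * PowerSeries.coeff 1 Y) := by
  have h := congrArg (PowerSeries.coeff 2) (expSeries_mul_eq Y Z)
  rw [coeff_two_expSeries _ (add_hausdorff_cong_zero Y Z), PowerSeries.coeff_mul,
    Finset.Nat.sum_antidiagonal_eq_sum_range_succ_mk, Finset.sum_range_succ,
    Finset.sum_range_succ, Finset.sum_range_one] at h
  simp only [Nat.sub_zero, Nat.sub_self, Nat.reduceSub] at h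
  rw [coeff_two_expSeries _ hY, coeff_two_expSeries _ hZ, expSeries_cong_one Y 0 one_pos,
    expSeries_cong_one Z 0 one_pos, expSeries_cong_one_add hY 1 one_lt_two,
    expSeries_cong_one_add hZ 1 one_lt_two] at h
  simp only [map_add, hausdorff_cong_zero hY hZ 1 one_lt_two, map_zero, add_zero,
    PowerSeries.coeff_one, if_true, one_ne_zero, if_false, zero_add, one_mul, mul_one,
    mul_add, add_mul, smul_add] at h
  rw [smul_sub]
  set y := PowerSeries.coeff 1 Y
  set z := PowerSeries.coeff 1 Z
  have h3 := sub_eq_zero.mpr h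
  rw [← sub_eq_zero, ← h3]
  module

/-- With `r` the error, exp A exp B is exp(-C + r), which is exp(-C) + r to this order. -/
theorem three_sum_hausdorff_aux {A B C : PowerSeries (TA g)} {n : ℕ}
    (hn : 1 ≤ n) (hC : Cong 1 C 0) (h : Cong n (A + B + C + hausdorff A B) 0) :
    Cong (n + 1) (expSeries A * expSeries B * expSeries C)
      (1 + (A + B + C + hausdorff A B)) := by
  set r := A + B + C + hausdorff A B with hr
  have h1 := expSeries_add_small (Y := -C) (by simpa using hC.neg) hn h
  have h2 : -C + r = A + B + hausdorff A B := by rw [hr]; abel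
  rw [h2, expSeries_mul_eq] at h1
  have h3 := h1.mul (Cong.refl (expSeries C))
  rw [add_mul, expSeries_neg_mul hC] at h3
  refine h3.trans ((Cong.refl 1).add ?_)
  rw [← Cong.sub_iff, ← mul_sub_one]
  exact h.mul_zero (Cong.sub_iff.mpr (expSeries_cong_one C))

/-- The commutator of `R` with `P - 1` has larger order than `R`, so conjugation does not affect the
leading term. -/
theorem conj_cong {P Q R : PowerSeries (TA g)} {n : ℕ} (hP : Cong 1 P 1) (hPQ : P * Q = 1)
    (hR : Cong n R 0) : Cong (n + 1) (P * R * Q) R := by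
  have hQP : Cong (n + 1) (P * R * Q - R * P * Q) 0 := by
    have : P * R * Q - R * P * Q = ((P - 1) * R - R * (P - 1)) * Q := by noncomm_ring
    rw [this]
    refine Cong.mul_right_zero ?_ Q
    have m1 := (Cong.sub_iff.mpr hP).mul_zero hR
    have m2 := hR.mul_zero (Cong.sub_iff.mpr hP)
    rw [add_comm 1 n] at m1
    simpa using m1.sub m2
  rw [mul_assoc R, hPQ, mul_one] at hQP
  exact Cong.sub_iff.mp hQP

/-- The two errors are the leading terms of exp A exp B exp C - 1 and of its rotation, which is its
conjugate by exp A. -/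
theorem hausdorff_rotate {A B C : PowerSeries (TA g)} (hA : Cong 1 A 0)
    (hC : Cong 1 C 0) {n : ℕ} (hn : 1 ≤ n) (h : Cong n (A + B + C + hausdorff A B) 0)
    (h' : Cong n (B + C + A + hausdorff B C) 0) :
    Cong (n + 1) (A + B + C + hausdorff A B) (B + C + A + hausdorff B C) := by
  have k := three_sum_hausdorff_aux hn hC h
  have k' := three_sum_hausdorff_aux hn hA h'
  have hconj : expSeries (-A) * (expSeries A * expSeries B * expSeries C) * expSeries A =
      expSeries B * expSeries C * expSeries A := by
    simp only [← mul_assoc]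
    rw [expSeries_neg_mul hA, one_mul]
  have k2 := ((Cong.refl (expSeries (-A))).mul k).mul (Cong.refl (expSeries A))
  rw [hconj] at k2
  have k3 := (k'.symm.trans k2).trans (g := expSeries (-A) * (1 + (A + B + C + hausdorff A B)) *
    expSeries A) (Cong.refl _)
  rw [mul_add, mul_one, add_mul, expSeries_neg_mul hA] at k3
  have k4 := k3.trans ((Cong.refl 1).add
    (conj_cong (expSeries_cong_one _) (expSeries_neg_mul hA) h))
  have := k4.sub (Cong.refl 1)
  rw [add_sub_cancel_left, add_sub_cancel_left] at this
  exact this.symm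

/-- If `A + B + C` is minus the mean of the three Hausdorff brackets of consecutive terms, then
`exp A exp B exp C = 1` (and the three Hausdorff brackets coincide). -/
theorem hausdorff_eq_of_three_sum {A B C : PowerSeries (TA g)} (hA : Cong 1 A 0) (hB : Cong 1 B 0)
    (hC : Cong 1 C 0)
    (h : (3 : ℚ) • (A + B + C) + (hausdorff A B + hausdorff B C + hausdorff C A) = 0) :
    A + B + C + hausdorff A B = 0 := by
  have key : ∀ n, Cong n (A + B + C + hausdorff A B) 0 ∧ Cong n (B + C + A + hausdorff B C) 0 ∧
      Cong n (C + A + B + hausdorff C A) 0 := by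
    intro n
    induction n with
    | zero => exact ⟨fun i hi => by omega, fun i hi => by omega, fun i hi => by omega⟩
    | succ n ih =>
      obtain ⟨i1, i2, i3⟩ := ih
      have e12 : Cong (n + 1) (A + B + C + hausdorff A B) (B + C + A + hausdorff B C) ∧
          Cong (n + 1) (B + C + A + hausdorff B C) (C + A + B + hausdorff C A) := by
        -- The perturbation argument needs positive order; in degree zero all terms vanish anyway.
        rcases Nat.eq_zero_or_pos n with rfl | hn
        · have z : ∀ {P Q R S : PowerSeries (TA g)}, Cong 1 P 0 → Cong 1 Q 0 → Cong 1 R 0 →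
              Cong 1 S 0 → Cong 1 (P + Q + R + S) 0 := fun a b c d => by
            simpa using ((a.add b).add c).add d
          have hh : ∀ {P Q : PowerSeries (TA g)}, Cong 1 P 0 → Cong 1 Q 0 →
              Cong 1 (hausdorff P Q) 0 := fun a b => (hausdorff_cong_zero a b).mono (by omega)
          exact ⟨(z hA hB hC (hh hA hB)).trans (z hB hC hA (hh hB hC)).symm,
            (z hB hC hA (hh hB hC)).trans (z hC hA hB (hh hC hA)).symm⟩
        · exact ⟨hausdorff_rotate hA hC hn i1 i2, hausdorff_rotate hB hA hn i2 i3⟩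
      -- The hypothesis says that the three errors add up to zero. As they agree in the next degree,
      -- three times each of them vanishes there.
      have hs : (A + B + C + hausdorff A B) + (B + C + A + hausdorff B C) +
          (C + A + B + hausdorff C A) = 0 := by
        rw [← h, show (3 : ℚ) = 1 + 1 + 1 by norm_num, add_smul, add_smul, one_smul]
        abel
      have e3 : Cong (n + 1) ((3 : ℚ) • (A + B + C + hausdorff A B)) 0 := by
        rw [show (3 : ℚ) = 1 + 1 + 1 by norm_num, add_smul, add_smul, one_smul]
        refine (((Cong.refl _).add e12.1).add (e12.1.trans e12.2)).trans ?_
        rw [hs]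
        exact Cong.refl 0
      have e4 : Cong (n + 1) (A + B + C + hausdorff A B) 0 := by
        have := e3.smul (1 / 3 : ℚ)
        rw [smul_smul, smul_zero] at this
        norm_num at this
        exact this
      exact ⟨e4, e12.1.symm.trans e4, e12.2.symm.trans (e12.1.symm.trans e4)⟩
  exact Cong.eq_of_forall fun n => (key n).1

theorem expSeries_three_mul {A B C : PowerSeries (TA g)} (hC : Cong 1 C 0)
    (h : A + B + C + hausdorff A B = 0) : expSeries A * expSeries B * expSeries C = 1 := by
  have : A + B + hausdorff A B = -C := by
    rw [eq_neg_iff_add_eq_zero, ← h]; abel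
  rw [← expSeries_mul_eq, this, expSeries_neg_mul hC]

/-- Needed for the corners of the new fatgraph: after transport by τ only the multiplicative
relation is at hand. -/
theorem hausdorff_of_expSeries_three_mul {A B C : PowerSeries (TA g)} (hC : Cong 1 C 0)
    (h : expSeries A * expSeries B * expSeries C = 1) : A + B + C + hausdorff A B = 0 := by
  have h1 : expSeries (A + B + hausdorff A B) = expSeries (-C) := by
    rw [expSeries_mul_eq]
    calc _ = expSeries A * expSeries B * (expSeries C * expSeries (-C)) := by
          rw [expSeries_mul_neg hC, mul_one]
      _ = _ := by rw [← mul_assoc, h, one_mul]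
  have := expSeries_injective (add_hausdorff_cong_zero A B) (by simpa using hC.neg) h1
  rw [eq_neg_iff_add_eq_zero] at this
  rw [← this]; abel

end ExpLog

/-! ## The Campbell-Baker-Hausdorff theorem -/

/-- Modulo terms of high degree, the product of two sums is the sum over a triangle. -/
theorem sum_antidiagonal_cong {A : Type*} [Ring A] {a b : ℕ → PowerSeries A}
    (ha : ∀ i, Cong i (a i) 0)
    (hb : ∀ k, Cong k (b k) 0) (M : ℕ) :
    Cong M (∑ n ∈ Finset.range M, ∑ p ∈ Finset.HasAntidiagonal.antidiagonal n, a p.1 * b p.2)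
      ((∑ i ∈ Finset.range M, a i) * ∑ k ∈ Finset.range M, b k) := by
  rw [Finset.sum_mul_sum, ← Finset.sum_product', Finset.sum_sigma']
  rw [← Finset.sum_filter_add_sum_filter_not (Finset.range M ×ˢ Finset.range M)
    (fun p => p.1 + p.2 < M)]
  have h1 : ∑ x ∈ (Finset.range M).sigma Finset.HasAntidiagonal.antidiagonal, a x.2.1 * b x.2.2 =
      ∑ p ∈ Finset.range M ×ˢ Finset.range M with p.1 + p.2 < M, a p.1 * b p.2 := by
    refine Finset.sum_bij' (fun x _ => x.2) (fun p _ => ⟨p.1 + p.2, p⟩) ?_ ?_ ?_ ?_ ?_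
    · rintro ⟨n, p⟩ h
      simp at h ⊢
      omega
    · rintro p h
      simp at h ⊢
      omega
    · rintro ⟨n, p⟩ h
      simp at h
      obtain ⟨_, rfl⟩ := h
      rfl
    · rintro p h
      rfl
    · rintro x h
      rfl
  rw [h1]
  -- The terms of the square outside the triangle have order at least `M`.
  have h2 : Cong M (∑ p ∈ Finset.range M ×ˢ Finset.range M with ¬ p.1 + p.2 < M, a p.1 * b p.2)
      0 := by
    rw [← Finset.sum_const_zero (s := {p ∈ Finset.range M ×ˢ Finset.range M | ¬ p.1 + p.2 < M})]
    refine Cong.sum _ fun p hp => ?_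
    simp at hp
    exact ((ha p.1).mul_zero (hb p.2)).mono hp.2
  simpa using (Cong.refl _).add h2.symm

section Euler

variable {A : Type*} [Ring A] [Algebra ℚ A]

/-- The Euler derivation, multiplying the coefficient of degree `n` by `n`. -/
def euler : PowerSeries A →ₗ[ℚ] PowerSeries A where
  toFun f := PowerSeries.mk fun n => (n : ℚ) • PowerSeries.coeff n f
  map_add' f f' := PowerSeries.ext fun n => by simp
  map_smul' r f := PowerSeries.ext fun n => by simp [smul_comm r]

theorem coeff_euler (f : PowerSeries A) (n : ℕ) :
    PowerSeries.coeff n (euler f) = (n : ℚ) • PowerSeries.coeff n f := by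
  simp [euler]

theorem euler_mul (f f' : PowerSeries A) : euler (f * f') = euler f * f' + f * euler f' := by
  refine PowerSeries.ext fun n => ?_
  rw [coeff_euler, map_add, PowerSeries.coeff_mul, PowerSeries.coeff_mul, PowerSeries.coeff_mul,
    Finset.smul_sum, ← Finset.sum_add_distrib]
  refine Finset.sum_congr rfl fun p hp => ?_
  rw [coeff_euler, coeff_euler, ← Finset.HasAntidiagonal.mem_antidiagonal.mp hp, smul_mul_assoc,
    mul_smul_comm, ← add_smul, Nat.cast_add]

theorem euler_one : euler (1 : PowerSeries A) = 0 := by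
  have := euler_mul (1 : PowerSeries A) 1
  simpa using this

theorem Cong.euler {n : ℕ} {f f' : PowerSeries A} (h : Cong n f f') :
    Cong n (euler f) (euler f') := fun i hi => by
  rw [coeff_euler, coeff_euler, h i hi]

/-- The operator `V ↦ V Y - Y V`. -/
def negAd (Y : PowerSeries A) : Module.End ℚ (PowerSeries A) :=
  LinearMap.mulRight ℚ Y - LinearMap.mulLeft ℚ Y

theorem negAd_apply (Y V : PowerSeries A) : negAd Y V = V * Y - Y * V := rfl

theorem negAd_pow_cong {Y V : PowerSeries A} (hY : Cong 1 Y 0) {j : ℕ} (hV : Cong j V 0) (k : ℕ) :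
    Cong (k + j) ((negAd Y ^ k) V) 0 := by
  induction k with
  | zero => simpa using hV
  | succ k ih =>
    rw [pow_succ', Module.End.mul_apply, negAd_apply]
    have h1 := ih.mul_zero hY
    have h2 := hY.mul_zero ih
    rw [show 1 + (k + j) = k + j + 1 by ring] at h2
    have := h1.sub h2
    rw [sub_zero] at this
    exact this.mono (by omega)

/-- Right multiplication by `Y` is the sum of the commuting operators left multiplication and `negAd
Y`, so the binomial theorem applies. -/
theorem mul_pow_eq (Y V : PowerSeries A) (n : ℕ) :
    V * Y ^ n = ∑ p ∈ Finset.HasAntidiagonal.antidiagonal n,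
      n.choose p.1 • (Y ^ p.1 * (negAd Y ^ p.2) V) := by
  have hc : Commute (LinearMap.mulLeft ℚ Y) (negAd Y) := by
    refine (LinearMap.commute_mulLeft_right Y Y).sub_right (Commute.refl _)
  have h : LinearMap.mulRight ℚ Y = LinearMap.mulLeft ℚ Y + negAd Y := by
    rw [negAd, add_sub_cancel]
  have h2 := congrArg (fun T => T V) (hc.add_pow' n)
  rw [← h, LinearMap.pow_mulRight] at h2
  rw [LinearMap.mulRight_apply] at h2
  rw [h2, LinearMap.sum_apply]
  refine Finset.sum_congr rfl fun p _ => ?_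
  rw [LinearMap.smul_apply, Module.End.mul_apply, LinearMap.pow_mulLeft, LinearMap.mulLeft_apply]

/-- By the Leibniz rule the new term is `euler Y * Y ^ (n + 1)`; moving `euler Y` to the right with
`mul_pow_eq` makes Pascal's rule applicable. -/
theorem euler_pow_succ (Y : PowerSeries A) (n : ℕ) :
    euler (Y ^ (n + 1)) = ∑ p ∈ Finset.HasAntidiagonal.antidiagonal n,
      (n + 1).choose (p.2 + 1) • (Y ^ p.1 * (negAd Y ^ p.2) (euler Y)) := by
  induction n with
  | zero => simp
  | succ n ih =>
    rw [pow_succ', euler_mul, ih, mul_pow_eq, Finset.Nat.sum_antidiagonal_succ,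
      Finset.Nat.sum_antidiagonal_succ, Finset.mul_sum, add_assoc, ← Finset.sum_add_distrib]
    congr 1
    · simp
    · refine Finset.sum_congr rfl fun p hp => ?_
      have hp' := Finset.HasAntidiagonal.mem_antidiagonal.mp hp
      dsimp only
      rw [mul_smul_comm, ← mul_assoc, ← pow_succ', ← add_smul, Nat.choose_succ_succ (n + 1) p.2,
        Nat.choose_symm_of_eq_add (by omega : n + 1 = p.1 + 1 + p.2)]

theorem inv_factorial_pow_cong {Y : PowerSeries A} (hY : Cong 1 Y 0) (i : ℕ) :
    Cong i (((i.factorial : ℚ)⁻¹) • Y ^ i) 0 := by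
  simpa using (hY.pow_zero i).smul ((i.factorial : ℚ)⁻¹)

end Euler

section CBH

variable {g : ℕ}

/-- `V exp Y = exp Y (exp (- ad Y) V)`. -/
theorem mul_expSeries_cong {Y : PowerSeries (TA g)} (hY : Cong 1 Y 0) (V : PowerSeries (TA g))
    (M : ℕ) :
    Cong M (V * expSeries Y) (expSeries Y *
      ∑ k ∈ Finset.range M, ((k.factorial : ℚ)⁻¹) • (negAd Y ^ k) V) := by
  have h1 := expSeries_cong_sum hY M
  refine ((Cong.refl V).mul h1).trans (Cong.trans ?_ (h1.symm.mul (Cong.refl _)))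
  refine Cong.trans ?_ (sum_antidiagonal_cong (inv_factorial_pow_cong hY) (fun k => ?_) M)
  · rw [Finset.mul_sum]
    refine Cong.sum _ fun n _ => ?_
    rw [mul_smul_comm, mul_pow_eq, Finset.smul_sum]
    refine Cong.sum _ fun p hp => ?_
    have hp' := Finset.HasAntidiagonal.mem_antidiagonal.mp hp
    rw [smul_mul_assoc, mul_smul_comm, smul_smul, ← Nat.cast_smul_eq_nsmul ℚ, smul_smul,
      Nat.choose_eq_factorial_div_factorial (by omega : p.1 ≤ n),
      Nat.cast_div (Nat.factorial_mul_factorial_dvd_factorial (by omega))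
        (by positivity), show n - p.1 = p.2 by omega]
    have : (n.factorial : ℚ) ≠ 0 := by positivity
    -- Divided by n!, the binomial coefficient splits as 1/p! times 1/q!, giving the Cauchy product
    -- of two exponential sums.
    have e : (n.factorial : ℚ)⁻¹ * ((n.factorial : ℚ) / ((p.1.factorial * p.2.factorial : ℕ) : ℚ))
      = (p.1.factorial : ℚ)⁻¹ * (p.2.factorial : ℚ)⁻¹ := by
      push_cast
      field_simp
    rw [e]
    exact Cong.refl _
  · simpa using (negAd_pow_cong hY (j := 0) (V := V) (fun i hi => by omega) k).smul
      ((k.factorial : ℚ)⁻¹)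

/-- The derivative of the exponential: `E (exp Y) = exp Y ∑ (- ad Y)ᵏ (E Y) / (k + 1)!`. -/
theorem euler_expSeries_cong {Y : PowerSeries (TA g)} (hY : Cong 1 Y 0) (M : ℕ) :
    Cong M (euler (expSeries Y)) (expSeries Y *
      ∑ k ∈ Finset.range M, (((k + 1).factorial : ℚ)⁻¹) • (negAd Y ^ k) (euler Y)) := by
  have h1 := expSeries_cong_sum hY M
  have h2 := ((expSeries_cong_sum hY (M + 1)).mono M.le_succ).euler
  refine h2.trans (Cong.trans ?_ (h1.symm.mul (Cong.refl _)))
  refine Cong.trans ?_ (sum_antidiagonal_cong (inv_factorial_pow_cong hY) (fun k => ?_) M)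
  · rw [map_sum, Finset.sum_range_succ']
    simp only [map_smul, pow_zero, euler_one, smul_zero, add_zero]
    refine Cong.sum _ fun n _ => ?_
    rw [euler_pow_succ, Finset.smul_sum]
    refine Cong.sum _ fun p hp => ?_
    have hp' := Finset.HasAntidiagonal.mem_antidiagonal.mp hp
    rw [smul_mul_assoc, mul_smul_comm, smul_smul, ← Nat.cast_smul_eq_nsmul ℚ, smul_smul,
      Nat.choose_eq_factorial_div_factorial (by omega : p.2 + 1 ≤ n + 1),
      Nat.cast_div (Nat.factorial_mul_factorial_dvd_factorial (by omega))
        (by positivity), show n + 1 - (p.2 + 1) = p.1 by omega]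
    have : ((n + 1).factorial : ℚ) ≠ 0 := by positivity
    have e : ((n + 1).factorial : ℚ)⁻¹ *
        (((n + 1).factorial : ℚ) / (((p.2 + 1).factorial * p.1.factorial : ℕ) : ℚ))
      = (p.1.factorial : ℚ)⁻¹ * ((p.2 + 1).factorial : ℚ)⁻¹ := by
      push_cast
      field_simp
    rw [e]
    exact Cong.refl _
  · simpa using (negAd_pow_cong hY (j := 0) (V := euler Y) (fun i hi => by omega) k).smul
      (((k + 1).factorial : ℚ)⁻¹)

/-- The coefficients of degree less than `n` lie in the homogeneous parts of the free Lie
algebra. -/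
def LieUpTo (n : ℕ) (f : PowerSeries (TA g)) : Prop :=
  ∀ i < n, PowerSeries.coeff i f ∈ freeLiePart g i

attribute [local instance] LieRing.ofAssociativeRing in
theorem commutator_mem_freeLiePart {i j : ℕ} {x y : TA g} (hx : x ∈ freeLiePart g i)
    (hy : y ∈ freeLiePart g j) : x * y - y * x ∈ freeLiePart g (i + j) := by
  refine ⟨?_, ?_⟩
  · exact LieSubalgebra.lie_mem _ hx.1 hy.1
  · refine Submodule.sub_mem _ ?_ ?_
    · rw [tensorPower, pow_add]
      exact Submodule.mul_mem_mul hx.2 hy.2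
    · rw [tensorPower, add_comm, pow_add]
      exact Submodule.mul_mem_mul hy.2 hx.2

attribute [local instance] LieRing.ofAssociativeRing in
theorem ι_mem_freeLiePart (x : Hlgy g) : TensorAlgebra.ι ℚ x ∈ freeLiePart g 1 := by
  refine ⟨LieSubalgebra.subset_lieSpan ⟨x, rfl⟩, ?_⟩
  rw [tensorPower, pow_one]
  exact ⟨x, rfl⟩

namespace LieUpTo

variable {n : ℕ} {f f' : PowerSeries (TA g)}

theorem add (h : LieUpTo n f) (h' : LieUpTo n f') : LieUpTo n (f + f') := fun i hi => by
  rw [map_add]; exact Submodule.add_mem _ (h i hi) (h' i hi)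

theorem sub (h : LieUpTo n f) (h' : LieUpTo n f') : LieUpTo n (f - f') := fun i hi => by
  rw [map_sub]; exact Submodule.sub_mem _ (h i hi) (h' i hi)

theorem neg (h : LieUpTo n f) : LieUpTo n (-f) := fun i hi => by
  rw [map_neg]; exact Submodule.neg_mem _ (h i hi)

theorem smul (r : ℚ) (h : LieUpTo n f) : LieUpTo n (r • f) := fun i hi => by
  rw [PowerSeries.coeff_smul]; exact Submodule.smul_mem _ _ (h i hi)

theorem sum {ι : Type*} (s : Finset ι) {F : ι → PowerSeries (TA g)}
    (h : ∀ i ∈ s, LieUpTo n (F i)) : LieUpTo n (∑ i ∈ s, F i) := fun i hi => by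
  rw [map_sum]; exact Submodule.sum_mem _ fun j hj => h j hj i hi

theorem congr (h : LieUpTo n f) (hc : Cong n f f') : LieUpTo n f' := fun i hi => by
  rw [← hc i hi]; exact h i hi

theorem mono {m : ℕ} (hmn : m ≤ n) (h : LieUpTo n f) : LieUpTo m f :=
  fun i hi => h i (hi.trans_le hmn)

theorem euler (h : LieUpTo n f) : LieUpTo n (euler f) := fun i hi => by
  rw [coeff_euler]; exact Submodule.smul_mem _ _ (h i hi)

theorem negAd (h : LieUpTo n f) (h' : LieUpTo n f') : LieUpTo n (negAd f f') := fun i hi => by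
  rw [negAd_apply, map_sub, PowerSeries.coeff_mul, PowerSeries.coeff_mul,
    ← Finset.Nat.sum_antidiagonal_swap (n := i) (f := fun p => PowerSeries.coeff p.1 f *
      PowerSeries.coeff p.2 f'), ← Finset.sum_sub_distrib]
  refine Submodule.sum_mem _ fun p hp => ?_
  have hp' := Finset.HasAntidiagonal.mem_antidiagonal.mp hp
  have := commutator_mem_freeLiePart (h' p.1 (by omega)) (h p.2 (by omega))
  rwa [hp'] at this

/-- Without constant terms, a bracket of total degree `n` only involves factors of degree less than
`n`. This extra degree drives the induction in `lieUpTo_of_logDeriv`. -/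
theorem negAd_succ (h : LieUpTo n f) (h' : LieUpTo n f') (h0 : Cong 1 f 0) (h0' : Cong 1 f' 0) :
    LieUpTo (n + 1) (FatgraphJohnson.negAd f f') := fun i hi => by
  rw [negAd_apply, map_sub, PowerSeries.coeff_mul, PowerSeries.coeff_mul,
    ← Finset.Nat.sum_antidiagonal_swap (n := i) (f := fun p => PowerSeries.coeff p.1 f *
      PowerSeries.coeff p.2 f'), ← Finset.sum_sub_distrib]
  refine Submodule.sum_mem _ fun p hp => ?_
  have hp' := Finset.HasAntidiagonal.mem_antidiagonal.mp hp
  by_cases h1 : p.1 = 0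
  · simp only [Prod.fst_swap, Prod.snd_swap]
    rw [h1, h0' 0 one_pos]
    simp
  by_cases h2 : p.2 = 0
  · simp only [Prod.fst_swap, Prod.snd_swap]
    rw [h2, h0 0 one_pos]
    simp
  have := commutator_mem_freeLiePart (h' p.1 (by omega)) (h p.2 (by omega))
  rwa [hp'] at this

theorem negAd_pow (h : LieUpTo n f) (h' : LieUpTo n f') (k : ℕ) :
    LieUpTo n ((FatgraphJohnson.negAd f ^ k) f') := by
  induction k with
  | zero => simpa using h'
  | succ k ih => rw [pow_succ', Module.End.mul_apply]; exact h.negAd ih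

end LieUpTo

/-- A series without constant term is Lie if its left logarithmic derivative is. -/
theorem lieUpTo_of_logDeriv {W : PowerSeries (TA g)} (hW : Cong 1 W 0) {N : ℕ}
    (h : LieUpTo N (∑ k ∈ Finset.range N, (((k + 1).factorial : ℚ)⁻¹) •
      (negAd W ^ k) (euler W))) : LieUpTo N W := by
  suffices H : ∀ n ≤ N, LieUpTo n W from H N le_rfl
  intro n
  induction n with
  | zero => exact fun _ i hi => by omega
  | succ n ih =>
    intro hn
    have hWn := ih (by omega)
    have hE0 : Cong 1 (euler W) 0 := by simpa using hW.euler
    obtain ⟨N, rfl⟩ : ∃ M, N = M + 1 := ⟨N - 1, by omega⟩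
    rw [Finset.sum_range_succ'] at h
    -- All summands but the first are brackets with `W`, so they are under control one degree
    -- further than `W` itself.
    have h1 : LieUpTo (n + 1) (∑ k ∈ Finset.range N, (((k + 1 + 1).factorial : ℚ)⁻¹) •
        (negAd W ^ (k + 1)) (euler W)) := by
      refine LieUpTo.sum _ fun k _ => LieUpTo.smul _ ?_
      rw [pow_succ', Module.End.mul_apply]
      exact hWn.negAd_succ (hWn.negAd_pow hWn.euler k) hW
        ((negAd_pow_cong hW hE0 k).mono (by omega))
    have h2 := (h.mono hn).sub h1
    rw [add_sub_cancel_left] at h2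
    intro i hi
    rcases Nat.eq_zero_or_pos i with rfl | hi0
    · rw [hW 0 one_pos, map_zero]
      exact Submodule.zero_mem _
    have h3 := h2 i hi
    simp only [zero_add, Nat.factorial_one, Nat.cast_one, inv_one, one_smul, pow_zero,
      Module.End.one_apply, coeff_euler] at h3
    -- The remaining summand `euler W` has coefficient i W_i, and i is invertible.
    have h4 := Submodule.smul_mem _ ((i : ℚ)⁻¹) h3
    rwa [smul_smul, inv_mul_cancel₀ (by positivity), one_smul] at h4

/-- The Campbell-Baker-Hausdorff theorem. -/
theorem LieUpTo.hausdorff {Y Z : PowerSeries (TA g)} (hY0 : Cong 1 Y 0) (hZ0 : Cong 1 Z 0)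
    {N : ℕ} (hY : LieUpTo N Y) (hZ : LieUpTo N Z) : LieUpTo N (hausdorff Y Z) := by
  set W := Y + Z + FatgraphJohnson.hausdorff Y Z with hWdef
  have hW0 : Cong 1 W 0 := add_hausdorff_cong_zero Y Z
  set Φ : PowerSeries (TA g) → PowerSeries (TA g) := fun U =>
    ∑ k ∈ Finset.range N, (((k + 1).factorial : ℚ)⁻¹) • (FatgraphJohnson.negAd U ^ k)
      (FatgraphJohnson.euler U) with hΦ
  have hΦL : ∀ U : PowerSeries (TA g), LieUpTo N U → LieUpTo N (Φ U) := fun U hU =>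
    LieUpTo.sum _ fun k _ => (hU.negAd_pow hU.euler k).smul _
  set Ψ := ∑ k ∈ Finset.range N, ((k.factorial : ℚ)⁻¹) • (FatgraphJohnson.negAd Z ^ k) (Φ Y)
  have hΨ : LieUpTo N Ψ := LieUpTo.sum _ fun k _ => (hZ.negAd_pow (hΦL Y hY) k).smul _
  have hexp : expSeries W = expSeries Y * expSeries Z := expSeries_mul_eq Y Z
  have c1 := euler_expSeries_cong hW0 N
  -- By the Leibniz rule the logarithmic derivative of exp Y exp Z is that of exp Y conjugated by
  -- exp Z, plus that of exp Z. Both are built from `Y` and `Z` by brackets.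
  have c2 : Cong N (FatgraphJohnson.euler (expSeries W)) (expSeries W * (Ψ + Φ Z)) := by
    rw [hexp, euler_mul, mul_add]
    refine Cong.add ?_ ?_
    · refine ((euler_expSeries_cong hY0 N).mul (Cong.refl _)).trans ?_
      rw [mul_assoc, mul_assoc]
      exact (Cong.refl _).mul (mul_expSeries_cong hZ0 (Φ Y) N)
    · rw [mul_assoc]
      exact (Cong.refl _).mul (euler_expSeries_cong hZ0 N)
  have c3 := (Cong.refl (expSeries (-W))).mul (c2.symm.trans c1)
  rw [← mul_assoc, ← mul_assoc, expSeries_neg_mul hW0, one_mul, one_mul] at c3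
  have h1 := lieUpTo_of_logDeriv hW0 ((hΨ.add (hΦL Z hZ)).congr c3)
  have h2 := (h1.sub hY).sub hZ
  have e : W - Y - Z = FatgraphJohnson.hausdorff Y Z := by rw [hWdef]; abel
  rwa [e] at h2

end CBH

/-! ## Automorphisms of the completed tensor algebra -/

section Completed

variable {g : ℕ}

theorem inFiltration_iff {p : ℕ} {w : CompletedTensor g} :
    InFiltration p w ↔ Cong p (w : PowerSeries (TA g)) 0 := by
  refine forall₂_congr fun i _ => ?_
  rw [map_zero]
  rfl

theorem component_mem (n : ℕ) (w : CompletedTensor g) : component n w ∈ tensorPower g n := w.2 n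

theorem component_add (n : ℕ) (w v : CompletedTensor g) :
    component n (w + v) = component n w + component n v := map_add _ _ _

theorem component_sub (n : ℕ) (w v : CompletedTensor g) :
    component n (w - v) = component n w - component n v := map_sub _ _ _

theorem component_smul (n : ℕ) (r : ℚ) (w : CompletedTensor g) :
    component n (r • w) = r • component n w := PowerSeries.coeff_smul ..

theorem component_sum {ι : Type*} (n : ℕ) (s : Finset ι) (F : ι → CompletedTensor g) :
    component n (∑ i ∈ s, F i) = ∑ i ∈ s, component n (F i) := by
  rw [component, AddSubmonoidClass.coe_finsetSum, map_sum]
  rfl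

theorem component_one (n : ℕ) : component n (1 : CompletedTensor g) = if n = 0 then 1 else 0 := by
  rw [component, OneMemClass.coe_one, PowerSeries.coeff_one]

theorem component_mul (n : ℕ) (w v : CompletedTensor g) : component n (w * v) =
    ∑ p ∈ Finset.HasAntidiagonal.antidiagonal n, component p.1 w * component p.2 v := by
  rw [component, MulMemClass.coe_mul, PowerSeries.coeff_mul]
  rfl

theorem component_ofH (n : ℕ) (x : Hlgy g) :
    component n (ofH x) = if n = 1 then TensorAlgebra.ι ℚ x else 0 :=
  PowerSeries.coeff_monomial ..

theorem completed_ext {w v : CompletedTensor g} (h : ∀ n, component n w = component n v) :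
    w = v := Subtype.ext (PowerSeries.ext h)

namespace InFiltration

variable {p q : ℕ} {w v : CompletedTensor g}

theorem mono (hpq : p ≤ q) (h : InFiltration q w) : InFiltration p w :=
  fun n hn => h n (hn.trans_le hpq)

theorem add (h : InFiltration p w) (h' : InFiltration p v) : InFiltration p (w + v) :=
  fun n hn => by rw [component_add, h n hn, h' n hn, add_zero]

theorem sub (h : InFiltration p w) (h' : InFiltration p v) : InFiltration p (w - v) :=
  fun n hn => by rw [component_sub, h n hn, h' n hn, sub_zero]

theorem smul (r : ℚ) (h : InFiltration p w) : InFiltration p (r • w) :=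
  fun n hn => by rw [component_smul, h n hn, smul_zero]

theorem sum {ι : Type*} (s : Finset ι) {F : ι → CompletedTensor g}
    (h : ∀ i ∈ s, InFiltration p (F i)) : InFiltration p (∑ i ∈ s, F i) := fun n hn => by
  rw [component_sum]
  exact Finset.sum_eq_zero fun i hi => h i hi n hn

theorem mul (h : InFiltration p w) (h' : InFiltration q v) : InFiltration (p + q) (w * v) :=
  inFiltration_iff.mpr ((inFiltration_iff.mp h).mul_zero (inFiltration_iff.mp h'))

theorem zero (p : ℕ) : InFiltration p (0 : CompletedTensor g) := fun _ _ => map_zero _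

theorem of_zero (w : CompletedTensor g) : InFiltration 0 w := fun n hn => by omega

theorem eq_zero (h : ∀ p, InFiltration p w) : w = 0 :=
  completed_ext fun n => (h (n + 1) n n.lt_succ_self).trans (map_zero _).symm

/-- The leading component of a product. -/
theorem component_mul (h : InFiltration p w) (h' : InFiltration q v) :
    component (p + q) (w * v) = component p w * component q v := by
  rw [FatgraphJohnson.component_mul, Finset.sum_eq_single (p, q)]
  · intro r hr hne
    have hr' := Finset.HasAntidiagonal.mem_antidiagonal.mp hr
    by_cases h1 : r.1 < p
    · rw [h _ h1, zero_mul]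
    · by_cases h2 : r.2 < q
      · rw [h' _ h2, mul_zero]
      · exact absurd (Prod.ext (by omega) (by omega)) hne
  · intro h
    exact absurd (Finset.HasAntidiagonal.mem_antidiagonal (n := p + q) (a := (p, q)) |>.mpr rfl) h

end InFiltration

theorem ofH_inFiltration (x : Hlgy g) : InFiltration 1 (ofH x) := fun n hn => by
  rw [component_ofH, if_neg (by omega)]

/-- An endomorphism inducing the identity on the graded quotients of the filtration. -/
def IsUnipotent (Φ : CompletedTensor g →ₐ[ℚ] CompletedTensor g) : Prop :=
  ∀ p w, InFiltration p w → InFiltration (p + 1) (Φ w - w)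

namespace IsUnipotent

variable {Φ : CompletedTensor g →ₐ[ℚ] CompletedTensor g} (hΦ : IsUnipotent Φ)
include hΦ

theorem map_inFiltration {p : ℕ} {w : CompletedTensor g} (h : InFiltration p w) :
    InFiltration p (Φ w) := by
  simpa using ((hΦ p w h).mono p.le_succ).add h

/-- `w` and `Φ w` have the same leading term, so the order of `w` can be raised step by step. -/
theorem inFiltration_of_map {p : ℕ} {w : CompletedTensor g} (h : InFiltration p (Φ w)) :
    InFiltration p w := by
  suffices H : ∀ q ≤ p, InFiltration q w from H p le_rfl
  intro q
  induction q with
  | zero => exact fun _ => InFiltration.of_zero w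
  | succ q ih =>
    intro hq
    have := (h.mono hq).sub (hΦ q w (ih (by omega)))
    simpa using this

theorem injective : Function.Injective Φ := by
  rw [injective_iff_map_eq_zero]
  intro w hw
  exact InFiltration.eq_zero fun p => hΦ.inFiltration_of_map (hw ▸ InFiltration.zero p)

/-- Successive approximation: adding the defect `v - Φ t` to `t` raises the order of the defect by
one. -/
theorem surjective : Function.Surjective Φ := by
  intro v
  let s : ℕ → CompletedTensor g := fun N => Nat.rec 0 (fun _ t => t + (v - Φ t)) N
  have hs : ∀ N, s (N + 1) = s N + (v - Φ (s N)) := fun N => rfl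
  have h1 : ∀ N, InFiltration N (v - Φ (s N)) := by
    intro N
    induction N with
    | zero => exact InFiltration.of_zero _
    | succ N ih =>
      have := (InFiltration.zero (N + 1)).sub (hΦ N _ ih)
      have e : v - Φ (s (N + 1)) = 0 - (Φ (v - Φ (s N)) - (v - Φ (s N))) := by
        rw [hs, map_add]; abel
      rwa [e]
  have h2 : ∀ N k, InFiltration N (s (N + k) - s N) := by
    intro N k
    induction k with
    | zero => simpa using InFiltration.zero N
    | succ k ih =>
      have := ih.add ((h1 (N + k)).mono (Nat.le_add_right N k))
      have e : s (N + (k + 1)) - s N = s (N + k) - s N + (v - Φ (s (N + k))) := by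
        rw [← add_assoc, hs]; abel
      rwa [e]
  -- The degree `n` component of the approximations is stationary from index `n + 1` on.
  let w : CompletedTensor g :=
    ⟨PowerSeries.mk fun n => component n (s (n + 1)), fun n => by
      rw [PowerSeries.coeff_mk]; exact component_mem _ _⟩
  have hw : ∀ N, InFiltration N (w - s N) := by
    intro N n hn
    have h3 := h2 (n + 1) (N - (n + 1)) n n.lt_succ_self
    rw [Nat.add_sub_cancel' hn, component_sub] at h3
    rw [component_sub, sub_eq_zero, sub_eq_zero.mp h3]
    change PowerSeries.coeff n (PowerSeries.mk fun n => component n (s (n + 1))) = _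
    rw [PowerSeries.coeff_mk]
  refine ⟨w, sub_eq_zero.mp (InFiltration.eq_zero fun N => ?_)⟩
  have := (hΦ.map_inFiltration (hw N)).sub (h1 N)
  simpa using this

/-- A unipotent endomorphism as an automorphism. -/
def equiv : CompletedTensor g ≃ₐ[ℚ] CompletedTensor g :=
  AlgEquiv.ofBijective Φ ⟨hΦ.injective, hΦ.surjective⟩

theorem equiv_apply (w : CompletedTensor g) : hΦ.equiv w = Φ w := rfl

theorem isIA_equiv : IsIA hΦ.equiv :=
  ⟨fun _ _ => ⟨hΦ.inFiltration_of_map, hΦ.map_inFiltration⟩, fun w hw => hΦ 1 w hw⟩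

end IsUnipotent

/-! ### The universal property -/

section Extend

variable (f : Hlgy g →ₗ[ℚ] CompletedTensor g)

theorem lift_inFiltration (hf : ∀ x, InFiltration 1 (f x)) {k : ℕ} :
    ∀ {t : TA g}, t ∈ tensorPower g k → InFiltration k (TensorAlgebra.lift ℚ f t) := by
  induction k with
  | zero => exact fun _ => InFiltration.of_zero _
  | succ k ih =>
    intro t ht
    rw [tensorPower, pow_succ] at ht
    induction ht using Submodule.mul_induction_on' with
    | mem_mul_mem a ha b hb =>
      obtain ⟨x, rfl⟩ := hb
      rw [map_mul, TensorAlgebra.lift_ι_apply]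
      exact (ih ha).mul (hf x)
    | add a ha b hb iha ihb => rw [map_add]; exact iha.add ihb

/-- The leading term of a product is the product of the leading terms, and `f` is the identity to
lowest order. -/
theorem component_lift (hf : ∀ x, InFiltration 2 (f x - ofH x)) {k : ℕ} :
    ∀ {t : TA g}, t ∈ tensorPower g k → component k (TensorAlgebra.lift ℚ f t) = t := by
  have hf1 : ∀ x, InFiltration 1 (f x) := fun x => by
    simpa using ((hf x).mono one_le_two).add (ofH_inFiltration x)
  induction k with
  | zero =>
    intro t ht
    rw [tensorPower, pow_zero] at ht
    obtain ⟨r, rfl⟩ := Submodule.mem_one.mp ht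
    rw [AlgHom.commutes, Algebra.algebraMap_eq_smul_one, component_smul, component_one, if_pos rfl,
      Algebra.algebraMap_eq_smul_one]
  | succ k ih =>
    intro t ht
    rw [tensorPower, pow_succ] at ht
    induction ht using Submodule.mul_induction_on' with
    | mem_mul_mem a ha b hb =>
      obtain ⟨x, rfl⟩ := hb
      rw [map_mul, TensorAlgebra.lift_ι_apply,
        (lift_inFiltration f hf1 (k := k) ha).component_mul (hf1 x), ih ha]
      have := hf x 1 one_lt_two
      rw [component_sub, component_ofH, if_pos rfl, sub_eq_zero] at this
      rw [this]
    | add a ha b hb iha ihb => rw [map_add, component_add, iha, ihb]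

/-- The value at `w` of the endomorphism extending `f`. -/
def extendFun (w : CompletedTensor g) : CompletedTensor g :=
  ⟨PowerSeries.mk fun n => ∑ k ∈ Finset.range (n + 1),
    component n (TensorAlgebra.lift ℚ f (component k w)), fun n => by
      rw [PowerSeries.coeff_mk]
      exact Submodule.sum_mem _ fun k _ => component_mem _ _⟩

theorem component_extendFun (w : CompletedTensor g) (n : ℕ) :
    component n (extendFun f w) = ∑ k ∈ Finset.range (n + 1),
      component n (TensorAlgebra.lift ℚ f (component k w)) := by
  rw [component, extendFun, PowerSeries.coeff_mk]

theorem extendFun_cong (hf : ∀ x, InFiltration 1 (f x)) (w : CompletedTensor g) (N : ℕ) :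
    Cong N (extendFun f w : PowerSeries (TA g))
      (∑ k ∈ Finset.range N, (TensorAlgebra.lift ℚ f (component k w) : PowerSeries (TA g))) := by
  intro n hn
  change component n _ = _
  rw [component_extendFun, map_sum]
  refine Finset.sum_subset (Finset.range_mono hn) fun k _ hk => ?_
  exact lift_inFiltration f hf (component_mem k w) n (by simpa using hk)

/-- The endomorphism of the completed tensor algebra extending a linear map on `H`. -/
def extend (hf : ∀ x, InFiltration 1 (f x)) : CompletedTensor g →ₐ[ℚ] CompletedTensor g :=
  AlgHom.ofLinearMap
    { toFun := extendFun f
      map_add' := fun w v => completed_ext fun n => by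
        simp only [component_add, component_extendFun, map_add, Finset.sum_add_distrib]
      map_smul' := fun r w => completed_ext fun n => by
        simp only [component_smul, component_extendFun, map_smul, Finset.smul_sum,
          RingHom.id_apply] }
    (completed_ext fun n => by
      simp only [LinearMap.coe_mk, AddHom.coe_mk, component_extendFun, component_one]
      rw [Finset.sum_eq_single 0]
      · rw [if_pos rfl, map_one, component_one]
      · intro k _ hk
        rw [if_neg hk, map_zero]
        exact map_zero _
      · simp)
    (fun w v => Subtype.ext <| Cong.eq_of_forall fun N => by
      refine (extendFun_cong f hf _ N).trans (Cong.trans ?_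
        ((extendFun_cong f hf w N).mul (extendFun_cong f hf v N)).symm)
      refine Cong.trans (fun i _ => ?_) (sum_antidiagonal_cong
        (fun k => inFiltration_iff.mp (lift_inFiltration f hf (component_mem k w)))
        (fun k => inFiltration_iff.mp (lift_inFiltration f hf (component_mem k v))) N)
      congr 1
      refine Finset.sum_congr rfl fun n _ => ?_
      rw [component_mul, map_sum, AddSubmonoidClass.coe_finsetSum]
      refine Finset.sum_congr rfl fun p _ => ?_
      rw [map_mul, MulMemClass.coe_mul])

theorem component_extend (hf : ∀ x, InFiltration 1 (f x)) (w : CompletedTensor g) (n : ℕ) :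
    component n (extend f hf w) = ∑ k ∈ Finset.range (n + 1),
      component n (TensorAlgebra.lift ℚ f (component k w)) := component_extendFun f w n

theorem extend_ofH (hf : ∀ x, InFiltration 1 (f x)) (x : Hlgy g) : extend f hf (ofH x) = f x := by
  refine completed_ext fun n => ?_
  rw [component_extend]
  simp only [component_ofH]
  rcases n with _ | n
  · rw [hf x 0 one_pos, Finset.sum_range_one, if_neg zero_ne_one, map_zero]
    exact map_zero _
  · rw [Finset.sum_eq_single 1]
    · rw [if_pos rfl, TensorAlgebra.lift_ι_apply]
    · intro k _ hk
      rw [if_neg hk, map_zero]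
      exact map_zero _
    · intro h
      simp at h

theorem extend_isUnipotent (hf : ∀ x, InFiltration 1 (f x))
    (hf2 : ∀ x, InFiltration 2 (f x - ofH x)) : IsUnipotent (extend f hf) := by
  intro p w hw n hn
  rw [component_sub, component_extend, Finset.sum_eq_single n]
  · rw [component_lift f hf2 (component_mem n w), sub_self]
  · intro k hk hkn
    rw [hw k (by simp at hk; omega), map_zero]
    exact map_zero _
  · simp

end Extend

/-- Density of the tensor algebra: the leading component of the remainder is itself a tensor and can
be subtracted. -/
theorem exists_lift_ofH_sub_inFiltration (w : CompletedTensor g) (N : ℕ) :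
    ∃ t : TA g, InFiltration N (w - TensorAlgebra.lift ℚ ofH t) := by
  induction N with
  | zero => exact ⟨0, InFiltration.of_zero _⟩
  | succ N ih =>
    obtain ⟨t, ht⟩ := ih
    set u := component N (w - TensorAlgebra.lift ℚ ofH t) with hu
    have hum : u ∈ tensorPower g N := component_mem _ _
    refine ⟨t + u, ?_⟩
    have e : w - TensorAlgebra.lift ℚ ofH (t + u) =
        w - TensorAlgebra.lift ℚ ofH t - TensorAlgebra.lift ℚ ofH u := by
      rw [map_add]; abel
    rw [e]
    intro n hn
    rcases Nat.lt_succ_iff_lt_or_eq.mp hn with h | rfl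
    · exact (ht.sub (lift_inFiltration ofH ofH_inFiltration hum)) n h
    · rw [component_sub, component_lift ofH (fun x => by simpa using InFiltration.zero 2) hum,
        ← hu, sub_self]

/-- Filtered endomorphisms are determined by their restriction to `H`. -/
theorem algHom_ext_of_filtered {Φ Ψ : CompletedTensor g →ₐ[ℚ] CompletedTensor g}
    (hΦ : ∀ p w, InFiltration p w → InFiltration p (Φ w))
    (hΨ : ∀ p w, InFiltration p w → InFiltration p (Ψ w))
    (h : ∀ x, Φ (ofH x) = Ψ (ofH x)) : Φ = Ψ := by
  have hlift : Φ.comp (TensorAlgebra.lift ℚ ofH) = Ψ.comp (TensorAlgebra.lift ℚ ofH) := by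
    refine TensorAlgebra.hom_ext (LinearMap.ext fun x => ?_)
    simpa using h x
  refine AlgHom.ext fun w => sub_eq_zero.mp (InFiltration.eq_zero fun N => ?_)
  obtain ⟨t, ht⟩ := exists_lift_ofH_sub_inFiltration w N
  have e : Φ w - Ψ w = Φ (w - TensorAlgebra.lift ℚ ofH t) - Ψ (w - TensorAlgebra.lift ℚ ofH t) := by
    have := AlgHom.congr_fun hlift t
    simp only [AlgHom.comp_apply] at this
    rw [map_sub, map_sub, this]; abel
  rw [e]
  exact (hΦ N _ ht).sub (hΨ N _ ht)

theorem IsIA.symm {U : CompletedTensor g ≃ₐ[ℚ] CompletedTensor g} (hU : IsIA U) : IsIA U.symm := by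
  have h1 : ∀ p w, InFiltration p (U.symm w) ↔ InFiltration p w := fun p w => by
    rw [← hU.1, AlgEquiv.apply_symm_apply]
  refine ⟨h1, fun w hw => ?_⟩
  have := (InFiltration.zero 2).sub (hU.2 _ ((h1 1 w).mpr hw))
  simpa using this

theorem IsIA.trans {U V : CompletedTensor g ≃ₐ[ℚ] CompletedTensor g} (hU : IsIA U) (hV : IsIA V) :
    IsIA (U.trans V) := by
  refine ⟨fun p w => (hV.1 p _).trans (hU.1 p w), fun w hw => ?_⟩
  simpa using (hV.2 _ ((hU.1 1 w).mpr hw)).add (hU.2 w hw)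

/-- An element of `IA` can be prescribed on a basis of `H`. -/
theorem exists_isIA_of_basis {ι : Type*} [Finite ι] (b : Module.Basis ι ℚ (Hlgy g))
    (v : ι → CompletedTensor g) (hv : ∀ i, InFiltration 2 (v i - ofH (b i))) :
    ∃ U : CompletedTensor g ≃ₐ[ℚ] CompletedTensor g, IsIA U ∧ ∀ i, U (ofH (b i)) = v i := by
  have := Fintype.ofFinite ι
  set f := b.constr ℚ v with hfdef
  have hf2 : ∀ x, InFiltration 2 (f x - ofH x) := by
    intro x
    have e : f x - ofH x = ∑ i, b.repr x i • (v i - ofH (b i)) := by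
      conv_lhs => rw [← b.sum_repr x]
      rw [map_sum, map_sum, ← Finset.sum_sub_distrib]
      refine Finset.sum_congr rfl fun i _ => ?_
      rw [map_smul, map_smul, ← smul_sub, hfdef, Module.Basis.constr_basis]
    rw [e]
    exact InFiltration.sum _ fun i _ => (hv i).smul _
  have hf : ∀ x, InFiltration 1 (f x) := fun x => by
    simpa using ((hf2 x).mono one_le_two).add (ofH_inFiltration x)
  refine ⟨(extend_isUnipotent f hf hf2).equiv, (extend_isUnipotent f hf hf2).isIA_equiv,
    fun i => ?_⟩
  rw [IsUnipotent.equiv_apply, extend_ofH, hfdef, Module.Basis.constr_basis]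

/-! ### Exponentials in the completed tensor algebra -/

/-- The exponential of an element of the completed tensor algebra. -/
def expT (w : CompletedTensor g) : CompletedTensor g :=
  ⟨expSeries (w : PowerSeries (TA g)), fun n => by
    rw [expSeries, PowerSeries.coeff_mk]
    refine Submodule.sum_mem _ fun k _ => Submodule.smul_mem _ _ ?_
    rw [← SubmonoidClass.coe_pow]
    exact (w ^ k).2 n⟩

theorem expT_cong_sum {w : CompletedTensor g} (hw : InFiltration 1 w) (N : ℕ) :
    InFiltration N (expT w - ∑ k ∈ Finset.range N, ((k.factorial : ℚ)⁻¹) • w ^ k) := by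
  rw [inFiltration_iff, AddSubgroupClass.coe_sub, Cong.sub_iff, AddSubmonoidClass.coe_finsetSum]
  exact expSeries_cong_sum (inFiltration_iff.mp hw) N

/-- `U` commutes with the partial sums and preserves the order of the remainders. -/
theorem IsIA.map_expT {U : CompletedTensor g ≃ₐ[ℚ] CompletedTensor g} (hU : IsIA U)
    {w : CompletedTensor g} (hw : InFiltration 1 w) : U (expT w) = expT (U w) := by
  refine sub_eq_zero.mp (InFiltration.eq_zero fun N => ?_)
  have h1 := (hU.1 N _).mpr (expT_cong_sum hw N)
  have h2 := expT_cong_sum ((hU.1 1 w).mpr hw) N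
  have := h1.sub h2
  simp only [map_sub, map_sum, map_smul, map_pow] at this
  simpa using this

theorem expT_sub_one_sub_inFiltration {w : CompletedTensor g} (hw : InFiltration 1 w) :
    InFiltration 2 (expT w - 1 - w) := by
  rw [inFiltration_iff, AddSubgroupClass.coe_sub, AddSubgroupClass.coe_sub, sub_sub, Cong.sub_iff]
  exact expSeries_cong_one_add (inFiltration_iff.mp hw)

/-! ### Magnus expansions -/

theorem homologyClass_mul (x y : SurfaceGroup g) :
    homologyClass (x * y) = homologyClass x + homologyClass y := by
  simp [homologyClass]

theorem homologyClass_one : homologyClass (1 : SurfaceGroup g) = 0 := by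
  simp [homologyClass]

theorem homologyClass_inv (x : SurfaceGroup g) : homologyClass x⁻¹ = -homologyClass x := by
  simp [homologyClass]

theorem homologyClass_of (i : Fin g ⊕ Fin g) :
    homologyClass (FreeGroup.of i : SurfaceGroup g) = Pi.single i 1 := by
  simp [homologyClass, homologyHom]

theorem component_zero_mul (w v : CompletedTensor g) :
    component 0 (w * v) = component 0 w * component 0 v := by
  rw [component_mul]; simp

theorem component_one_mul (w v : CompletedTensor g) : component 1 (w * v) =
    component 0 w * component 1 v + component 1 w * component 0 v := by
  rw [component_mul, Finset.Nat.sum_antidiagonal_succ]; simp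

theorem isMagnusExpansion_of_generators {θ : SurfaceGroup g →* CompletedTensor g}
    (h : ∀ i, component 0 (θ (FreeGroup.of i)) = 1 ∧
      component 1 (θ (FreeGroup.of i)) = TensorAlgebra.ι ℚ (Pi.single i 1)) :
    IsMagnusExpansion θ := by
  have hinv : ∀ x, (component 0 (θ x) = 1 ∧
      component 1 (θ x) = TensorAlgebra.ι ℚ (homologyClass x)) → component 0 (θ x⁻¹) = 1 ∧
      component 1 (θ x⁻¹) = TensorAlgebra.ι ℚ (homologyClass x⁻¹) := by
    rintro x ⟨h0, h1⟩
    have e : θ x⁻¹ * θ x = 1 := by rw [← map_mul, inv_mul_cancel, map_one]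
    have e0 := congrArg (component 0) e
    have e1 := congrArg (component 1) e
    rw [component_zero_mul, component_one, if_pos rfl, h0, mul_one] at e0
    rw [component_one_mul, component_one, if_neg one_ne_zero, h0, h1, e0, one_mul, mul_one] at e1
    refine ⟨e0, ?_⟩
    rw [homologyClass_inv, map_neg, eq_neg_iff_add_eq_zero, add_comm, e1]
  intro x
  induction x using FreeGroup.induction_on with
  | C1 => rw [map_one, component_one, component_one, homologyClass_one, map_zero]; simp
  | of i => rw [homologyClass_of]; exact h i
  | inv_of i _ => exact hinv _ (by rw [homologyClass_of]; exact h i)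
  | mul x y hx hy =>
    rw [map_mul, component_zero_mul, component_one_mul, hx.1, hx.2, hy.1, hy.2, homologyClass_mul,
      map_add]
    simp [add_comm]

theorem IsMagnusExpansion.sub_one_sub_inFiltration {θ : SurfaceGroup g →* CompletedTensor g}
    (h : IsMagnusExpansion θ) (x : SurfaceGroup g) :
    InFiltration 2 (θ x - 1 - ofH (homologyClass x)) := by
  intro n hn
  rw [component_sub, component_sub, component_one, component_ofH]
  rcases (by omega : n = 0 ∨ n = 1) with rfl | rfl
  · rw [(h x).1]; simp
  · rw [(h x).2]; simp

theorem isMagnusExpansion_of_inFiltration {θ : SurfaceGroup g →* CompletedTensor g}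
    (h : ∀ x, InFiltration 2 (θ x - 1 - ofH (homologyClass x))) : IsMagnusExpansion θ := by
  intro x
  have h0 := h x 0 two_pos
  have h1 := h x 1 one_lt_two
  rw [component_sub, component_sub, component_one, component_ofH, sub_sub, sub_eq_zero] at h0 h1
  simp at h0 h1
  exact ⟨h0, h1⟩

/-- On a free group the values at the generators are arbitrary units; exponentials come with
explicit inverses. -/
theorem exists_isMagnusExpansion (g : ℕ) :
    ∃ θ : SurfaceGroup g →* CompletedTensor g, IsMagnusExpansion θ := by
  have hH : ∀ x : Hlgy g, Cong 1 (ofH x : PowerSeries (TA g)) 0 := fun x =>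
    inFiltration_iff.mp (ofH_inFiltration x)
  let u : Fin g ⊕ Fin g → (CompletedTensor g)ˣ := fun i =>
    { val := expT (ofH (Pi.single i 1))
      inv := expT (-ofH (Pi.single i 1))
      val_inv := Subtype.ext (expSeries_mul_neg (hH _))
      inv_val := Subtype.ext (expSeries_neg_mul (hH _)) }
  refine ⟨(Units.coeHom _).comp (FreeGroup.lift u), isMagnusExpansion_of_generators fun i => ?_⟩
  have e : ((Units.coeHom _).comp (FreeGroup.lift u)) (FreeGroup.of i) =
      expT (ofH (Pi.single i 1)) := by simp [u]
  have h := expT_sub_one_sub_inFiltration (ofH_inFiltration (g := g) (Pi.single i 1))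
  have h0 := h 0 two_pos
  have h1 := h 1 one_lt_two
  rw [component_sub, component_sub, component_one, component_ofH, sub_sub, sub_eq_zero] at h0 h1
  simp at h0 h1
  rw [e]
  exact ⟨h0, h1⟩

theorem IsIA.map_magnus {U : CompletedTensor g ≃ₐ[ℚ] CompletedTensor g} (hU : IsIA U)
    {θ : SurfaceGroup g →* CompletedTensor g} (hθ : IsMagnusExpansion θ) :
    IsMagnusExpansion ((U : CompletedTensor g →* CompletedTensor g).comp θ) := by
  refine isMagnusExpansion_of_inFiltration fun x => ?_
  have h1 := hθ.sub_one_sub_inFiltration x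
  have h2 : InFiltration 1 (θ x - 1) := by
    simpa using (h1.mono one_le_two).add (ofH_inFiltration (homologyClass x))
  have := (hU.2 _ h2).add h1
  rw [map_sub, map_one] at this
  have e : (U : CompletedTensor g →* CompletedTensor g).comp θ x - 1 - ofH (homologyClass x) =
      U (θ x) - 1 - (θ x - 1) + (θ x - 1 - ofH (homologyClass x)) := by
    simp only [MonoidHom.comp_apply]
    change U (θ x) - 1 - _ = _
    abel
  rwa [e]

theorem IsMagnusExpansion.exists_isIA {θ : SurfaceGroup g →* CompletedTensor g}
    (hθ : IsMagnusExpansion θ) : ∃ U : CompletedTensor g ≃ₐ[ℚ] CompletedTensor g, IsIA U ∧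
      ∀ i, U (1 + ofH (Pi.single i 1)) = θ (FreeGroup.of i) := by
  obtain ⟨U, hU, hUb⟩ := exists_isIA_of_basis (Pi.basisFun ℚ (Fin g ⊕ Fin g))
    (fun i => θ (FreeGroup.of i) - 1) (fun i => by
      have := hθ.sub_one_sub_inFiltration (FreeGroup.of i)
      rwa [homologyClass_of, ← Pi.basisFun_apply ℚ] at this)
  refine ⟨U, hU, fun i => ?_⟩
  have := hUb i
  rw [Pi.basisFun_apply] at this
  rw [map_add, map_one, this, add_sub_cancel]

/-- Two Magnus expansions differ by an element of `IA`. -/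
theorem exists_isIA_comp_eq {θ θ' : SurfaceGroup g →* CompletedTensor g}
    (hθ : IsMagnusExpansion θ) (hθ' : IsMagnusExpansion θ') :
    ∃ U : CompletedTensor g ≃ₐ[ℚ] CompletedTensor g, IsIA U ∧ ∀ x, U (θ' x) = θ x := by
  obtain ⟨V, hV, hVg⟩ := hθ.exists_isIA
  obtain ⟨V', hV', hVg'⟩ := hθ'.exists_isIA
  refine ⟨V'.symm.trans V, hV'.symm.trans hV, fun x => ?_⟩
  have : ((V'.symm.trans V : CompletedTensor g ≃ₐ[ℚ] CompletedTensor g) :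
      CompletedTensor g →* CompletedTensor g).comp θ' = θ := by
    refine FreeGroup.ext_hom _ _ fun i => ?_
    change V (V'.symm (θ' (FreeGroup.of i))) = _
    rw [← hVg' i, AlgEquiv.symm_apply_apply, hVg]
  exact DFunLike.congr_fun this x

/-- Elements of `IA` are determined by their effect on a Magnus expansion. -/
theorem isIA_ext {θ : SurfaceGroup g →* CompletedTensor g} (hθ : IsMagnusExpansion θ)
    {U V : CompletedTensor g ≃ₐ[ℚ] CompletedTensor g} (hU : IsIA U) (hV : IsIA V)
    (h : ∀ x, U (θ x) = V (θ x)) : U = V := by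
  -- `B` carries the basis of H to the elements θ(generator) - 1, so after composition with `B` the
  -- automorphisms can be compared on H.
  obtain ⟨B, hB, hBg⟩ := hθ.exists_isIA
  have key : (B.trans U).toAlgHom = (B.trans V).toAlgHom := by
    refine algHom_ext_of_filtered (fun p w hw => ((hB.trans hU).1 p w).mpr hw)
      (fun p w hw => ((hB.trans hV).1 p w).mpr hw) fun x => ?_
    have : (B.trans U).toAlgHom.toLinearMap ∘ₗ ofH = (B.trans V).toAlgHom.toLinearMap ∘ₗ ofH := by
      refine (Pi.basisFun ℚ (Fin g ⊕ Fin g)).ext fun i => ?_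
      rw [Pi.basisFun_apply]
      change U (B (ofH (Pi.single i 1))) = V (B (ofH (Pi.single i 1)))
      have e : B (ofH (Pi.single i 1)) = θ (FreeGroup.of i) - 1 := by
        rw [← hBg, map_add, map_one, add_sub_cancel_left]
      rw [e, map_sub, map_sub, map_one, map_one, h]
    exact LinearMap.congr_fun this x
  refine AlgEquiv.ext fun w => ?_
  obtain ⟨v, rfl⟩ := B.surjective w
  exact AlgHom.congr_fun key v

end Completed

/-! ## The boundary cycle of a fatgraph -/

namespace Fatgraph

variable {D : Type*} (G : Fatgraph D)

theorem boundary_apply (x : D) : G.boundary x = G.bar (G.next x) := rfl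

theorem boundary_bar_tail : G.boundary (G.bar G.tail) = G.tail := by
  rw [boundary_apply, G.univalent, G.bar_bar]

theorem next_next_next (x : D) : G.next (G.next (G.next x)) = x := by
  by_cases h : x = G.bar G.tail
  · rw [h, G.univalent, G.univalent, G.univalent]
  · exact (G.trivalent x h).2

theorem next_ne_bar_tail {x : D} (h : x ≠ G.bar G.tail) : G.next x ≠ G.bar G.tail := fun h' =>
  h (G.next.injective (h'.trans G.univalent.symm))

/-- The number of steps along the boundary cycle from the tail to an oriented edge. -/
def pos (x : D) : ℕ := sInf {i | (G.boundary ^ i) G.tail = x}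

/-- The sum of a function over the part of the boundary cycle between the tail and an oriented
edge. -/
def potential {W : Type*} [AddCommGroup W] (J : D → W) (x : D) : W :=
  ∑ i ∈ Finset.range (G.pos x), J ((G.boundary ^ i) G.tail)

theorem pos_le {x : D} {i : ℕ} (h : (G.boundary ^ i) G.tail = x) : G.pos x ≤ i := Nat.sInf_le h

theorem pos_tail : G.pos G.tail = 0 := Nat.le_zero.mp (G.pos_le rfl)

theorem potential_tail {W : Type*} [AddCommGroup W] (J : D → W) : G.potential J G.tail = 0 := by
  rw [potential, G.pos_tail, Finset.sum_range_zero]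

theorem map_potential {W W' : Type*} [AddCommGroup W] [AddCommGroup W'] (J : D → W) (T : W →+ W')
    (x : D) : T (G.potential J x) = G.potential (fun y => T (J y)) x := map_sum _ _ _

section Finite

variable [Finite D]

theorem pow_pos_tail (x : D) : (G.boundary ^ G.pos x) G.tail = x := by
  obtain ⟨i, _, _, hi⟩ := (G.one_boundary G.tail x).exists_pow_eq''
  exact Nat.sInf_mem (s := {i | (G.boundary ^ i) G.tail = x}) ⟨i, hi⟩

theorem pos_injective : Function.Injective G.pos := fun x y h => by
  rw [← G.pow_pos_tail x, h, G.pow_pos_tail]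

theorem pos_boundary {x : D} (h : x ≠ G.bar G.tail) : G.pos (G.boundary x) = G.pos x + 1 := by
  have h1 : G.pos (G.boundary x) ≤ G.pos x + 1 := G.pos_le (by
    rw [pow_succ', Equiv.Perm.mul_apply, G.pow_pos_tail])
  have h2 := G.pow_pos_tail (G.boundary x)
  rcases hp : G.pos (G.boundary x) with _ | n
  · rw [hp, pow_zero, Equiv.Perm.one_apply, ← G.boundary_bar_tail] at h2
    exact absurd (G.boundary.injective h2).symm h
  · rw [hp, pow_succ', Equiv.Perm.mul_apply] at h2
    have := G.pos_le (G.boundary.injective h2)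
    omega

/-- After `bar tail` the cycle is back at the tail, so a larger position could be shortened. -/
theorem pos_le_bar_tail (x : D) : G.pos x ≤ G.pos (G.bar G.tail) := by
  by_contra! h
  have h1 : (G.boundary ^ (G.pos (G.bar G.tail) + 1)) G.tail = G.tail := by
    rw [pow_succ', Equiv.Perm.mul_apply, G.pow_pos_tail, G.boundary_bar_tail]
  have h2 : (G.boundary ^ (G.pos x - (G.pos (G.bar G.tail) + 1))) G.tail = x := by
    calc _ = (G.boundary ^ (G.pos x - (G.pos (G.bar G.tail) + 1)))
          ((G.boundary ^ (G.pos (G.bar G.tail) + 1)) G.tail) := by rw [h1]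
      _ = x := by
        rw [← Equiv.Perm.mul_apply, ← pow_add, Nat.sub_add_cancel h, G.pow_pos_tail]
  have := G.pos_le h2
  omega

theorem pos_pow_boundary (x : D) (i : ℕ) (h : G.pos x + i ≤ G.pos (G.bar G.tail)) :
    G.pos ((G.boundary ^ i) x) = G.pos x + i := by
  induction i with
  | zero => simp
  | succ i ih =>
    have hi := ih (by omega)
    rw [pow_succ', Equiv.Perm.mul_apply, G.pos_boundary, hi, add_assoc]
    intro h'
    rw [h'] at hi
    omega

theorem exists_pow_eq_bar (x : D) : (G.boundary ^ G.pathLength x) x = G.bar x := by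
  obtain ⟨i, _, _, hi⟩ := (G.one_boundary x (G.bar x)).exists_pow_eq''
  exact Nat.sInf_mem (s := {i | (G.boundary ^ i) x = G.bar x}) ⟨i, hi⟩

theorem pathLength_eq {x : D} (h : G.pos x < G.pos (G.bar x)) :
    G.pathLength x = G.pos (G.bar x) - G.pos x := by
  have hle := G.pos_le_bar_tail (G.bar x)
  have h1 : G.pathLength x ≤ G.pos (G.bar x) - G.pos x := Nat.sInf_le (by
    refine G.pos_injective ?_
    rw [G.pos_pow_boundary _ _ (by omega)]
    omega)
  have h2 := congrArg G.pos (G.exists_pow_eq_bar x)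
  rw [G.pos_pow_boundary _ _ (by omega)] at h2
  omega

/-- On the boundary cycle cut at the tail, the path stays within the interval exactly if `x` is met
before its reverse. -/
theorem avoidsTail_iff (x : D) : G.AvoidsTail x ↔ G.pos x < G.pos (G.bar x) := by
  constructor
  · intro h
    have key : ∀ i ≤ G.pathLength x, G.pos ((G.boundary ^ i) x) = G.pos x + i := by
      intro i
      induction i with
      | zero => simp
      | succ i ih =>
        intro hi
        rw [pow_succ', Equiv.Perm.mul_apply, G.pos_boundary (h i (by omega)), ih (by omega),
          add_assoc]
    have h1 := key _ le_rfl
    rw [G.exists_pow_eq_bar] at h1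
    rcases Nat.eq_zero_or_pos (G.pathLength x) with h0 | h0
    · have := G.exists_pow_eq_bar x
      rw [h0, pow_zero, Equiv.Perm.one_apply] at this
      exact absurd this.symm (G.bar_ne x)
    · omega
  · intro h i hi h'
    have hle := G.pos_le_bar_tail (G.bar x)
    rw [G.pathLength_eq h] at hi
    have := G.pos_pow_boundary x i (by omega)
    rw [h'] at this
    omega

variable {W : Type*} [AddCommGroup W] (J : D → W)

theorem potential_boundary {x : D} (h : x ≠ G.bar G.tail) :
    G.potential J (G.boundary x) = G.potential J x + J x := by
  rw [potential, G.pos_boundary h, Finset.sum_range_succ, G.pow_pos_tail, potential]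

theorem sum_path {x : D} (h : G.pos x < G.pos (G.bar x)) :
    ∑ i ∈ Finset.range (G.pathLength x), J ((G.boundary ^ i) x) =
      G.potential J (G.bar x) - G.potential J x := by
  have hav := (G.avoidsTail_iff x).mpr h
  have h1 : ∀ i ∈ Finset.range (G.pathLength x), J ((G.boundary ^ i) x) =
      G.potential J ((G.boundary ^ (i + 1)) x) - G.potential J ((G.boundary ^ i) x) := by
    intro i hi
    rw [pow_succ', Equiv.Perm.mul_apply, G.potential_boundary J (hav i (Finset.mem_range.mp hi)),
      add_sub_cancel_left]
  rw [Finset.sum_congr rfl h1,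
    Finset.sum_range_sub (fun i => G.potential J ((G.boundary ^ i) x)), G.exists_pow_eq_bar,
    pow_zero, Equiv.Perm.one_apply]

/-- The potential of a function is characterised by its increments. -/
theorem eq_potential {F : D → W} (h0 : F G.tail = 0)
    (h : ∀ x, x ≠ G.bar G.tail → F (G.boundary x) = F x + J x) (x : D) :
    F x = G.potential J x := by
  suffices H : ∀ n x, G.pos x = n → F x = G.potential J x from H _ x rfl
  intro n
  induction n with
  | zero =>
    intro x hx
    obtain rfl : x = G.tail := G.pos_injective (hx.trans G.pos_tail.symm)
    rw [h0, potential_tail]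
  | succ n ih =>
    intro x hx
    obtain ⟨y, rfl⟩ := G.boundary.surjective x
    have hy : y ≠ G.bar G.tail := by
      rintro rfl
      rw [G.boundary_bar_tail, G.pos_tail] at hx
      omega
    rw [G.pos_boundary hy] at hx
    rw [h y hy, G.potential_boundary J hy, ih y (by omega)]

/-- The value of the potential at the end of the boundary cycle. -/
theorem potential_bar_tail [Fintype D] :
    G.potential J (G.bar G.tail) + J (G.bar G.tail) = ∑ x, J x := by
  have h : J (G.bar G.tail) = J ((G.boundary ^ G.pos (G.bar G.tail)) G.tail) := by
    rw [G.pow_pos_tail]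
  rw [h, potential, ← Finset.sum_range_succ (fun i => J ((G.boundary ^ i) G.tail))]
  refine Finset.sum_bij' (fun i _ => (G.boundary ^ i) G.tail) (fun x _ => G.pos x) ?_ ?_ ?_ ?_ ?_
  · exact fun _ _ => Finset.mem_univ _
  · intro x _
    have := G.pos_le_bar_tail x
    simp
    omega
  · intro i hi
    have h1 := G.pos_pow_boundary G.tail i (by simp at hi; rw [G.pos_tail]; omega)
    rw [h1, G.pos_tail, zero_add]
  · exact fun x _ => G.pow_pos_tail x
  · exact fun _ _ => rfl

end Finite

end Fatgraph

/-! ## The function `ℓ` -/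

namespace MarkedFatgraph

variable {g : ℕ} {D : Type*} (G : MarkedFatgraph g D)

theorem mark_bar (x : D) : G.mark (G.bar x) = (G.mark x)⁻¹ :=
  eq_inv_of_mul_eq_one_left (G.orientation x)

theorem hmark_bar (x : D) : G.hmark (G.bar x) = -G.hmark x := by
  rw [hmark, mark_bar, homologyClass_inv, hmark]

theorem hmark_vertex {x : D} (h : x ≠ G.bar G.tail) :
    G.hmark x + G.hmark (G.next x) + G.hmark (G.next (G.next x)) = 0 := by
  have := congrArg homologyClass (G.vertex_compatibility x h)
  rwa [homologyClass_mul, homologyClass_mul, homologyClass_one] at this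

theorem homologyClass_boundaryWord (g : ℕ) : homologyClass (boundaryWord g) = 0 := by
  rw [boundaryWord]
  have : ∀ L : List (SurfaceGroup g), (∀ x ∈ L, homologyClass x = 0) →
      homologyClass L.prod = 0 := by
    intro L
    induction L with
    | nil => intro _; rw [List.prod_nil, homologyClass_one]
    | cons x L ih =>
      intro h
      rw [List.prod_cons, homologyClass_mul, h x (by simp), ih fun y hy => h y (by simp [hy]),
        add_zero]
  refine this _ fun x hx => ?_
  obtain ⟨i, rfl⟩ := (List.mem_ofFn' _ _).mp hx
  simp only [homologyClass_mul, homologyClass_inv]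
  abel

theorem hmark_bar_tail : G.hmark (G.bar G.tail) = 0 := by
  rw [hmark, G.geometricity, homologyClass_boundaryWord]

theorem coeff_ell (n : ℕ) (x : D) : PowerSeries.coeff n (G.ell x) = G.ellComponent n x :=
  PowerSeries.coeff_mk _ _

theorem ell_cong_zero (x : D) : Cong 1 (G.ell x) 0 := by
  rw [Cong.one_iff, coeff_ell, ellComponent, map_zero]

section Finite

variable [Finite D]

/-- A path sum is an increment of the potential. The formula is odd under reversal, so the two cases
of the definition merge into it; truncating the arguments of h is harmless by `hausdorff_congr`. -/
theorem ellComponent_add_two (n : ℕ) (x : D) : G.ellComponent (n + 2) x = (1 / 3 : ℚ) •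
    (G.potential (fun y => PowerSeries.coeff (n + 2)
        (hausdorff (G.ell y) (-G.ell (G.boundary y)))) x -
      G.potential (fun y => PowerSeries.coeff (n + 2)
        (hausdorff (G.ell y) (-G.ell (G.boundary y)))) (G.bar x)) := by
  set J : D → TA g := fun y => PowerSeries.coeff (n + 2)
        (hausdorff (G.ell y) (-G.ell (G.boundary y)))
  rw [ellComponent]
  set t : D → PowerSeries (TA g) := fun y =>
    PowerSeries.mk fun j => if _h : j < n + 2 then G.ellComponent j y else 0 with ht
  have htc : ∀ y, Cong (n + 2) (t y) (G.ell y) := fun y j hj => by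
    rw [coeff_ell, ht, PowerSeries.coeff_mk, dif_pos hj]
  have ht0 : ∀ y, Cong 1 (t y) 0 := fun y =>
    ((htc y).mono (by omega)).trans (G.ell_cong_zero y)
  have hneg : ∀ {f : PowerSeries (TA g)}, Cong 1 f 0 → Cong 1 (-f) 0 := fun h => by
    simpa using h.neg
  have hJ : ∀ y i, PowerSeries.coeff (n + 2)
      (hausdorff (t ((G.boundary ^ i) y)) (-t ((G.boundary ^ (i + 1)) y))) =
        J ((G.boundary ^ i) y) := by
    intro y i
    rw [pow_succ' G.boundary i, Equiv.Perm.mul_apply]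
    exact hausdorff_congr (ht0 _) (hneg (ht0 _)) (G.ell_cong_zero _) (hneg (G.ell_cong_zero _))
      (htc _) (htc _).neg _ (by omega)
  have hint : ∀ y, G.pos y < G.pos (G.bar y) → -(1 / 3 : ℚ) •
      ∑ i ∈ Finset.range (G.pathLength y), PowerSeries.coeff (n + 2)
        (hausdorff (t ((G.boundary ^ i) y)) (-t ((G.boundary ^ (i + 1)) y))) =
      (1 / 3 : ℚ) • (G.potential J y - G.potential J (G.bar y)) := by
    intro y hy
    simp only [hJ]
    rw [G.sum_path J hy]
    module
  split_ifs with h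
  · exact hint x ((G.avoidsTail_iff x).mp h)
  · have hlt : G.pos (G.bar x) < G.pos (G.bar (G.bar x)) := by
      rw [G.avoidsTail_iff] at h
      rw [G.bar_bar]
      have : G.pos (G.bar x) ≠ G.pos x := fun h' => G.bar_ne x (G.pos_injective h')
      omega
    have := hint _ hlt
    rw [G.bar_bar] at this
    exact (congrArg Neg.neg this).trans (by module)

theorem ell_bar (x : D) : G.ell (G.bar x) = -G.ell x := by
  refine PowerSeries.ext fun n => ?_
  rw [map_neg, coeff_ell, coeff_ell]
  rcases n with _ | _ | n
  · rw [ellComponent, ellComponent, neg_zero]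
  · rw [ellComponent, ellComponent, hmark_bar, map_neg]
  · rw [ellComponent_add_two, ellComponent_add_two, G.bar_bar]
    module

/-- The Hausdorff series of the sector after the oriented edge `x`. -/
def sector (x : D) : PowerSeries (TA g) := hausdorff (G.ell x) (G.ell (G.next x))

theorem sector_eq (x : D) : G.sector x = hausdorff (G.ell x) (-G.ell (G.boundary x)) := by
  rw [G.boundary_apply, ell_bar, neg_neg, sector]

/-- All degrees together: a fixed point equation for ℓ, linear in the corner series. -/
theorem ell_eq (x : D) : G.ell x = PowerSeries.monomial 1 (TensorAlgebra.ι ℚ (G.hmark x)) +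
    (1 / 3 : ℚ) • (G.potential G.sector x - G.potential G.sector (G.bar x)) := by
  refine PowerSeries.ext fun n => ?_
  have hs : ∀ n x, PowerSeries.coeff n (G.potential G.sector x) =
      G.potential (fun y => PowerSeries.coeff n (hausdorff (G.ell y) (-G.ell (G.boundary y)))) x :=
    fun n x => by
      simp only [← sector_eq]
      exact G.map_potential G.sector (PowerSeries.coeff (R := TA g) n).toAddMonoidHom x
  have hlow : ∀ n x, n < 2 → PowerSeries.coeff n (G.potential G.sector x) = 0 := by
    intro n x hn
    rw [Fatgraph.potential, map_sum]
    refine Finset.sum_eq_zero fun i _ => ?_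
    exact hausdorff_cong_zero (G.ell_cong_zero _) (G.ell_cong_zero _) n hn
  rw [coeff_ell, map_add, PowerSeries.coeff_smul, map_sub, PowerSeries.coeff_monomial]
  rcases n with _ | _ | n
  · rw [ellComponent, hlow _ _ (by omega), hlow _ _ (by omega)]
    simp
  · rw [ellComponent, hlow _ _ (by omega), hlow _ _ (by omega)]
    simp
  · rw [ellComponent_add_two, hs, hs]
    simp

/-- Since `bar (next y)` follows `y` on the boundary cycle, its potential is that of `y` plus
`sector y`. Summing `ell_eq` over the vertex, potentials and homology classes cancel, leaving the
hypothesis of `hausdorff_eq_of_three_sum`. -/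
theorem ell_vertex {x : D} (h : x ≠ G.bar G.tail) :
    G.ell x + G.ell (G.next x) + G.ell (G.next (G.next x)) + G.sector x = 0 := by
  have h1 := G.next_ne_bar_tail h
  have h2 := G.next_ne_bar_tail h1
  refine hausdorff_eq_of_three_sum (G.ell_cong_zero _) (G.ell_cong_zero _) (G.ell_cong_zero _) ?_
  have hp : ∀ y, y ≠ G.bar G.tail →
      G.potential G.sector (G.bar (G.next y)) = G.potential G.sector y + G.sector y :=
    fun y hy => G.potential_boundary G.sector hy
  have p1 := hp x h
  have p2 := hp _ h1
  have p3 := hp _ h2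
  rw [G.next_next_next] at p3
  have hm : PowerSeries.monomial 1 (TensorAlgebra.ι ℚ (G.hmark x)) +
      PowerSeries.monomial 1 (TensorAlgebra.ι ℚ (G.hmark (G.next x))) +
      PowerSeries.monomial 1 (TensorAlgebra.ι ℚ (G.hmark (G.next (G.next x)))) =
      (0 : PowerSeries (TA g)) := by
    rw [← map_add, ← map_add, ← map_add, ← map_add, G.hmark_vertex h, map_zero, map_zero]
  have e1 := G.ell_eq x
  have e2 := G.ell_eq (G.next x)
  have e3 := G.ell_eq (G.next (G.next x))
  rw [p1] at e2
  rw [p2] at e3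
  rw [p3] at e1
  have s3 : hausdorff (G.ell (G.next (G.next x))) (G.ell x) = G.sector (G.next (G.next x)) := by
    rw [sector, G.next_next_next]
  rw [s3]
  change _ + (G.sector x + G.sector (G.next x) + _) = _
  have hsum : G.ell x + G.ell (G.next x) + G.ell (G.next (G.next x)) =
      (-(1 / 3) : ℚ) • (G.sector x + G.sector (G.next x) + G.sector (G.next (G.next x))) := by
    conv_lhs => rw [e1, e2, e3]
    rw [← sub_eq_zero, ← hm]
    module
  rw [hsum]
  module

theorem expSeries_ell_vertex {x : D} (h : x ≠ G.bar G.tail) :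
    expSeries (G.ell x) * expSeries (G.ell (G.next x)) *
      expSeries (G.ell (G.next (G.next x))) = 1 :=
  expSeries_three_mul (G.ell_cong_zero _) (G.ell_vertex h)

theorem ellComponent_mem (n : ℕ) : ∀ x, G.ellComponent n x ∈ freeLiePart g n := by
  induction n using Nat.strong_induction_on with
  | _ n ih =>
    intro x
    rcases n with _ | _ | n
    · rw [ellComponent]; exact Submodule.zero_mem _
    · rw [ellComponent]; exact ι_mem_freeLiePart _
    · rw [ellComponent_add_two]
      have hL : ∀ y, LieUpTo (n + 2) (G.ell y) := fun y i hi => by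
        rw [coeff_ell]; exact ih i hi y
      have hneg : ∀ y, Cong 1 (-G.ell y) 0 := fun y => by simpa using (G.ell_cong_zero y).neg
      -- The Campbell-Baker-Hausdorff theorem in degree `n + 2` asks for Lie arguments up to that
      -- degree, which the induction does not provide for ℓ. The truncations are Lie in every degree
      -- and give the same h in degree `n + 2`.
      set t : D → PowerSeries (TA g) := fun y =>
        PowerSeries.mk fun j => if j < n + 2 then G.ellComponent j y else 0 with ht
      have htc : ∀ y, Cong (n + 2) (t y) (G.ell y) := fun y j hj => by
        rw [coeff_ell, ht, PowerSeries.coeff_mk, if_pos hj]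
      have ht0 : ∀ y, Cong 1 (t y) 0 := fun y =>
        ((htc y).mono (by omega)).trans (G.ell_cong_zero y)
      have htL : ∀ y, LieUpTo (n + 3) (t y) := fun y i _ => by
        rw [ht, PowerSeries.coeff_mk]
        split_ifs with h
        · exact ih i h y
        · exact Submodule.zero_mem _
      have hJ : ∀ y, PowerSeries.coeff (n + 2) (hausdorff (G.ell y) (-G.ell (G.boundary y))) ∈
          freeLiePart g (n + 2) := fun y => by
        have hn0 : Cong 1 (-t (G.boundary y)) 0 := by simpa using (ht0 (G.boundary y)).neg
        rw [← hausdorff_congr (ht0 y) hn0 (G.ell_cong_zero y) (hneg _) (htc y) (htc _).neg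
          (n + 2) (by omega)]
        exact LieUpTo.hausdorff (ht0 y) hn0 (htL y) (htL _).neg (n + 2) (by omega)
      have hpot : ∀ y, G.potential (fun y => PowerSeries.coeff (n + 2)
          (hausdorff (G.ell y) (-G.ell (G.boundary y)))) y ∈ freeLiePart g (n + 2) := fun y =>
        Submodule.sum_mem _ fun i _ => hJ _
      exact Submodule.smul_mem _ _ (Submodule.sub_mem _ (hpot _) (hpot _))

theorem ell_lieUpTo (n : ℕ) (x : D) : LieUpTo n (G.ell x) := fun i _ => by
  rw [coeff_ell]; exact G.ellComponent_mem i x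

/-- The function `ℓ` with values in the completed tensor algebra. -/
def ellT (x : D) : CompletedTensor g :=
  ⟨G.ell x, fun n => by rw [coeff_ell]; exact (G.ellComponent_mem n x).2⟩

theorem ellT_inFiltration (x : D) : InFiltration 1 (G.ellT x) :=
  inFiltration_iff.mpr (G.ell_cong_zero x)

theorem expT_ellT_sub_inFiltration (x : D) :
    InFiltration 2 (expT (G.ellT x) - 1 - ofH (G.hmark x)) := by
  have h1 := expT_sub_one_sub_inFiltration (G.ellT_inFiltration x)
  have h2 : InFiltration 2 (G.ellT x - ofH (G.hmark x)) := by
    intro n hn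
    rw [component_sub, component_ofH]
    change PowerSeries.coeff n (G.ell x) - _ = 0
    rw [coeff_ell]
    rcases (by omega : n = 0 ∨ n = 1) with rfl | rfl
    · rw [ellComponent]; simp
    · rw [ellComponent]; simp
  have := h1.add h2
  rwa [sub_add_sub_cancel] at this

end Finite

end MarkedFatgraph

/-! ## Flows -/

theorem eq_of_sameCycle {α β : Type*} {p : Equiv.Perm α} {f : α → β} (h : ∀ x, f (p x) = f x)
    {x y : α} (hxy : p.SameCycle x y) : f x = f y := by
  obtain ⟨i, rfl⟩ := hxy
  have hn : ∀ (n : ℕ) z, f ((p ^ n) z) = f z := by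
    intro n
    induction n with
    | zero => simp
    | succ n ih => intro z; rw [pow_succ', Equiv.Perm.mul_apply, h, ih]
  rcases Int.eq_nat_or_neg i with ⟨n, rfl | rfl⟩
  · rw [zpow_natCast, hn]
  · rw [← hn n ((p ^ (-(n : ℤ))) x), ← zpow_natCast, ← Equiv.Perm.mul_apply, ← zpow_add]
    simp

namespace Fatgraph

variable {D : Type*} (G : Fatgraph D)

/-- A flow: a function on oriented edges which changes sign under reversal and has zero sum at
every trivalent vertex. -/
def IsFlow {W : Type*} [AddCommGroup W] (δ : D → W) : Prop :=
  (∀ x, δ (G.bar x) = -δ x) ∧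
    ∀ x, x ≠ G.bar G.tail → δ x + δ (G.next x) + δ (G.next (G.next x)) = 0

theorem IsFlow.map {G : Fatgraph D} {W W' : Type*} [AddCommGroup W] [AddCommGroup W'] {δ : D → W}
    (h : G.IsFlow δ) (T : W →+ W') : G.IsFlow (fun x => T (δ x)) :=
  ⟨fun x => by simp only [h.1, map_neg],
    fun x hx => by simp only [← map_add, h.2 x hx, map_zero]⟩

/-- The space of rational flows. -/
def flowSpace : Submodule ℚ (D → ℚ) where
  carrier := {δ | G.IsFlow δ}
  add_mem' := fun {a b} ha hb => ⟨fun x => by simp [ha.1, hb.1, add_comm], fun x hx => by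
    have h1 := ha.2 x hx
    have h2 := hb.2 x hx
    simp only [Pi.add_apply]
    linear_combination h1 + h2⟩
  zero_mem' := ⟨fun x => by simp, fun x _ => by simp⟩
  smul_mem' := fun r a ha => ⟨fun x => by simp [ha.1], fun x hx => by
    have h1 := ha.2 x hx
    simp only [Pi.smul_apply, smul_eq_mul]
    linear_combination r * h1⟩

/-- The space of rational functions on oriented edges which change sign under reversal. -/
def chainSpace : Submodule ℚ (D → ℚ) where
  carrier := {δ | ∀ x, δ (G.bar x) = -δ x}
  add_mem' := fun {a b} ha hb x => by simp [ha x, hb x, add_comm]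
  zero_mem' := fun x => by simp
  smul_mem' := fun r a ha x => by simp [ha x]

/-- `h` is a function on vertices, so the sum can be grouped into vertex sums of `δ`; the univalent
vertex is taken care of by `h0`. -/
theorem sum_flow_mul_eq_zero [Fintype D] {δ : D → ℚ} (hδ : G.IsFlow δ) {h : D → ℚ}
    (hn : ∀ x, h (G.next x) = h x) (h0 : h (G.bar G.tail) = 0) : ∑ x, δ x * h x = 0 := by
  have h1 : ∑ x, δ (G.next x) * h x = ∑ x, δ x * h x := by
    rw [← Equiv.sum_comp G.next (fun x => δ x * h x)]
    simp only [hn]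
  have h2 : ∑ x, δ (G.next (G.next x)) * h x = ∑ x, δ x * h x := by
    rw [← h1, ← Equiv.sum_comp G.next (fun x => δ (G.next x) * h x)]
    simp only [hn]
  have h3 : ∑ x, (δ x + δ (G.next x) + δ (G.next (G.next x))) * h x = 0 := by
    refine Finset.sum_eq_zero fun x _ => ?_
    by_cases hx : x = G.bar G.tail
    · rw [hx, h0, mul_zero]
    · rw [hδ.2 x hx, zero_mul]
  simp only [add_mul, Finset.sum_add_distrib, h1, h2] at h3
  linarith

theorem numCycles_boundary : numCycles G.boundary = 1 := by
  rw [numCycles, Nat.card_eq_one_iff_unique]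
  refine ⟨⟨fun p q => ?_⟩, ⟨Quotient.mk _ G.tail⟩⟩
  induction p using Quotient.inductionOn with | _ x =>
  induction q using Quotient.inductionOn with | _ y =>
  exact Quotient.sound (s := Equiv.Perm.SameCycle.setoid G.boundary) (G.one_boundary x y)

variable [Finite D]

theorem finrank_chainSpace_le : Module.finrank ℚ G.chainSpace ≤ numCycles G.bar := by
  classical
  have := Fintype.ofFinite D
  let Q := Quotient (Equiv.Perm.SameCycle.setoid G.bar)
  have : Finite Q := Quotient.finite _
  have := Fintype.ofFinite Q
  let T : G.chainSpace →ₗ[ℚ] (Q → ℚ) :=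
    { toFun := fun δ q => δ.1 q.out
      map_add' := fun _ _ => rfl
      map_smul' := fun _ _ => rfl }
  have hT : Function.Injective T := by
    rw [injective_iff_map_eq_zero]
    intro δ hδ
    refine Subtype.ext (funext fun x => ?_)
    have h1 : δ.1 (Quotient.out (Quotient.mk (Equiv.Perm.SameCycle.setoid G.bar) x)) = 0 :=
      congrFun hδ _
    have h2 : G.bar.SameCycle
        (Quotient.out (Quotient.mk (Equiv.Perm.SameCycle.setoid G.bar) x)) x :=
      Quotient.mk_out (s := Equiv.Perm.SameCycle.setoid G.bar) x
    have h3 := eq_of_sameCycle (f := fun z => δ.1 z = 0)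
      (fun z => by rw [δ.2 z, neg_eq_zero]) h2
    exact h3.mp h1
  have := LinearMap.finrank_le_finrank_of_injective hT
  rwa [Module.finrank_fintype_fun_eq_card, ← Nat.card_eq_fintype_card] at this

/-- The coboundary of functions on vertices vanishing at the univalent vertex. -/
theorem exists_coboundarySpace : ∃ R : Submodule ℚ (D → ℚ), R ≤ G.chainSpace ∧
    numCycles G.next ≤ Module.finrank ℚ R + 1 ∧
    ∀ δ ∈ R, ∃ h : D → ℚ, (∀ x, h (G.next x) = h x) ∧ h (G.bar G.tail) = 0 ∧
      ∀ x, δ x = h x - h (G.bar x) := by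
  classical
  have := Fintype.ofFinite D
  let Q := Quotient (Equiv.Perm.SameCycle.setoid G.next)
  have : Finite Q := Quotient.finite _
  have := Fintype.ofFinite Q
  let π : D → Q := Quotient.mk _
  have hπ : ∀ x, π (G.next x) = π x := fun x =>
    Quotient.sound (s := Equiv.Perm.SameCycle.setoid G.next)
      (show G.next.SameCycle (G.next x) x from Equiv.Perm.sameCycle_apply_left.mpr
        (Equiv.Perm.SameCycle.refl _ _))
  let ev : (Q → ℚ) →ₗ[ℚ] ℚ := LinearMap.proj (π (G.bar G.tail))
  let T : (Q → ℚ) →ₗ[ℚ] (D → ℚ) :=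
    { toFun := fun h x => h (π x) - h (π (G.bar x))
      map_add' := fun h h' => funext fun x => by simp only [Pi.add_apply]; ring
      map_smul' := fun r h => funext fun x => by
        simp only [Pi.smul_apply, smul_eq_mul, RingHom.id_apply]; ring }
  let T' := T ∘ₗ (LinearMap.ker ev).subtype
  -- A function on vertices with zero coboundary is constant along the boundary cycle, which meets
  -- every oriented edge, and it vanishes at the univalent vertex.
  have hT' : Function.Injective T' := by
    rw [injective_iff_map_eq_zero]
    rintro ⟨h, hh⟩ h0
    refine Subtype.ext (funext fun q => ?_)
    obtain ⟨x, rfl⟩ := Quotient.exists_rep q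
    have h1 : ∀ y, h (π (G.bar y)) = h (π y) := fun y => (sub_eq_zero.mp (congrFun h0 y)).symm
    have h2 := eq_of_sameCycle (p := G.boundary) (f := fun y => h (π y))
      (fun y => by rw [boundary_apply, h1, hπ]) (G.one_boundary x (G.bar G.tail))
    exact h2.trans hh
  refine ⟨LinearMap.range T', ?_, ?_, ?_⟩
  · rintro _ ⟨h, rfl⟩ x
    change h.1 (π (G.bar x)) - h.1 (π (G.bar (G.bar x))) = -(h.1 (π x) - h.1 (π (G.bar x)))
    rw [G.bar_bar]; ring
  · rw [LinearMap.finrank_range_of_inj hT']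
    have h1 := LinearMap.finrank_range_add_finrank_ker ev
    have h2 := Submodule.finrank_le (LinearMap.range ev)
    rw [Module.finrank_fintype_fun_eq_card, ← Nat.card_eq_fintype_card] at h1
    rw [Module.finrank_self] at h2
    change Nat.card Q ≤ _
    omega
  · rintro _ ⟨h, rfl⟩
    exact ⟨fun x => h.1 (π x), fun x => congrArg h.1 (hπ x), h.2, fun x => rfl⟩

/-- Coboundaries are orthogonal to flows, and both lie in the chains, of dimension at most E. The
coboundaries take up at least V - 1 dimensions, leaving E - V + 1, which is 2g as there is one
boundary cycle. -/
theorem finrank_flowSpace_le {g : ℕ} (hg : G.HasGenus g) :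
    Module.finrank ℚ G.flowSpace ≤ 2 * g := by
  have := Fintype.ofFinite D
  obtain ⟨R, hR, hfin, hRh⟩ := G.exists_coboundarySpace
  have hF : G.flowSpace ≤ G.chainSpace := fun δ hδ => hδ.1
  have hdis : R ⊓ G.flowSpace = ⊥ := by
    rw [eq_bot_iff]
    rintro δ ⟨h1, h2⟩
    obtain ⟨h, hn, h0, hδ⟩ := hRh δ h1
    have s1 := G.sum_flow_mul_eq_zero h2 hn h0
    have s2 : ∑ x, δ x * h (G.bar x) = 0 := by
      rw [← Equiv.sum_comp G.bar]
      simp only [G.bar_bar, h2.1, neg_mul, Finset.sum_neg_distrib, s1, neg_zero]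
    have s3 : ∑ x, δ x * δ x = 0 := by
      calc ∑ x, δ x * δ x = ∑ x, (δ x * h x - δ x * h (G.bar x)) :=
            Finset.sum_congr rfl fun x _ => by rw [← mul_sub, ← hδ]
        _ = 0 := by rw [Finset.sum_sub_distrib, s1, s2, sub_zero]
    rw [Finset.sum_eq_zero_iff_of_nonneg fun x _ => mul_self_nonneg _] at s3
    exact (Submodule.mem_bot ℚ).mpr (funext fun x => mul_self_eq_zero.mp (s3 x (Finset.mem_univ x)))
  have h1 := Submodule.finrank_sup_add_finrank_inf_eq R G.flowSpace
  rw [hdis, finrank_bot] at h1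
  have h2 := Submodule.finrank_mono (sup_le hR hF)
  have h3 := G.finrank_chainSpace_le
  rw [HasGenus, numCycles_boundary] at hg
  omega

end Fatgraph

/-! ### Flows as functionals on homology, and existence of the expansion -/

namespace MarkedFatgraph

variable {g : ℕ} {D : Type*} (G : MarkedFatgraph g D)

theorem hmark_isFlow : G.IsFlow G.hmark := ⟨G.hmark_bar, fun _ hx => G.hmark_vertex hx⟩

theorem span_hmark : Submodule.span ℚ (Set.range G.hmark) = ⊤ := by
  let S : Subgroup (SurfaceGroup g) :=
    { carrier := {x | homologyClass x ∈ Submodule.span ℚ (Set.range G.hmark)}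
      mul_mem' := fun {a b} ha hb => by
        simp only [Set.mem_ofPred_eq] at ha hb ⊢
        rw [homologyClass_mul]; exact Submodule.add_mem _ ha hb
      one_mem' := by
        simp only [Set.mem_ofPred_eq]
        rw [homologyClass_one]; exact Submodule.zero_mem _
      inv_mem' := fun {a} ha => by
        simp only [Set.mem_ofPred_eq] at ha ⊢
        rw [homologyClass_inv]; exact Submodule.neg_mem _ ha }
  have hS : S = ⊤ := by
    rw [eq_top_iff, ← G.full_rank, Subgroup.closure_le]
    rintro _ ⟨x, rfl⟩
    exact Submodule.subset_span ⟨x, rfl⟩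
  rw [eq_top_iff, ← (Pi.basisFun ℚ (Fin g ⊕ Fin g)).span_eq, Submodule.span_le]
  rintro _ ⟨i, rfl⟩
  have : FreeGroup.of i ∈ S := hS ▸ Subgroup.mem_top _
  rw [Pi.basisFun_apply, ← homologyClass_of]
  exact this

variable [Finite D]

theorem exists_basis {D : Type u} [Finite D] (G : MarkedFatgraph g D) :
    ∃ (κ : Type u) (y : κ → D) (b : Module.Basis κ ℚ (Hlgy g)),
    Finite κ ∧ ∀ i, b i = G.hmark (y i) := by
  obtain ⟨κ, y, hinj, hspan, hli⟩ := exists_linearIndependent' ℚ G.hmark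
  exact ⟨κ, y, Module.Basis.mk hli (by rw [hspan, span_hmark]), Finite.of_injective y hinj,
    fun i => by rw [Module.Basis.mk_apply, Function.comp_apply]⟩

/-- Every rational flow is obtained from the `H`-marking by a linear functional. -/
theorem exists_dual_of_isFlow {δ : D → ℚ} (hδ : G.IsFlow δ) :
    ∃ l : Module.Dual ℚ (Hlgy g), ∀ x, δ x = l (G.hmark x) := by
  have := Fintype.ofFinite D
  let T : Module.Dual ℚ (Hlgy g) →ₗ[ℚ] (D → ℚ) :=
    { toFun := fun l x => l (G.hmark x)
      map_add' := fun _ _ => rfl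
      map_smul' := fun _ _ => rfl }
  have hT : Function.Injective T := by
    rw [injective_iff_map_eq_zero]
    intro l hl
    refine LinearMap.ext_on_range G.span_hmark fun x => ?_
    exact congrFun hl x
  have hle : LinearMap.range T ≤ G.flowSpace := by
    rintro _ ⟨l, rfl⟩
    exact G.hmark_isFlow.map l.toAddMonoidHom
  -- Functionals embed because the classes of the edges span H; their dimension 2g attains the bound
  -- for flows.
  have heq : LinearMap.range T = G.flowSpace := by
    refine Submodule.eq_of_le_of_finrank_le hle ?_
    rw [LinearMap.finrank_range_of_inj hT, Subspace.dual_finrank_eq,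
      Module.finrank_fintype_fun_eq_card]
    refine (G.finrank_flowSpace_le G.genus).trans ?_
    simp [two_mul]
  have : δ ∈ LinearMap.range T := heq ▸ hδ
  obtain ⟨l, rfl⟩ := this
  exact ⟨l, fun x => rfl⟩

/-- Tested against a functional on `W`, the flow comes from a functional on H, which vanishes on a
basis. -/
theorem isFlow_eq_zero {W : Type*} [AddCommGroup W] [Module ℚ W] {δ : D → W} (hδ : G.IsFlow δ)
    {κ : Type*} {y : κ → D} (b : Module.Basis κ ℚ (Hlgy g)) (hb : ∀ i, b i = G.hmark (y i))
    (h : ∀ i, δ (y i) = 0) (x : D) : δ x = 0 := by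
  rw [← Module.forall_dual_apply_eq_zero_iff ℚ]
  intro ω
  obtain ⟨l, hl⟩ := G.exists_dual_of_isFlow (hδ.map ω.toAddMonoidHom)
  have h0 : l = 0 := b.ext fun i => by
    rw [hb, ← hl, h i, map_zero, LinearMap.zero_apply]
  have := hl x
  rw [h0] at this
  exact this

theorem component_mul_sub {N : ℕ} {A A' B B' : CompletedTensor g} (hA : InFiltration N (A - A'))
    (hB : InFiltration N (B - B')) (hA' : component 0 A' = 1) (hB0 : component 0 B = 1) :
    component N (A * B - A' * B') = component N (A - A') + component N (B - B') := by
  have e : A * B - A' * B' = (A - A') * B + A' * (B - B') := by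
    rw [sub_mul, mul_sub]; abel
  have h1 := hA.component_mul (InFiltration.of_zero B)
  have h2 := (InFiltration.of_zero A').component_mul hB
  rw [add_zero, hB0, mul_one] at h1
  rw [zero_add, hA', one_mul] at h2
  rw [e, component_add, h1, h2]

theorem mul_sub_inFiltration {N : ℕ} {A A' B B' : CompletedTensor g} (hA : InFiltration N (A - A'))
    (hB : InFiltration N (B - B')) : InFiltration N (A * B - A' * B') := by
  have e : A * B - A' * B' = (A - A') * B + A' * (B - B') := by
    rw [sub_mul, mul_sub]; abel
  have h1 := hA.mul (InFiltration.of_zero B)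
  have h2 := (InFiltration.of_zero A').mul hB
  rw [zero_add] at h2
  rw [e]
  exact h1.add h2

/-- Multiplicative solutions of the vertex relations are determined by their values on edges whose
classes form a basis. -/
theorem eq_of_vertex_relations {ψ ψ' : D → CompletedTensor g} {κ : Type*} {y : κ → D}
    (b : Module.Basis κ ℚ (Hlgy g)) (hb : ∀ i, b i = G.hmark (y i))
    (h0 : ∀ x, component 0 (ψ x) = 1) (h0' : ∀ x, component 0 (ψ' x) = 1)
    (hbar : ∀ x, ψ (G.bar x) * ψ x = 1) (hbar' : ∀ x, ψ' (G.bar x) * ψ' x = 1)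
    (hv : ∀ x, x ≠ G.bar G.tail → ψ x * ψ (G.next x) * ψ (G.next (G.next x)) = 1)
    (hv' : ∀ x, x ≠ G.bar G.tail → ψ' x * ψ' (G.next x) * ψ' (G.next (G.next x)) = 1)
    (hy : ∀ i, ψ (y i) = ψ' (y i)) : ψ = ψ' := by
  funext x
  refine sub_eq_zero.mp (InFiltration.eq_zero fun N => ?_)
  revert x
  induction N with
  | zero => exact fun x => InFiltration.of_zero _
  | succ N ih =>
    -- The first possible discrepancy is additive under multiplication, so the multiplicative
    -- relations turn into those of a flow.
    have hflow : G.IsFlow (fun x => component N (ψ x - ψ' x)) := by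
      refine ⟨fun x => ?_, fun x hx => ?_⟩
      · have := component_mul_sub (ih (G.bar x)) (ih x) (h0' _) (h0 _)
        rw [hbar, hbar', sub_self] at this
        rw [eq_neg_iff_add_eq_zero, ← this]
        exact map_zero _
      · have h1 := component_mul_sub (mul_sub_inFiltration (ih x) (ih (G.next x)))
          (ih (G.next (G.next x))) (by rw [component_zero_mul, h0', h0', one_mul]) (h0 _)
        rw [hv x hx, hv' x hx, sub_self, component_mul_sub (ih x) (ih (G.next x)) (h0' _) (h0 _)]
          at h1
        rw [← h1]
        exact map_zero _
    intro x n hn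
    rcases Nat.lt_succ_iff_lt_or_eq.mp hn with h | rfl
    · exact ih x n h
    · refine G.isFlow_eq_zero hflow b hb (fun i => ?_) x
      rw [hy, sub_self]
      exact map_zero _

theorem component_zero_expT (w : CompletedTensor g) : component 0 (expT w) = 1 := by
  have := expSeries_cong_one (w : PowerSeries (TA g)) 0 one_pos
  rw [PowerSeries.coeff_one, if_pos rfl] at this
  exact this

/-- The fatgraph Magnus expansion exists. -/
theorem exists_isFatgraphMagnus : ∃ θ : SurfaceGroup g →* CompletedTensor g,
    G.IsFatgraphMagnus θ := by
  obtain ⟨σ, hσ⟩ := exists_isMagnusExpansion g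
  obtain ⟨κ, y, b, hκ, hb⟩ := G.exists_basis
  obtain ⟨A, hA, hAb⟩ := exists_isIA_of_basis b (fun i => σ (G.mark (y i)) - 1) fun i => by
    rw [hb]; exact hσ.sub_one_sub_inFiltration _
  obtain ⟨B, hB, hBb⟩ := exists_isIA_of_basis b (fun i => expT (G.ellT (y i)) - 1) fun i => by
    rw [hb]; exact G.expT_ellT_sub_inFiltration _
  -- `A` and `B` carry the same basis of H to the values of σ - 1 and of exp ℓ - 1 on the chosen
  -- edges, so B A⁻¹ corrects σ there; the vertex relations propagate the equality to all edges.
  have hU := hA.symm.trans hB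
  set U := A.symm.trans B with hUdef
  set θ := (U : CompletedTensor g →* CompletedTensor g).comp σ with hθdef
  have hθ : IsMagnusExpansion θ := hU.map_magnus hσ
  refine ⟨θ, hθ, ?_⟩
  have key : (fun x => θ (G.mark x)) = fun x => expT (G.ellT x) := by
    refine G.eq_of_vertex_relations b hb (fun x => (hθ _).1) (fun x => component_zero_expT _)
      (fun x => ?_) (fun x => ?_) (fun x hx => ?_) (fun x hx => ?_) (fun i => ?_)
    · rw [← map_mul, G.orientation, map_one]
    · refine Subtype.ext ?_
      change expSeries (G.ell (G.bar x)) * expSeries (G.ell x) = 1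
      rw [ell_bar, expSeries_neg_mul (G.ell_cong_zero x)]
    · rw [← map_mul, ← map_mul, G.vertex_compatibility x hx, map_one]
    · exact Subtype.ext (G.expSeries_ell_vertex hx)
    · change B (A.symm (σ (G.mark (y i)))) = _
      have e : σ (G.mark (y i)) = A (1 + ofH (b i)) := by
        rw [map_add, map_one, hAb, add_sub_cancel]
      rw [e, AlgEquiv.symm_apply_apply, map_add, map_one, hBb, add_sub_cancel]
  intro x
  exact congrArg Subtype.val (congrFun key x)

theorem IsFatgraphMagnus.apply_mark {G : MarkedFatgraph g D}
    {θ : SurfaceGroup g →* CompletedTensor g} (h : G.IsFatgraphMagnus θ) (x : D) :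
    θ (G.mark x) = expT (G.ellT x) := Subtype.ext (h.2 x)

theorem IsFatgraphMagnus.unique {G : MarkedFatgraph g D}
    {θ θ' : SurfaceGroup g →* CompletedTensor g} (h : G.IsFatgraphMagnus θ)
    (h' : G.IsFatgraphMagnus θ') : θ = θ' := by
  refine MonoidHom.eq_of_eqOn_dense (s := Set.range G.mark) G.full_rank ?_
  rintro _ ⟨x, rfl⟩
  rw [h.apply_mark, h'.apply_mark]

end MarkedFatgraph

theorem existsUnique_isFatgraphJohnsonMap {g : ℕ} {D D' : Type*} [Finite D] [Finite D']
    (G : MarkedFatgraph g D) (G' : MarkedFatgraph g D') :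
    ∃! τ : CompletedTensor g ≃ₐ[ℚ] CompletedTensor g, IsFatgraphJohnsonMap G G' τ := by
  obtain ⟨θ, hθ⟩ := G.exists_isFatgraphMagnus
  obtain ⟨θ', hθ'⟩ := G'.exists_isFatgraphMagnus
  obtain ⟨τ, hτ, hτθ⟩ := exists_isIA_comp_eq hθ.1 hθ'.1
  refine ⟨τ, ⟨hτ, θ, θ', hθ, hθ', hτθ⟩, ?_⟩
  rintro σ ⟨hσ, θ₁, θ₁', hθ₁, hθ₁', hσθ⟩
  obtain rfl := hθ.unique hθ₁
  obtain rfl := hθ'.unique hθ₁'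
  exact isIA_ext hθ'.1 hσ hτ fun x => by rw [hσθ, hτθ]

/-! ## The symplectic form in degree two -/

section DegreeTwo

variable {g : ℕ}

theorem component_two_mul (w v : CompletedTensor g) : component 2 (w * v) =
    component 0 w * component 2 v + component 1 w * component 1 v +
      component 2 w * component 0 v := by
  rw [component_mul, Finset.Nat.sum_antidiagonal_succ, Finset.Nat.sum_antidiagonal_succ]
  simp [add_assoc]

theorem IsMagnusExpansion.component_two_commutator {θ : SurfaceGroup g →* CompletedTensor g}
    (hθ : IsMagnusExpansion θ) (x y : SurfaceGroup g) :
    component 2 (θ (x * y * x⁻¹ * y⁻¹)) =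
      TensorAlgebra.ι ℚ (homologyClass x) * TensorAlgebra.ι ℚ (homologyClass y) -
        TensorAlgebra.ι ℚ (homologyClass y) * TensorAlgebra.ι ℚ (homologyClass x) := by
  -- Multiplying by θ(y)θ(x) avoids the quadratic parts of inverses.
  have h : θ (x * y * x⁻¹ * y⁻¹) * (θ y * θ x) = θ x * θ y := by
    rw [← map_mul, ← map_mul, ← map_mul]
    congr 1
    group
  have hc : homologyClass (x * y * x⁻¹ * y⁻¹) = 0 := by
    simp only [homologyClass_mul, homologyClass_inv]
    abel
  have h2 := congrArg (component 2) h
  rw [component_two_mul, (hθ _).1, (hθ _).2, hc, map_zero, zero_mul, add_zero, component_zero_mul,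
    component_two_mul, component_two_mul, (hθ x).1, (hθ y).1, (hθ x).2, (hθ y).2] at h2
  simp only [one_mul, mul_one] at h2
  rw [← sub_eq_zero] at h2 ⊢
  rw [← h2]
  abel

theorem IsMagnusExpansion.component_two_prod {θ : SurfaceGroup g →* CompletedTensor g}
    (hθ : IsMagnusExpansion θ) (L : List (SurfaceGroup g)) (hL : ∀ x ∈ L, homologyClass x = 0) :
    component 2 (θ L.prod) = (L.map fun x => component 2 (θ x)).sum := by
  induction L with
  | nil => rw [List.prod_nil, map_one, component_one]; simp
  | cons x L ih =>
    have hx := hL x (by simp)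
    rw [List.prod_cons, map_mul, component_two_mul, (hθ x).1, (hθ x).2, hx, (hθ L.prod).1,
      ih fun y hy => hL y (by simp [hy]), List.map_cons, List.sum_cons]
    simp [add_comm]

/-- The degree two part of a Magnus expansion of the boundary word is the symplectic form. -/
theorem IsMagnusExpansion.component_two_boundaryWord {θ : SurfaceGroup g →* CompletedTensor g}
    (hθ : IsMagnusExpansion θ) : component 2 (θ (boundaryWord g)) = ∑ i : Fin g,
      (TensorAlgebra.ι ℚ (Pi.single (Sum.inl i) 1 : Hlgy g) *
          TensorAlgebra.ι ℚ (Pi.single (Sum.inr i) 1) -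
        TensorAlgebra.ι ℚ (Pi.single (Sum.inr i) 1) *
          TensorAlgebra.ι ℚ (Pi.single (Sum.inl i) 1)) := by
  rw [boundaryWord, hθ.component_two_prod, List.map_ofFn, List.sum_ofFn]
  · refine Finset.sum_congr rfl fun i _ => ?_
    rw [Function.comp_apply, hθ.component_two_commutator, homologyClass_of, homologyClass_of]
  · intro x hx
    obtain ⟨i, rfl⟩ := (List.mem_ofFn' _ _).mp hx
    simp only [homologyClass_mul, homologyClass_inv]
    abel

/-- The evaluation of a quadratic tensor at a pair of functionals, as an entry of a
representation by strictly upper triangular matrices. -/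
def pairRep (l μ : Module.Dual ℚ (Hlgy g)) : TA g →ₐ[ℚ] Matrix (Fin 3) (Fin 3) ℚ :=
  TensorAlgebra.lift ℚ
    (l.smulRight (Matrix.single 0 1 1) + μ.smulRight (Matrix.single 1 2 1))

theorem pairRep_apply (l μ : Module.Dual ℚ (Hlgy g)) (x y : Hlgy g) :
    pairRep l μ (TensorAlgebra.ι ℚ x * TensorAlgebra.ι ℚ y) 0 2 = l x * μ y := by
  rw [map_mul, pairRep, TensorAlgebra.lift_ι_apply, TensorAlgebra.lift_ι_apply]
  simp [Matrix.mul_apply, Matrix.single_apply]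

end DegreeTwo

namespace MarkedFatgraph

variable {g : ℕ} {D : Type*} (G : MarkedFatgraph g D)

theorem coeff_one_ell (x : D) : PowerSeries.coeff 1 (G.ell x) = TensorAlgebra.ι ℚ (G.hmark x) := by
  rw [coeff_ell, ellComponent]

theorem coeff_two_sector (x : D) : PowerSeries.coeff 2 (G.sector x) = (1 / 2 : ℚ) •
    (TensorAlgebra.ι ℚ (G.hmark x) * TensorAlgebra.ι ℚ (G.hmark (G.next x)) -
      TensorAlgebra.ι ℚ (G.hmark (G.next x)) * TensorAlgebra.ι ℚ (G.hmark x)) := by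
  rw [sector, coeff_two_hausdorff (G.ell_cong_zero _) (G.ell_cong_zero _), coeff_one_ell,
    coeff_one_ell]

variable [Fintype D]

/-- The path from the tail to its reverse is the whole boundary cycle, so every corner is counted.
The corner at the univalent vertex contributes the commutator of an element with itself. -/
theorem coeff_two_ell_bar_tail : PowerSeries.coeff 2 (G.ell (G.bar G.tail)) =
    (1 / 3 : ℚ) • ∑ x, PowerSeries.coeff 2 (G.sector x) := by
  have h := G.potential_bar_tail (fun x => PowerSeries.coeff 2 (G.sector x))
  have h0 : PowerSeries.coeff 2 (G.sector (G.bar G.tail)) = 0 := by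
    rw [coeff_two_sector, G.univalent, sub_self, smul_zero]
  have hp : PowerSeries.coeff 2 (G.potential G.sector (G.bar G.tail)) =
      G.potential (fun x => PowerSeries.coeff 2 (G.sector x)) (G.bar G.tail) :=
    G.map_potential G.sector (PowerSeries.coeff (R := TA g) 2).toAddMonoidHom _
  rw [h0, add_zero, ← hp] at h
  rw [ell_eq, G.bar_bar, G.potential_tail, sub_zero, ← h, map_add, PowerSeries.coeff_smul,
    PowerSeries.coeff_monomial, if_neg (by norm_num), zero_add]

/-- The symplectic form in terms of the `H`-marking. -/
theorem symplectic_eq (l μ : Module.Dual ℚ (Hlgy g)) :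
    ∑ i : Fin g, (l (Pi.single (Sum.inl i) 1) * μ (Pi.single (Sum.inr i) 1) -
      l (Pi.single (Sum.inr i) 1) * μ (Pi.single (Sum.inl i) 1)) =
    (1 / 6 : ℚ) * ∑ x, (l (G.hmark x) * μ (G.hmark (G.next x)) -
      l (G.hmark (G.next x)) * μ (G.hmark x)) := by
  obtain ⟨θ, hθ⟩ := G.exists_isFatgraphMagnus
  have h1 := hθ.1.component_two_boundaryWord
  rw [← G.geometricity, hθ.apply_mark] at h1
  -- The boundary is null-homologous, so in degree two its exponential reduces to ℓ.
  have h2 : component 2 (expT (G.ellT (G.bar G.tail))) =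
      (1 / 3 : ℚ) • ∑ x, PowerSeries.coeff 2 (G.sector x) := by
    change PowerSeries.coeff 2 (expSeries (G.ell (G.bar G.tail))) = _
    rw [coeff_two_expSeries _ (G.ell_cong_zero _), coeff_one_ell, G.hmark_bar_tail, map_zero,
      mul_zero, smul_zero, add_zero, coeff_two_ell_bar_tail]
  rw [h2] at h1
  simp only [coeff_two_sector] at h1
  have h3 := congrArg (fun t => pairRep l μ t 0 2) h1
  simp only [map_smul, map_sum, map_sub, Matrix.smul_apply, Matrix.sum_apply, Matrix.sub_apply,
    pairRep_apply, smul_eq_mul] at h3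
  rw [← h3, ← Finset.mul_sum]
  ring

end MarkedFatgraph

/-! ## Linking numbers -/

namespace Fatgraph

variable {D : Type*} (G : Fatgraph D)

/-- The indicator function of the part of the boundary cycle after `α`. -/
def heaviside (α p : D) : ℚ := if G.pos α < G.pos p then 1 else 0

open Classical in
/-- The indicator function of `α`. -/
def delta (α p : D) : ℚ := if p = α then 1 else 0

theorem delta_self (α : D) : delta α α = 1 := if_pos rfl

theorem delta_of_ne {α p : D} (h : p ≠ α) : delta α p = 0 := if_neg h

theorem delta_bar (α p : D) : delta α (G.bar p) = delta (G.bar α) p := by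
  by_cases h : p = G.bar α
  · rw [h, G.bar_bar, delta_self, delta_self]
  · rw [delta_of_ne h, delta_of_ne]
    rintro rfl
    exact h (G.bar_bar p).symm

theorem sum_delta_mul [Fintype D] (α : D) (m : D → ℚ) : ∑ x, delta α x * m x = m α := by
  classical
  rw [Finset.sum_eq_single α]
  · rw [delta_self, one_mul]
  · intro x _ hx
    rw [delta_of_ne hx, zero_mul]
  · simp

variable [Finite D]

/-- The indicator jumps up after `α` and drops back at the passage from `bar tail` to the tail. -/
theorem heaviside_boundary (α p : D) : G.heaviside α (G.boundary p) =
    G.heaviside α p + delta α p - delta (G.bar G.tail) p := by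
  by_cases hp : p = G.bar G.tail
  · rw [hp, G.boundary_bar_tail, delta_self]
    have h1 : G.heaviside α G.tail = 0 := by
      rw [heaviside, G.pos_tail]; simp
    rw [h1]
    by_cases h : G.bar G.tail = α
    · rw [← h, delta_self, heaviside, if_neg (lt_irrefl _)]; norm_num
    · have : G.pos α ≠ G.pos (G.bar G.tail) := fun h' => h (G.pos_injective h').symm
      have hle := G.pos_le_bar_tail α
      rw [delta_of_ne h, heaviside, if_pos (by omega)]; norm_num
  · rw [delta_of_ne hp, heaviside, heaviside, G.pos_boundary hp]
    by_cases h : p = α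
    · rw [← h, delta_self]; simp
    · have : G.pos α ≠ G.pos p := fun h' => h (G.pos_injective h').symm
      rw [delta_of_ne h]
      by_cases h2 : G.pos α < G.pos p
      · rw [if_pos h2, if_pos (by omega)]; norm_num
      · rw [if_neg h2, if_neg (by omega)]; norm_num

/-- The linking number of the pairs of positions of two edges on the boundary cycle. -/
def linking (a x : D) : ℚ :=
  G.heaviside a (G.boundary x) - G.heaviside (G.bar a) (G.boundary x) -
    (G.heaviside a (G.bar x) - G.heaviside (G.bar a) (G.bar x))

theorem linking_eq (a x : D) : G.linking a x =
    (G.heaviside a x - G.heaviside a (G.bar x)) -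
      ((G.heaviside (G.bar a) x + delta (G.bar a) x) -
        (G.heaviside (G.bar a) (G.bar x) + delta (G.bar a) (G.bar x))) := by
  rw [linking, heaviside_boundary, heaviside_boundary, G.delta_bar, G.bar_bar]
  ring

/-- Since `boundary x` is `bar (next x)`, the three linking numbers at a vertex telescope. -/
theorem linking_isFlow (a : D) : G.IsFlow (G.linking a) := by
  refine ⟨fun x => ?_, fun x _ => ?_⟩
  · simp only [linking, heaviside_boundary, bar_bar, delta_bar]
    ring
  · simp only [linking, boundary_apply, next_next_next]
    ring

/-- Discrete integration by parts: `γ` jumps only after `a` and `bar a`, so a sum of `γ` against the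
flow along the boundary cycle localises there (`s4`). Reindexing around the vertices reduces the
whole expression to -3 times that sum. -/
theorem sum_linking_mul [Fintype D] (a : D) {m : D → ℚ} (hm : G.IsFlow m)
    (h0 : m (G.bar G.tail) = 0) :
    ∑ x, (G.linking a x * m (G.next x) - G.linking a (G.next x) * m x) = 6 * m a := by
  have hv : ∀ x, m x + m (G.next x) + m (G.next (G.next x)) = 0 := by
    intro x
    by_cases hx : x = G.bar G.tail
    · rw [hx, G.univalent, G.univalent, h0]; norm_num
    · exact hm.2 x hx
  set γ : D → ℚ := fun p => G.heaviside a p - G.heaviside (G.bar a) p with hγ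
  have hγb : ∀ p, γ (G.boundary p) = γ p + delta a p - delta (G.bar a) p := fun p => by
    simp only [hγ, heaviside_boundary]; ring
  have hlk : ∀ x, G.linking a x = γ (G.bar (G.next x)) - γ (G.bar x) := fun x => rfl
  have hshift : ∀ F : D → ℚ, ∑ x, F (G.next x) = ∑ x, F x := fun F => Equiv.sum_comp G.next F
  have s0 : ∑ x, γ (G.bar (G.next x)) * m (G.next x) = ∑ x, γ (G.bar x) * m x :=
    hshift fun x => γ (G.bar x) * m x
  have s1 : ∑ x, γ (G.bar (G.next x)) * m (G.next (G.next x)) =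
      ∑ x, γ (G.bar x) * m (G.next x) := hshift fun x => γ (G.bar x) * m (G.next x)
  have s2 : ∑ x, γ (G.bar (G.next (G.next x))) * m x =
      ∑ x, γ (G.bar (G.next x)) * m (G.next (G.next x)) := by
    rw [← hshift fun x => γ (G.bar (G.next x)) * m (G.next (G.next x))]
    simp only [next_next_next]
  have s3 : ∑ x, γ (G.bar (G.next x)) * m x = ∑ x, γ (G.bar x) * m (G.next (G.next x)) := by
    rw [← hshift fun x => γ (G.bar x) * m (G.next (G.next x))]
    simp only [next_next_next]
  have s4 : ∑ x, γ (G.bar (G.next x)) * (m (G.next (G.next x))) = -2 * m a := by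
    have e1 : ∀ x, γ (G.bar (G.next x)) * m (G.next (G.next x)) =
        γ (G.boundary x) * m (G.boundary x) - γ x * m x - delta a x * m x +
          delta (G.bar a) x * m x := by
      intro x
      have h1 : m (G.boundary x) = -m (G.next x) := hm.1 _
      have h2 := hγb x
      have h3 := hv x
      rw [← boundary_apply, h1, h2]
      linear_combination (γ x + delta a x - delta (G.bar a) x) * h3
    simp only [e1, Finset.sum_add_distrib, Finset.sum_sub_distrib, sum_delta_mul]
    rw [Equiv.sum_comp G.boundary (fun x => γ x * m x), hm.1]
    ring
  have s5 : ∑ x, γ (G.bar x) * m x + ∑ x, γ (G.bar x) * m (G.next x) +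
      ∑ x, γ (G.bar x) * m (G.next (G.next x)) = 0 := by
    rw [← Finset.sum_add_distrib, ← Finset.sum_add_distrib]
    refine Finset.sum_eq_zero fun x _ => ?_
    linear_combination γ (G.bar x) * hv x
  simp only [hlk, sub_mul, Finset.sum_sub_distrib]
  rw [s0, s2, s1, s3]
  rw [s1] at s4
  linear_combination s5 - 3 * s4

end Fatgraph

namespace MarkedFatgraph

variable {g : ℕ} {D : Type*} [Finite D] (G : MarkedFatgraph g D)

/-- The intersection number of the classes of two edges is minus their linking number. -/
theorem intersection_hmark (a x : D) :
    intersection g (G.hmark a) (G.hmark x) = -G.linking a x := by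
  have := Fintype.ofFinite D
  obtain ⟨l, hl⟩ := G.exists_dual_of_isFlow (G.linking_isFlow a)
  -- Contracting the symplectic tensor with the functional `l` of linking numbers gives the class of
  -- `a`: the factor 1/6 of `symplectic_eq` cancels the 6 of `sum_linking_mul`. Coordinate
  -- functionals then determine `l`.
  have key : ∀ μ : Module.Dual ℚ (Hlgy g), ∑ i : Fin g,
      (l (Pi.single (Sum.inl i) 1) * μ (Pi.single (Sum.inr i) 1) -
        l (Pi.single (Sum.inr i) 1) * μ (Pi.single (Sum.inl i) 1)) = μ (G.hmark a) := by
    intro μ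
    have h := G.sum_linking_mul a (G.hmark_isFlow.map μ.toAddMonoidHom)
      (by rw [G.hmark_bar_tail, map_zero])
    rw [G.symplectic_eq l μ]
    simp only [hl] at h
    change ∑ x, (l (G.hmark x) * μ (G.hmark (G.next x)) -
      l (G.hmark (G.next x)) * μ (G.hmark x)) = 6 * μ (G.hmark a) at h
    rw [h]
    ring
  have hu : ∀ j, l (Pi.single (Sum.inl j) 1) = G.hmark a (Sum.inr j) := fun j => by
    have := key (LinearMap.proj (Sum.inr j))
    simpa [Pi.single_apply] using this
  have hv : ∀ j, l (Pi.single (Sum.inr j) 1) = -G.hmark a (Sum.inl j) := fun j => by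
    have := key (LinearMap.proj (Sum.inl j))
    simp [Pi.single_apply] at this
    linarith
  rw [hl x, intersection_apply, LinearMap.pi_apply_eq_sum_univ l (G.hmark x),
    Fintype.sum_sum_type, ← Finset.sum_add_distrib, ← Finset.sum_neg_distrib]
  refine Finset.sum_congr rfl fun i _ => ?_
  have e : ∀ k : Fin g ⊕ Fin g, (fun j => if k = j then (1 : ℚ) else 0) = Pi.single k 1 :=
    fun k => by ext j; simp [Pi.single_apply, eq_comm]
  rw [e, e, hu, hv, smul_eq_mul, smul_eq_mul]
  ring

end MarkedFatgraph

/-! ## The fatgraph Johnson map of a Whitehead move -/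

theorem expT_injective {g : ℕ} {w v : CompletedTensor g} (hw : InFiltration 1 w)
    (hv : InFiltration 1 v) (h : expT w = expT v) : w = v :=
  Subtype.ext (expSeries_injective (inFiltration_iff.mp hw) (inFiltration_iff.mp hv)
    (congrArg Subtype.val h))

namespace Fatgraph

variable {D : Type*} (G : Fatgraph D)

theorem heaviside_tail (α : D) : G.heaviside α G.tail = 0 := by
  rw [heaviside, G.pos_tail]; simp

/-- The sum of the contributions of the corners of a quadrilateral to a potential. -/
def cornerSum {W : Type*} [AddCommGroup W] [Module ℚ W] (a b c d : D) (P Q R S : W) (x : D) : W :=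
  -(G.heaviside a x • Q) + G.heaviside b x • R - G.heaviside c x • P + G.heaviside d x • S

variable [Finite D]

theorem cornerSum_boundary {W : Type*} [AddCommGroup W] [Module ℚ W] (a b c d : D) (P Q R S : W)
    {x : D} (hx : x ≠ G.bar G.tail) :
    G.cornerSum a b c d P Q R S (G.boundary x) = G.cornerSum a b c d P Q R S x - delta a x • Q +
      delta b x • R - delta c x • P + delta d x • S := by
  simp only [cornerSum, heaviside_boundary, delta_of_ne hx]
  module

/-- Moving the threshold one step along the cycle loses exactly one point, which `delta` restores.
-/
theorem heaviside_boundary_left {α : D} (h : α ≠ G.bar G.tail) (p : D) :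
    G.heaviside (G.boundary α) p + delta (G.boundary α) p = G.heaviside α p := by
  rw [heaviside, heaviside, G.pos_boundary h]
  by_cases hp : p = G.boundary α
  · rw [hp, delta_self, G.pos_boundary h]; simp
  · have : G.pos p ≠ G.pos α + 1 := fun h' =>
      hp (G.pos_injective (h'.trans (G.pos_boundary h).symm))
    rw [delta_of_ne hp]
    by_cases h2 : G.pos α < G.pos p
    · rw [if_pos h2, if_pos (by omega)]; norm_num
    · rw [if_neg h2, if_neg (by omega)]; norm_num

end Fatgraph

namespace MarkedFatgraph

variable {g : ℕ} {D : Type*} [Finite D] (G : MarkedFatgraph g D)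

/-- The series of a sector, as an element of the completed tensor algebra. -/
def sectorT (x : D) : CompletedTensor g :=
  -(G.ellT x + G.ellT (G.next x) + G.ellT (G.next (G.next x)))

theorem coe_sectorT {x : D} (h : x ≠ G.bar G.tail) :
    (G.sectorT x : PowerSeries (TA g)) = G.sector x := by
  have := G.ell_vertex h
  change -(G.ell x + G.ell (G.next x) + G.ell (G.next (G.next x))) = _
  rw [neg_eq_iff_add_eq_zero, this]

theorem ellT_bar (x : D) : G.ellT (G.bar x) = -G.ellT x := Subtype.ext (G.ell_bar x)

theorem coe_potential_sectorT (x : D) :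
    ((G.potential G.sectorT x : CompletedTensor g) : PowerSeries (TA g)) =
      G.potential G.sector x := by
  refine G.eq_potential (F := fun x =>
    ((G.potential G.sectorT x : CompletedTensor g) : PowerSeries (TA g))) G.sector ?_
    (fun y hy => ?_) x
  · rw [G.potential_tail]; rfl
  · rw [G.potential_boundary _ hy, ← G.coe_sectorT hy]; rfl

theorem ellT_eq (x : D) : G.ellT x = ofH (G.hmark x) +
    (1 / 3 : ℚ) • (G.potential G.sectorT x - G.potential G.sectorT (G.bar x)) := by
  refine Subtype.ext ?_
  have := G.ell_eq x
  rw [← coe_potential_sectorT, ← coe_potential_sectorT] at this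
  exact this

theorem expT_ellT_vertex {x : D} (h : x ≠ G.bar G.tail) :
    expT (G.ellT x) * expT (G.ellT (G.next x)) * expT (G.ellT (G.next (G.next x))) = 1 :=
  Subtype.ext (G.expSeries_ell_vertex h)

end MarkedFatgraph

/-! ### The quadrilateral of a Whitehead move -/

namespace IsWhiteheadMove

variable {g : ℕ} {D D' : Type*} {G : MarkedFatgraph g D} {G' : MarkedFatgraph g D'} {φ : D ≃ D'}
  {a b c d e : D} (hW : IsWhiteheadMove G G' φ a b c d e)
include hW

theorem bar_e_ne : G.bar e ≠ G.bar G.tail := fun h => hW.ne_tail (G.bar.injective h)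

theorem ne_first : a ≠ b ∧ a ≠ e ∧ b ≠ e := by
  have h := (G.trivalent e hW.ne_bar_tail).1
  rw [hW.next_e] at h
  refine ⟨?_, h, ?_⟩
  · rintro rfl
    exact h (hW.next_a.symm.trans hW.next_b)
  · rintro rfl
    exact h (hW.next_e.symm.trans hW.next_b)

theorem ne_second : c ≠ d ∧ c ≠ G.bar e ∧ d ≠ G.bar e := by
  have h := (G.trivalent _ hW.bar_e_ne).1
  rw [hW.next_bar_e] at h
  refine ⟨?_, h, ?_⟩
  · rintro rfl
    exact h (hW.next_c.symm.trans hW.next_d)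
  · intro h'
    have := hW.next_d
    rw [h', hW.next_bar_e] at this
    exact h this

theorem ne_cross {x y : D} (hx : x = a ∨ x = b ∨ x = e) (hy : y = c ∨ y = d ∨ y = G.bar e) :
    x ≠ y := by
  have hx' : G.next.SameCycle e x := by
    rcases hx with rfl | rfl | rfl
    · exact ⟨1, by simpa using hW.next_e⟩
    · exact ⟨2, by
        rw [zpow_two, Equiv.Perm.mul_apply, hW.next_e, hW.next_a]⟩
    · exact Equiv.Perm.SameCycle.refl _ _
  have hy' : G.next.SameCycle (G.bar e) y := by
    rcases hy with rfl | rfl | rfl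
    · exact ⟨1, by simpa using hW.next_bar_e⟩
    · exact ⟨2, by
        rw [zpow_two, Equiv.Perm.mul_apply, hW.next_bar_e, hW.next_c]⟩
    · exact Equiv.Perm.SameCycle.refl _ _
  rintro rfl
  exact hW.distinct_endpoints (hx'.trans hy'.symm)

theorem a_ne_bar_tail : a ≠ G.bar G.tail := by
  rintro rfl
  exact hW.ne_first.1 (G.univalent.symm.trans hW.next_a)

theorem b_ne_bar_tail : b ≠ G.bar G.tail := by
  rintro rfl
  exact hW.ne_first.2.2 (G.univalent.symm.trans hW.next_b)

theorem c_ne_bar_tail : c ≠ G.bar G.tail := by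
  rintro rfl
  exact hW.ne_second.1 (G.univalent.symm.trans hW.next_c)

theorem d_ne_bar_tail : d ≠ G.bar G.tail := by
  rintro rfl
  exact hW.ne_second.2.2 (G.univalent.symm.trans hW.next_d)

theorem map_bar_tail : φ (G.bar G.tail) = G'.bar G'.tail := by rw [hW.map_bar, hW.map_tail]

theorem map_ne_bar_tail {x : D} (h : x ≠ G.bar G.tail) : φ x ≠ G'.bar G'.tail := fun h' =>
  h (φ.injective (h'.trans hW.map_bar_tail.symm))

theorem hmark_map {x : D} (h : x ≠ e) (h' : x ≠ G.bar e) : G'.hmark (φ x) = G.hmark x := by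
  rw [MarkedFatgraph.hmark, hW.mark' x h h', MarkedFatgraph.hmark]

variable [Finite D]

/-- The difference of the potentials of the two fatgraphs. -/
theorem potential_sub {lam : D' → CompletedTensor g}
    (hlam : ∀ x, x ≠ e → x ≠ G.bar e → lam (φ x) = G.ellT x)
    (hbar : lam (φ (G.bar e)) = -lam (φ e)) {F' : D' → CompletedTensor g}
    (hF0 : F' G'.tail = 0) (hF : ∀ x, x ≠ G'.bar G'.tail → F' (G'.boundary x) = F' x -
      (lam x + lam (G'.next x) + lam (G'.next (G'.next x))))
    {P Q R S : CompletedTensor g}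
    (hP : P = -(G.ellT a + G.ellT b + G.ellT e)) (hQ : Q = -(G.ellT c + G.ellT d - G.ellT e))
    (hR : R = -(G.ellT d + G.ellT a + lam (φ e))) (hS : S = -(G.ellT b + G.ellT c - lam (φ e)))
    {x : D} (hxe : x ≠ e) (hxe' : x ≠ G.bar e) :
    G.potential G.sectorT x - F' (φ x) = G.cornerSum a b c d P Q R S x := by
  obtain ⟨hab, hae, hbe⟩ := hW.ne_first
  obtain ⟨hcd, hce, hde⟩ := hW.ne_second
  have hac : a ≠ c := hW.ne_cross (by simp) (by simp)
  have had : a ≠ d := hW.ne_cross (by simp) (by simp)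
  have hae' : a ≠ G.bar e := hW.ne_cross (by simp) (by simp)
  have hbc : b ≠ c := hW.ne_cross (by simp) (by simp)
  have hbd : b ≠ d := hW.ne_cross (by simp) (by simp)
  have hbe' : b ≠ G.bar e := hW.ne_cross (by simp) (by simp)
  have hec : e ≠ c := hW.ne_cross (by simp) (by simp)
  have hed : e ≠ d := hW.ne_cross (by simp) (by simp)
  have hee' : e ≠ G.bar e := hW.ne_cross (by simp) (by simp)
  have la := hlam a hae hae'
  have lb := hlam b hbe hbe'
  have lc := hlam c hec.symm hce
  have ld := hlam d hed.symm hde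
  have hi : ∀ {y z : D}, G.next y = G.next z → y = z := fun h => G.next.injective h
  -- Induction along the boundary cycle of G. The common edges occur in the same order on both
  -- cycles, so only the corners passed between consecutive ones have to be compared.
  suffices H : ∀ n x, G.pos x = n → x ≠ e → x ≠ G.bar e →
      G.potential G.sectorT x - F' (φ x) = G.cornerSum a b c d P Q R S x from H _ x rfl hxe hxe'
  intro n
  induction n using Nat.strong_induction_on with
  | _ n ih =>
    intro x hn hxe hxe'
    rcases Nat.eq_zero_or_pos n with rfl | hpos
    · obtain rfl : x = G.tail := G.pos_injective (hn.trans G.pos_tail.symm)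
      rw [G.potential_tail, hW.map_tail, hF0, Fatgraph.cornerSum]
      simp [G.heaviside_tail]
    obtain ⟨y, rfl⟩ := G.boundary.surjective x
    have hy : y ≠ G.bar G.tail := by
      rintro rfl
      rw [G.boundary_bar_tail, G.pos_tail] at hn
      omega
    have hpy := G.pos_boundary hy
    have hyb : y ≠ b := by
      rintro rfl
      rw [G.boundary_apply, hW.next_b] at hxe'
      exact hxe' rfl
    have hyd : y ≠ d := by
      rintro rfl
      rw [G.boundary_apply, hW.next_d, G.bar_bar] at hxe
      exact hxe rfl
    -- Between d and bar a, G turns at the corners Q and P, and G' at R only: the jump is P + Q - R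
    -- = S.
    by_cases hye : y = e
    · subst hye
      have b1 : G.boundary d = y := by rw [G.boundary_apply, hW.next_d, G.bar_bar]
      have hpd := G.pos_boundary hW.d_ne_bar_tail
      rw [b1] at hpd
      have h1 := ih (G.pos d) (by omega) d rfl hed.symm hde
      have b2 : φ (G.boundary y) = G'.boundary (φ d) := by
        rw [G.boundary_apply, G'.boundary_apply, hW.next_e, hW.next'_d, hW.map_bar]
      have p1 := G.potential_boundary G.sectorT hW.d_ne_bar_tail
      have k1 := G.cornerSum_boundary a b c d P Q R S hW.d_ne_bar_tail
      rw [b1] at p1 k1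
      rw [Fatgraph.delta_of_ne had.symm, Fatgraph.delta_of_ne hbd.symm,
        Fatgraph.delta_of_ne hcd.symm, Fatgraph.delta_self] at k1
      rw [b2, hF _ (hW.map_ne_bar_tail hW.d_ne_bar_tail), hW.next'_d, hW.next'_a,
        G.potential_boundary _ hy, p1, G.cornerSum_boundary _ _ _ _ _ _ _ _ hy, k1, ← h1, ld, la,
        Fatgraph.delta_of_ne hae.symm, Fatgraph.delta_of_ne hbe.symm, Fatgraph.delta_of_ne hec,
        Fatgraph.delta_of_ne hed, MarkedFatgraph.sectorT, MarkedFatgraph.sectorT, hW.next_d,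
        hW.next_bar_e, hW.next_e, hW.next_a, G.ellT_bar, hS]
      module
    -- Between b and bar c, G turns at P and Q, and G' at S only: the jump is R.
    by_cases hye' : y = G.bar e
    · subst hye'
      have b1 : G.boundary b = G.bar e := by rw [G.boundary_apply, hW.next_b]
      have hpb := G.pos_boundary hW.b_ne_bar_tail
      rw [b1] at hpb
      have h1 := ih (G.pos b) (by omega) b rfl hbe hbe'
      have b2 : φ (G.boundary (G.bar e)) = G'.boundary (φ b) := by
        rw [G.boundary_apply, G'.boundary_apply, hW.next_bar_e, hW.next'_b, hW.map_bar]
      have p1 := G.potential_boundary G.sectorT hW.b_ne_bar_tail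
      have k1 := G.cornerSum_boundary a b c d P Q R S hW.b_ne_bar_tail
      rw [b1] at p1 k1
      rw [Fatgraph.delta_of_ne hab.symm, Fatgraph.delta_self, Fatgraph.delta_of_ne hbc,
        Fatgraph.delta_of_ne hbd] at k1
      rw [b2, hF _ (hW.map_ne_bar_tail hW.b_ne_bar_tail), hW.next'_b, hW.next'_c,
        G.potential_boundary _ hy, p1, G.cornerSum_boundary _ _ _ _ _ _ _ _ hy, k1, ← h1, lb, lc,
        hbar,
        Fatgraph.delta_of_ne hae'.symm, Fatgraph.delta_of_ne hbe'.symm,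
        Fatgraph.delta_of_ne hce.symm, Fatgraph.delta_of_ne hde.symm, MarkedFatgraph.sectorT,
        MarkedFatgraph.sectorT, hW.next_b, hW.next_e, hW.next_bar_e, hW.next_c, G.ellT_bar, hR]
      module
    have h1 := ih (G.pos y) (by omega) y rfl hye hye'
    -- Between a and bar b, G turns at P only, and G' at R and S: the jump is -Q.
    by_cases hya : y = a
    · subst hya
      have b2 : φ (G.boundary y) = G'.boundary (G'.boundary (φ y)) := by
        rw [G.boundary_apply, G'.boundary_apply, G'.boundary_apply, hW.next_a, hW.next'_a,
          ← hW.map_bar, hW.next'_bar_e, hW.map_bar]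
      have b3 : G'.boundary (φ y) = φ (G.bar e) := by
        rw [G'.boundary_apply, hW.next'_a, hW.map_bar]
      rw [b2, b3, hF _ (hW.map_ne_bar_tail hW.bar_e_ne), ← b3, hF _ (hW.map_ne_bar_tail hy), b3,
        hW.next'_a, hW.next'_e, hW.next'_bar_e, hW.next'_b, G.potential_boundary _ hy,
        G.cornerSum_boundary _ _ _ _ _ _ _ _ hy, ← h1, la, lb, lc, ld, hbar, Fatgraph.delta_self,
        Fatgraph.delta_of_ne hab, Fatgraph.delta_of_ne hac, Fatgraph.delta_of_ne had,
        MarkedFatgraph.sectorT, hW.next_a, hW.next_b, hQ]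
      module
    -- Between c and bar d, G turns at Q only, and G' at S and R: the jump is -P.
    by_cases hyc : y = c
    · subst hyc
      have b2 : φ (G.boundary y) = G'.boundary (G'.boundary (φ y)) := by
        rw [G.boundary_apply, G'.boundary_apply, G'.boundary_apply, hW.next_c, hW.next'_c,
          ← hW.map_bar, G.bar_bar, hW.next'_e, hW.map_bar]
      have b3 : G'.boundary (φ y) = φ e := by
        rw [G'.boundary_apply, hW.next'_c, ← hW.map_bar, G.bar_bar]
      rw [b2, b3, hF _ (hW.map_ne_bar_tail hW.ne_bar_tail), ← b3, hF _ (hW.map_ne_bar_tail hy),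
        b3, hW.next'_c, hW.next'_bar_e, hW.next'_e, hW.next'_d, G.potential_boundary _ hy,
        G.cornerSum_boundary _ _ _ _ _ _ _ _ hy, ← h1, la, lb, lc, ld, hbar, Fatgraph.delta_self,
        Fatgraph.delta_of_ne hac.symm, Fatgraph.delta_of_ne hbc.symm, Fatgraph.delta_of_ne hcd,
        MarkedFatgraph.sectorT, hW.next_c, hW.next_d, G.ellT_bar, hP]
      module
    -- At any other vertex all incident edges are common to both fatgraphs, and the corner series
    -- coincide.
    have n1 : G'.next (φ y) = φ (G.next y) := hW.next'_other y hya hyb hyc hyd hye hye'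
    have n2 : G'.next (φ (G.next y)) = φ (G.next (G.next y)) := by
      refine hW.next'_other _ ?_ ?_ ?_ ?_ ?_ ?_
      · rw [← hW.next_e]; exact fun h => hye (hi h)
      · rw [← hW.next_a]; exact fun h => hya (hi h)
      · rw [← hW.next_bar_e]; exact fun h => hye' (hi h)
      · rw [← hW.next_c]; exact fun h => hyc (hi h)
      · conv_rhs => rw [← hW.next_b]
        exact fun h => hyb (hi h)
      · rw [← hW.next_d]; exact fun h => hyd (hi h)
    have m1 : lam (φ (G.next y)) = G.ellT (G.next y) := by
      refine hlam _ ?_ ?_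
      · conv_rhs => rw [← hW.next_b]
        exact fun h => hyb (hi h)
      · rw [← hW.next_d]; exact fun h => hyd (hi h)
    have m2 : lam (φ (G.next (G.next y))) = G.ellT (G.next (G.next y)) := by
      refine hlam _ ?_ ?_
      · conv_rhs => rw [← hW.next_b, ← hW.next_a]
        exact fun h => hya (hi (hi h))
      · rw [← hW.next_d, ← hW.next_c]; exact fun h => hyc (hi (hi h))
    have b2 : φ (G.boundary y) = G'.boundary (φ y) := by
      rw [G.boundary_apply, G'.boundary_apply, n1, hW.map_bar]
    rw [b2, hF _ (hW.map_ne_bar_tail hy), n1, n2, m1, m2, hlam y hye hye',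
      G.potential_boundary _ hy, G.cornerSum_boundary _ _ _ _ _ _ _ _ hy, ← h1,
      Fatgraph.delta_of_ne hya,
      Fatgraph.delta_of_ne hyb, Fatgraph.delta_of_ne hyc, Fatgraph.delta_of_ne hyd,
      MarkedFatgraph.sectorT]
    module

/-- The intersection numbers with the sides of the quadrilateral, in terms of its corners. -/
theorem intersection_eq {x : D} (hxe : x ≠ e) (hxe' : x ≠ G.bar e) :
    let N := fun α => G.heaviside α x - G.heaviside α (G.bar x)
    intersection g (G.hmark a) (G.hmark x) = N d - N a ∧
    intersection g (G.hmark b) (G.hmark x) = N a - N b ∧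
    intersection g (G.hmark c) (G.hmark x) = N b - N c := by
  have hb1 : G.bar x ≠ e := fun h => hxe' (by rw [← h, G.bar_bar])
  have hb2 : G.bar x ≠ G.bar e := fun h => hxe (G.bar.injective h)
  have ba : G.bar a = G.boundary e := by rw [G.boundary_apply, hW.next_e]
  have be : e = G.boundary d := by rw [G.boundary_apply, hW.next_d, G.bar_bar]
  have bb : G.bar b = G.boundary a := by rw [G.boundary_apply, hW.next_a]
  have bc : G.bar c = G.boundary (G.bar e) := by rw [G.boundary_apply, hW.next_bar_e]
  have be' : G.bar e = G.boundary b := by rw [G.boundary_apply, hW.next_b]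
  -- `d`, `e`, `bar a` are consecutive on the boundary cycle, so the thresholds after `d` and from
  -- `bar a` on differ only at `e`. Thus reverses of sides are replaced by the preceding sides.
  have ka : ∀ p, p ≠ e → G.heaviside (G.bar a) p + Fatgraph.delta (G.bar a) p =
      G.heaviside d p := fun p hp => by
    rw [ba, G.heaviside_boundary_left hW.ne_bar_tail, ← G.heaviside_boundary_left hW.d_ne_bar_tail,
      ← be, Fatgraph.delta_of_ne hp, add_zero]
  have kb : ∀ p, G.heaviside (G.bar b) p + Fatgraph.delta (G.bar b) p = G.heaviside a p :=
    fun p => by rw [bb, G.heaviside_boundary_left hW.a_ne_bar_tail]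
  have kc : ∀ p, p ≠ G.bar e → G.heaviside (G.bar c) p + Fatgraph.delta (G.bar c) p =
      G.heaviside b p := fun p hp => by
    rw [bc, G.heaviside_boundary_left hW.bar_e_ne, ← G.heaviside_boundary_left hW.b_ne_bar_tail,
      ← be', Fatgraph.delta_of_ne hp, add_zero]
  refine ⟨?_, ?_, ?_⟩
  · rw [G.intersection_hmark, G.linking_eq, ka _ hxe, ka _ hb1]; ring
  · rw [G.intersection_hmark, G.linking_eq, kb, kb]; ring
  · rw [G.intersection_hmark, G.linking_eq, kc _ hxe', kc _ hb2]; ring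

/-- The fatgraph Johnson map of a Whitehead move on `H`. -/
theorem three_smul_johnson [Finite D'] {τ : CompletedTensor g ≃ₐ[ℚ] CompletedTensor g}
    (hτ : IsFatgraphJohnsonMap G G' τ) :
    ∃ P Q S : CompletedTensor g,
      (P : PowerSeries (TA g)) = hausdorff (G.ell a) (G.ell b) ∧
      (Q : PowerSeries (TA g)) = hausdorff (G.ell c) (G.ell d) ∧
      (S : PowerSeries (TA g)) = hausdorff (G.ell b) (G.ell c) ∧
      ∀ y : Hlgy g, (3 : ℚ) • (τ (ofH y) - ofH y) = intersection g (G.hmark a) y • S +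
        intersection g (G.hmark b) y • (S - Q) + intersection g (G.hmark c) y • P := by
  obtain ⟨hIA, θ, θ', hθ, hθ', hτθ⟩ := hτ
  obtain ⟨hab, hae, hbe⟩ := hW.ne_first
  obtain ⟨hcd, hce, hde⟩ := hW.ne_second
  have hae' : a ≠ G.bar e := hW.ne_cross (by simp) (by simp)
  have hbe' : b ≠ G.bar e := hW.ne_cross (by simp) (by simp)
  have hec : e ≠ c := hW.ne_cross (by simp) (by simp)
  set lam : D' → CompletedTensor g := fun x => τ (G'.ellT x) with hlamdef
  have hlam1 : ∀ x, InFiltration 1 (lam x) := fun x => (hIA.1 1 _).mpr (G'.ellT_inFiltration x)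
  have hexp : ∀ x, τ (expT (G'.ellT x)) = expT (lam x) := fun x =>
    hIA.map_expT (G'.ellT_inFiltration x)
  -- Common edges carry the same marking, so τ θ' = θ equates the two exponentials.
  have hlam : ∀ x, x ≠ e → x ≠ G.bar e → lam (φ x) = G.ellT x := fun x h h' => by
    refine expT_injective (hlam1 _) (G.ellT_inFiltration x) ?_
    rw [← hexp, ← hθ'.apply_mark, hτθ, hW.mark' x h h', hθ.apply_mark]
  have hbar : lam (φ (G.bar e)) = -lam (φ e) := by
    rw [hlamdef]
    simp only
    rw [hW.map_bar, G'.ellT_bar, map_neg]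
  set F' : D' → CompletedTensor g := fun x => τ (G'.potential G'.sectorT x) with hF'
  have hF0 : F' G'.tail = 0 := by
    rw [hF']; simp only
    rw [G'.potential_tail, map_zero]
  have hF : ∀ x, x ≠ G'.bar G'.tail → F' (G'.boundary x) = F' x -
      (lam x + lam (G'.next x) + lam (G'.next (G'.next x))) := fun x hx => by
    rw [hF']; simp only
    rw [G'.potential_boundary _ hx, map_add, MarkedFatgraph.sectorT, map_neg, map_add, map_add,
      ← sub_eq_add_neg]
  set P := -(G.ellT a + G.ellT b + G.ellT e) with hP
  set Q := -(G.ellT c + G.ellT d - G.ellT e) with hQ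
  set R := -(G.ellT d + G.ellT a + lam (φ e)) with hR
  set S := -(G.ellT b + G.ellT c - lam (φ e)) with hS
  refine ⟨P, Q, S, ?_, ?_, ?_, ?_⟩
  · have := G.coe_sectorT hW.a_ne_bar_tail
    rw [MarkedFatgraph.sectorT, MarkedFatgraph.sector, hW.next_a, hW.next_b] at this
    exact this
  · have := G.coe_sectorT hW.c_ne_bar_tail
    rw [MarkedFatgraph.sectorT, MarkedFatgraph.sector, hW.next_c, hW.next_d, G.ellT_bar,
      ← sub_eq_add_neg] at this
    exact this
  -- S belongs to the vertex (b, c, bar f) of G'. Its relation is transported by τ; the first two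
  -- edges are common to G, so the Hausdorff series is that of ℓ(b) and ℓ(c).
  · have h1 := congrArg τ (G'.expT_ellT_vertex (hW.map_ne_bar_tail hW.b_ne_bar_tail))
    rw [map_mul, map_mul, map_one, hexp, hexp, hexp, hW.next'_b, hW.next'_c, hlam b hbe hbe',
      hlam c hec.symm hce] at h1
    have h2 := hausdorff_of_expSeries_three_mul
      (inFiltration_iff.mp (hlam1 (φ (G.bar e)))) (congrArg Subtype.val h1)
    rw [hbar] at h2
    have h3 : (S : PowerSeries (TA g)) =
        -(G.ell b + G.ell c + ((-lam (φ e) : CompletedTensor g) : PowerSeries (TA g))) := by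
      rw [hS, sub_eq_add_neg]; rfl
    rw [h3, neg_eq_iff_add_eq_zero]
    exact h2
  have key : ∀ x, x ≠ e → x ≠ G.bar e →
      (3 : ℚ) • (τ (ofH (G.hmark x)) - ofH (G.hmark x)) =
      intersection g (G.hmark a) (G.hmark x) • S +
        intersection g (G.hmark b) (G.hmark x) • (S - Q) +
        intersection g (G.hmark c) (G.hmark x) • P := by
    intro x hx hx'
    have hb1 : G.bar x ≠ e := fun h => hx' (by rw [← h, G.bar_bar])
    have hb2 : G.bar x ≠ G.bar e := fun h => hx (G.bar.injective h)
    have q1 := hW.potential_sub hlam hbar hF0 hF hP hQ hR hS hx hx'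
    have q2 := hW.potential_sub hlam hbar hF0 hF hP hQ hR hS hb1 hb2
    have t1 := G.ellT_eq x
    have t2 := congrArg τ (G'.ellT_eq (φ x))
    rw [map_add, map_smul, map_sub, ← hW.map_bar, hW.hmark_map hx hx'] at t2
    change lam (φ x) = τ (ofH (G.hmark x)) + (1 / 3 : ℚ) • (F' (φ x) - F' (φ (G.bar x))) at t2
    rw [hlam x hx hx'] at t2
    obtain ⟨ia, ib, ic⟩ := hW.intersection_eq hx hx'
    -- The corner series at the ends of e, and likewise at those of f, add up to minus the sum of ℓ
    -- over the four sides.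
    have hPQRS : R = P + Q - S := by rw [hP, hQ, hR, hS]; module
    have s1 : (3 : ℚ) • (τ (ofH (G.hmark x)) - ofH (G.hmark x)) =
        G.cornerSum a b c d P Q R S x - G.cornerSum a b c d P Q R S (G.bar x) := by
      rw [← q1, ← q2]
      have t3 := t2.symm.trans t1
      rw [← eq_sub_iff_add_eq] at t3
      rw [t3]
      module
    rw [s1, ia, ib, ic, Fatgraph.cornerSum, Fatgraph.cornerSum, hPQRS]
    module
  have hlin : ∀ x, (3 : ℚ) • (τ (ofH (G.hmark x)) - ofH (G.hmark x)) =
      intersection g (G.hmark a) (G.hmark x) • S +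
        intersection g (G.hmark b) (G.hmark x) • (S - Q) +
        intersection g (G.hmark c) (G.hmark x) • P := by
    -- The class of e is a combination of those of two common edges, and both sides of the formula
    -- are linear.
    have he : G.hmark e = -(G.hmark a + G.hmark b) := by
      have := G.hmark_vertex hW.a_ne_bar_tail
      rw [hW.next_a, hW.next_b] at this
      rw [eq_neg_iff_add_eq_zero, ← this]; abel
    have hke : (3 : ℚ) • (τ (ofH (G.hmark e)) - ofH (G.hmark e)) =
      intersection g (G.hmark a) (G.hmark e) • S +
        intersection g (G.hmark b) (G.hmark e) • (S - Q) +
        intersection g (G.hmark c) (G.hmark e) • P := by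
      have ka := key a hae hae'
      have kb := key b hbe hbe'
      rw [he]
      simp only [map_neg, map_add]
      have : (3 : ℚ) • (-(τ (ofH (G.hmark a)) + τ (ofH (G.hmark b))) -
          -(ofH (G.hmark a) + ofH (G.hmark b))) =
          -((3 : ℚ) • (τ (ofH (G.hmark a)) - ofH (G.hmark a)) +
            (3 : ℚ) • (τ (ofH (G.hmark b)) - ofH (G.hmark b))) := by module
      rw [this, ka, kb]
      module
    intro x
    by_cases h1 : x = e
    · rw [h1, hke]
    by_cases h2 : x = G.bar e
    · rw [h2, G.hmark_bar]
      simp only [map_neg]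
      have : (3 : ℚ) • (-τ (ofH (G.hmark e)) - -ofH (G.hmark e)) =
          -((3 : ℚ) • (τ (ofH (G.hmark e)) - ofH (G.hmark e))) := by module
      rw [this, hke]
      module
    exact key x h1 h2
  let L₁ : Hlgy g →ₗ[ℚ] CompletedTensor g := (3 : ℚ) • (τ.toLinearMap ∘ₗ ofH - ofH)
  let L₂ : Hlgy g →ₗ[ℚ] CompletedTensor g := (intersection g (G.hmark a)).smulRight S +
    (intersection g (G.hmark b)).smulRight (S - Q) + (intersection g (G.hmark c)).smulRight P
  have hL : L₁ = L₂ := LinearMap.ext_on_range G.span_hmark hlin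
  exact fun y => LinearMap.congr_fun hL y

end IsWhiteheadMove

theorem tmul_mem_tensorLie {g n : ℕ} (x : Hlgy g) {w : TA g} (hw : w ∈ freeLiePart g n) :
    x ⊗ₜ[ℚ] w ∈ tensorLie g n := ⟨x ⊗ₜ[ℚ] ⟨w, hw⟩, by simp⟩

end

end FatgraphJohnson

open FatgraphJohnson
theorem theorem5p4 {g : ℕ} (hg : 0 < g) {D D' : Type*} [Finite D] [Finite D']
    (G : MarkedFatgraph g D) (G' : MarkedFatgraph g D') (φ : D ≃ D') (a b c d e : D)
    (hW : IsWhiteheadMove G G' φ a b c d e) :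
    (∃! τ : CompletedTensor g ≃ₐ[ℚ] CompletedTensor g, IsFatgraphJohnsonMap G G' τ) ∧
    ∀ τ : CompletedTensor g ≃ₐ[ℚ] CompletedTensor g, IsFatgraphJohnsonMap G G' τ →
      ∀ m : ℕ, 1 ≤ m →
        tensorComponent τ m ∈ tensorLie g (m + 1) ∧
        (3 : ℚ) • tensorComponent τ m =
          G.hmark a ⊗ₜ[ℚ] PowerSeries.coeff (m + 1) (hausdorff (G.ell b) (G.ell c))
          + G.hmark b ⊗ₜ[ℚ] PowerSeries.coeff (m + 1)
              (hausdorff (G.ell b) (G.ell c) - hausdorff (G.ell c) (G.ell d))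
          + G.hmark c ⊗ₜ[ℚ] PowerSeries.coeff (m + 1) (hausdorff (G.ell a) (G.ell b)) := by
  refine ⟨existsUnique_isFatgraphJohnsonMap G G', fun τ hτ m _ => ?_⟩
  have hL : ∀ x y, LieUpTo (m + 2) (hausdorff (G.ell x) (G.ell y)) := fun x y =>
    LieUpTo.hausdorff (G.ell_cong_zero x) (G.ell_cong_zero y) (G.ell_lieUpTo _ x)
      (G.ell_lieUpTo _ y)
  obtain ⟨P, Q, S, hP, hQ, hS, hτH⟩ := hW.three_smul_johnson hτ
  have hformula : (3 : ℚ) • tensorComponent τ m =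
      G.hmark a ⊗ₜ[ℚ] PowerSeries.coeff (m + 1) (hausdorff (G.ell b) (G.ell c))
      + G.hmark b ⊗ₜ[ℚ] PowerSeries.coeff (m + 1)
          (hausdorff (G.ell b) (G.ell c) - hausdorff (G.ell c) (G.ell d))
      + G.hmark c ⊗ₜ[ℚ] PowerSeries.coeff (m + 1) (hausdorff (G.ell a) (G.ell b)) := by
    -- By duality the identity of tensors becomes one of linear maps on H, the degree `m + 1` part
    -- of `three_smul_johnson`.
    rw [tensorComponent, ← map_smul, LinearEquiv.symm_apply_eq]
    refine LinearMap.ext fun y => ?_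
    simp only [map_add, LinearMap.add_apply, dualityEquiv_tmul]
    have h := congrArg (component (m + 1)) (hτH y)
    simp only [component_add, component_smul, component_sub] at h
    have e1 : component (m + 1) P = PowerSeries.coeff (m + 1) (hausdorff (G.ell a) (G.ell b)) := by
      rw [← hP]; rfl
    have e2 : component (m + 1) Q = PowerSeries.coeff (m + 1) (hausdorff (G.ell c) (G.ell d)) := by
      rw [← hQ]; rfl
    have e3 : component (m + 1) S = PowerSeries.coeff (m + 1) (hausdorff (G.ell b) (G.ell c)) := by
      rw [← hS]; rfl
    rw [e1, e2, e3] at h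
    rw [map_sub, ← h, ← component_sub]
    rfl
  refine ⟨?_, hformula⟩
  -- Membership is read off the formula, after division by 3.
  have h3 : tensorComponent τ m = (1 / 3 : ℚ) • ((3 : ℚ) • tensorComponent τ m) := by
    rw [smul_smul]; norm_num
  rw [h3, hformula]
  refine Submodule.smul_mem _ _ (Submodule.add_mem _ (Submodule.add_mem _ ?_ ?_) ?_)
  · exact tmul_mem_tensorLie _ (hL b c _ (by omega))
  · exact tmul_mem_tensorLie _ ((hL b c).sub (hL c d) _ (by omega))
  · exact tmul_mem_tensorLie _ (hL a b _ (by omega))
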